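/- Let $L>0$, $D_0>0$ and $K_0\in\mathbb R$, and let $\theta_0:(0,L)\to\mathbb R$ and $f,g:(0,\infty)\to\mathbb R$. Let $\theta$ be a bounded classical solution of $$\theta_t+K_0\theta_x=D_0\theta_{xx}\quad(0<x<L,\ t>0),\qquad \theta(x,0)=\theta_0(x),\quad \theta(0,t)=f(t),\quad \theta(L,t)=g(t).$$ This means: $\theta,\theta_t,\theta_x,\theta_{xx}$ exist and are continuous on $(0,L)\times(0,\infty)$ and satisfy the equation there; $\theta$ is bounded on $(0,L)\times(0,T)$ for every $T>0$; and the data are attained as pointwise limits, $\theta(x,t)\to\theta_0(x)$ as $t\to0^+$ for each $x\in(0,L)$, and $\theta(x,t)\to f(t)$ as $x\to0^+$, $\theta(x,t)\to g(t)$ as $x\to L^-$ for each $t>0$. Put $$\omega(\lambda)=D_0\lambda^2+iK_0\lambda,\quad \nu(\lambda)=-\lambda-i\tfrac{K_0}{D_0},\quad \Delta(\lambda)=e^{-i\lambda L}-e^{-i\nu(\lambda)L},$$ $$\mu(\lambda)=\lambda+i\tfrac{K_0}{2D_0},\quad \hat\theta_0(\lambda)=\int_0^L e^{-i\lambda x}\theta_0(x)\,dx,\quad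 \tilde f_0(k,t)=\int_0^t e^{k\tau}f(\tau)\,d\tau,\quad \tilde g_0(k,t)=\int_0^t e^{k\tau}g(\tau)\,d\tau,$$ and let $\partial D_\pm=\{\lambda\in\mathbb C:\operatorname{Re}\omega(\lambda)=0,\ \pm\operatorname{Im}\lambda>0\}$ (a curve, up to the single point $0$), oriented with $D_\pm=\{\operatorname{Re}\omega(\lambda)<0,\ \pm\operatorname{Im}\lambda>0\}$ on its left. Then for all $0<x<L$ and $t>0$ the following hold. (a) All integrals in the following formula converge absolutely, and $$\begin{aligned}\theta(x,t)={}&\frac1{2\pi}\int_{\mathbb R}e^{i\lambda x-\omega(\lambda)t}\hat\theta_0(\lambda)\,d\lambda +\frac i\pi e^{-\frac{K_0}{2D_0}(2L-x)}\int_{\partial D_+}\frac{e^{i\lambda L-\omega(\lambda)t}}{\Delta(\lambda)}\sin(x\mu(\lambda))\,\hat\theta_0(\lambda)\,d\lambda\\ &+\frac i\pi e^{-\frac{K_0}{2D_0}(L-x)}\int_{\partial D_+}\frac{e^{-\omega(\lambda)t}}{\Delta(\lambda)}\sin((L-x)\mu(\lambda))\,\hat\theta_0(\nu(\lambda))\,d\lambda\\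 &-\frac{2D_0}\pi e^{-\frac{K_0}{2D_0}(L-x)}\int_{\partial D_+}\frac{e^{-\omega(\lambda)t}}{\Delta(\lambda)}\mu(\lambda)\sin((L-x)\mu(\lambda))\,\tilde f_0(\omega(\lambda),t)\,d\lambda\\ &-\frac{2D_0}\pi e^{-\frac{K_0}{2D_0}(2L-x)}\int_{\partial D_+}\frac{e^{-\omega(\lambda)t}}{\Delta(\lambda)}\mu(\lambda)\sin(x\mu(\lambda))\,\tilde g_0(\omega(\lambda),t)\,d\lambda.\end{aligned}$$ (b) The change of variables $\lambda\mapsto\nu(\lambda)$ gives a representation over $\partial D_-$: all integrals in the following formula converge absolutely, and $$\begin{aligned}\theta(x,t)={}&\frac1{2\pi}\int_{\mathbb R}e^{i\lambda x-\omega(\lambda)t}\hat\theta_0(\lambda)\,d\lambda -\frac i\pi e^{-\frac{K_0}{2D_0}(2L-x)}\int_{\partial D_-}\frac{e^{i\nu(\lambda)L-\omega(\lambda)t}}{\Delta(\lambda)}\sin(x\mu(\lambda))\,\hat\theta_0(\nu(\lambda))\,d\lambda\\ &-\frac i\pi e^{-\frac{K_0}{2D_0}(L-x)}\int_{\partial D_-}\frac{e^{-\omega(\lambda)t}}{\Delta(\lambda)}\sin((L-x)\mu(\lambda))\,\hat\theta_0(\lambda)\,d\lambda\\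 &-\frac{2D_0}\pi e^{-\frac{K_0}{2D_0}(L-x)}\int_{\partial D_-}\frac{e^{-\omega(\lambda)t}}{\Delta(\lambda)}\mu(\lambda)\sin((L-x)\mu(\lambda))\,\tilde f_0(\omega(\lambda),t)\,d\lambda\\ &-\frac{2D_0}\pi e^{-\frac{K_0}{2D_0}(2L-x)}\int_{\partial D_-}\frac{e^{-\omega(\lambda)t}}{\Delta(\lambda)}\mu(\lambda)\sin(x\mu(\lambda))\,\tilde g_0(\omega(\lambda),t)\,d\lambda.\end{aligned}$$ (c) In particular, if $\theta_0=0$ on $(0,L)$, the formula in (a) holds verbatim with $\partial D_-$ in place of $\partial D_+$. -/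

import Mathlib

open Set Filter Topology MeasureTheory

namespace AdvectionDiffusion

noncomputable section

/-- A bounded classical solution of the problem
`θ_t + K₀ θ_x = D₀ θ_xx` for `0 < x < L`, `t > 0`, with `θ(x,0) = θ₀(x)`, `θ(0,t) = f(t)`,
`θ(L,t) = g(t)`. The first argument of `θ` is `x`, the second is `t`.
The solution is of class `C^{2,1}` in the open half-strip, is bounded up to every finite time,
and takes its initial and boundary data as pointwise limits; no compatibility of the data at the
corners `(0,0)`, `(L,0)` and no regularity of `θ_x` up to the boundary is asked for. -/
structure IsSolution (D₀ K₀ L : ℝ) (θ₀ f g : ℝ → ℝ) (θ : ℝ → ℝ → ℝ) : Prop where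
  differentiable_t : ∀ x ∈ Ioo 0 L, ∀ t > 0, DifferentiableAt ℝ (fun τ => θ x τ) t
  differentiable_x : ∀ x ∈ Ioo 0 L, ∀ t > 0, DifferentiableAt ℝ (fun ξ => θ ξ t) x
  differentiable_xx : ∀ x ∈ Ioo 0 L, ∀ t > 0, DifferentiableAt ℝ (deriv (fun ξ => θ ξ t)) x
  continuous : ContinuousOn (fun p : ℝ × ℝ => θ p.1 p.2) (Ioo 0 L ×ˢ Ioi 0)
  continuous_t :
    ContinuousOn (fun p : ℝ × ℝ => deriv (fun τ => θ p.1 τ) p.2) (Ioo 0 L ×ˢ Ioi 0)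
  continuous_x :
    ContinuousOn (fun p : ℝ × ℝ => deriv (fun ξ => θ ξ p.2) p.1) (Ioo 0 L ×ˢ Ioi 0)
  continuous_xx :
    ContinuousOn (fun p : ℝ × ℝ => deriv (deriv (fun ξ => θ ξ p.2)) p.1) (Ioo 0 L ×ˢ Ioi 0)
  pde : ∀ x ∈ Ioo 0 L, ∀ t > 0,
    deriv (fun τ => θ x τ) t + K₀ * deriv (fun ξ => θ ξ t) x
      = D₀ * deriv (deriv (fun ξ => θ ξ t)) x
  bounded : ∀ T > 0, ∃ C : ℝ, ∀ x ∈ Ioo 0 L, ∀ t ∈ Ioo 0 T, |θ x t| ≤ C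
  initial : ∀ x ∈ Ioo 0 L, Tendsto (fun t => θ x t) (𝓝[>] 0) (𝓝 (θ₀ x))
  left : ∀ t > 0, Tendsto (fun x => θ x t) (𝓝[>] 0) (𝓝 (f t))
  right : ∀ t > 0, Tendsto (fun x => θ x t) (𝓝[<] L) (𝓝 (g t))

/-- `ω(l) = D₀ l² + i K₀ l`. -/
def omega (D₀ K₀ : ℝ) (l : ℂ) : ℂ := D₀ * l ^ 2 + Complex.I * K₀ * l

/-- `ν(l) = -l - i K₀ / D₀`. -/
def nu (D₀ K₀ : ℝ) (l : ℂ) : ℂ := -l - Complex.I * (K₀ / D₀)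

/-- `Δ(l) = e^{-i l L} - e^{-i ν(l) L}`. -/
def Delta (D₀ K₀ L : ℝ) (l : ℂ) : ℂ :=
  Complex.exp (-(Complex.I * l * L)) - Complex.exp (-(Complex.I * nu D₀ K₀ l * L))

/-- `l + i K₀ / (2 D₀)`. -/
def shift (D₀ K₀ : ℝ) (l : ℂ) : ℂ := l + Complex.I * (K₀ / (2 * D₀))

/-- The transform `φ̂(l) = ∫₀ᴸ e^{-i l x} φ(x) dx`. -/
def fourierHat (L : ℝ) (φ : ℝ → ℝ) (l : ℂ) : ℂ :=
  ∫ x in (0 : ℝ)..L, Complex.exp (-(Complex.I * l * x)) * (φ x : ℂ)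

/-- The time transform `h̃(k,t) = ∫₀ᵗ e^{k τ} h(τ) dτ`. -/
def timeTransform (h : ℝ → ℝ) (k : ℂ) (t : ℝ) : ℂ :=
  ∫ τ in (0 : ℝ)..t, Complex.exp (k * τ) * (h τ : ℂ)

/-! ### The contours -/

/-- The domain `D₊`. -/
def domainPlus (D₀ K₀ : ℝ) : Set ℂ := {l | (omega D₀ K₀ l).re < 0 ∧ 0 < l.im}

/-- The domain `D₋`. -/
def domainMinus (D₀ K₀ : ℝ) : Set ℂ := {l | (omega D₀ K₀ l).re < 0 ∧ l.im < 0}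

/-- The point set `∂D₊`. -/
def boundaryPlus (D₀ K₀ : ℝ) : Set ℂ := {l | (omega D₀ K₀ l).re = 0 ∧ 0 < l.im}

/-- The point set `∂D₋`. -/
def boundaryMinus (D₀ K₀ : ℝ) : Set ℂ := {l | (omega D₀ K₀ l).re = 0 ∧ l.im < 0}

/-- The parametrization of `∂D₊` (a branch of a hyperbola, or two rays if `K₀ = 0`) by the real
part. It runs from left to right, so that `D₊`, which lies above it, is on its left. -/
def gammaPlus (D₀ K₀ : ℝ) (s : ℝ) : ℂ :=
  s + Complex.I * ((-(K₀ / (2 * D₀)) + √(s ^ 2 + (K₀ / (2 * D₀)) ^ 2) : ℝ) : ℂ)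

/-- The parametrization of `∂D₋`. It runs from right to left, so that `D₋`, which lies below it,
is on its left. -/
def gammaMinus (D₀ K₀ : ℝ) (s : ℝ) : ℂ :=
  -s + Complex.I * ((-(K₀ / (2 * D₀)) - √(s ^ 2 + (K₀ / (2 * D₀)) ^ 2) : ℝ) : ℂ)

/-- The integral `∫_γ F(l) dl` along a curve `γ : ℝ → ℂ`. -/
def contourIntegral (γ : ℝ → ℂ) (F : ℂ → ℂ) : ℂ := ∫ s : ℝ, F (γ s) * deriv γ s

/-- Absolute convergence of `∫_γ F(l) dl`. -/
def ContourIntegrable (γ : ℝ → ℂ) (F : ℂ → ℂ) : Prop :=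
  Integrable (fun s : ℝ => F (γ s) * deriv γ s)

theorem omega_nu {D₀ : ℝ} (hD : 0 < D₀) (K₀ : ℝ) (l : ℂ) :
    omega D₀ K₀ (nu D₀ K₀ l) = omega D₀ K₀ l := by
  have h : (D₀ : ℂ) ≠ 0 := by exact_mod_cast hD.ne'
  have hI : Complex.I ^ 2 = -1 := Complex.I_sq
  unfold omega nu
  field_simp
  ring_nf

theorem omega_re {D₀ : ℝ} (hD : 0 < D₀) (K₀ : ℝ) (l : ℂ) :
    (omega D₀ K₀ l).re
      = D₀ * (l.re ^ 2 + (K₀ / (2 * D₀)) ^ 2 - (l.im + K₀ / (2 * D₀)) ^ 2) := by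
  have h : (omega D₀ K₀ l).re = D₀ * (l.re ^ 2 - l.im ^ 2) - K₀ * l.im := by
    simp [omega, pow_two, sub_eq_add_neg]
  rw [h]
  field_simp
  ring

theorem nu_gammaPlus (D₀ K₀ s : ℝ) : nu D₀ K₀ (gammaPlus D₀ K₀ s) = gammaMinus D₀ K₀ s := by
  unfold nu gammaPlus gammaMinus
  push_cast
  ring

theorem gammaPlus_re (D₀ K₀ s : ℝ) : (gammaPlus D₀ K₀ s).re = s := by
  simp [gammaPlus, -Complex.ofReal_add, -Complex.ofReal_neg]

theorem gammaPlus_im (D₀ K₀ s : ℝ) :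
    (gammaPlus D₀ K₀ s).im = -(K₀ / (2 * D₀)) + √(s ^ 2 + (K₀ / (2 * D₀)) ^ 2) := by
  simp [gammaPlus, -Complex.ofReal_add, -Complex.ofReal_neg]

theorem gammaMinus_re (D₀ K₀ s : ℝ) : (gammaMinus D₀ K₀ s).re = -s := by
  simp [gammaMinus, -Complex.ofReal_sub, -Complex.ofReal_neg]

theorem gammaMinus_im (D₀ K₀ s : ℝ) :
    (gammaMinus D₀ K₀ s).im = -(K₀ / (2 * D₀)) - √(s ^ 2 + (K₀ / (2 * D₀)) ^ 2) := by
  simp [gammaMinus, -Complex.ofReal_sub, -Complex.ofReal_neg]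

/-- `gammaPlus` traces exactly `∂D₊`, up to the point `0`. -/
theorem range_gammaPlus {D₀ : ℝ} (hD : 0 < D₀) (K₀ : ℝ) :
    range (gammaPlus D₀ K₀) \ {0} = boundaryPlus D₀ K₀ := by
  ext l
  simp only [Set.mem_sdiff, mem_range, mem_singleton_iff, boundaryPlus, mem_ofPred_eq]
  rw [omega_re hD]
  generalize hk : K₀ / (2 * D₀) = k
  constructor
  · rintro ⟨⟨s, rfl⟩, h0⟩
    have hre := gammaPlus_re D₀ K₀ s
    have him := gammaPlus_im D₀ K₀ s
    rw [hk] at him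
    have hs : √(s ^ 2 + k ^ 2) ^ 2 = s ^ 2 + k ^ 2 := Real.sq_sqrt (by positivity)
    have hs0 := Real.sqrt_nonneg (s ^ 2 + k ^ 2)
    refine ⟨by rw [hre, him, neg_add_eq_sub, sub_add_cancel, hs]; ring, ?_⟩
    have hle : 0 ≤ (gammaPlus D₀ K₀ s).im := by
      rw [him]
      have := Real.le_sqrt_of_sq_le (x := k) (y := s ^ 2 + k ^ 2) (by nlinarith [sq_nonneg s])
      linarith
    refine lt_of_le_of_ne hle fun h => h0 ?_
    rw [him] at h
    have h1 : √(s ^ 2 + k ^ 2) = k := by linarith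
    rw [h1] at hs
    have h2 : s = 0 := by nlinarith [sq_nonneg s]
    apply Complex.ext
    · rw [hre, h2]; rfl
    · rw [him, ← h]; rfl
  · rintro ⟨h, hp⟩
    have h1 : (l.im + k) ^ 2 = l.re ^ 2 + k ^ 2 := by
      rcases mul_eq_zero.1 h with h | h
      · exact absurd h hD.ne'
      · linarith
    have h2 : 0 ≤ l.im + k := by nlinarith [sq_nonneg l.re]
    refine ⟨⟨l.re, Complex.ext (gammaPlus_re _ _ _) ?_⟩, fun h0 => by simp [h0] at hp⟩
    rw [gammaPlus_im, hk, ← h1, Real.sqrt_sq h2]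
    ring

/-- `gammaMinus` traces exactly `∂D₋`, up to the point `0`. -/
theorem range_gammaMinus {D₀ : ℝ} (hD : 0 < D₀) (K₀ : ℝ) :
    range (gammaMinus D₀ K₀) \ {0} = boundaryMinus D₀ K₀ := by
  ext l
  simp only [Set.mem_sdiff, mem_range, mem_singleton_iff, boundaryMinus, mem_ofPred_eq]
  rw [omega_re hD]
  generalize hk : K₀ / (2 * D₀) = k
  constructor
  · rintro ⟨⟨s, rfl⟩, h0⟩
    have hre := gammaMinus_re D₀ K₀ s
    have him := gammaMinus_im D₀ K₀ s
    rw [hk] at him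
    have hs : √(s ^ 2 + k ^ 2) ^ 2 = s ^ 2 + k ^ 2 := Real.sq_sqrt (by positivity)
    have hs0 := Real.sqrt_nonneg (s ^ 2 + k ^ 2)
    refine ⟨by rw [hre, him]; ring_nf; ring_nf at hs; rw [hs]; ring, ?_⟩
    have hle : (gammaMinus D₀ K₀ s).im ≤ 0 := by
      rw [him]
      have := Real.le_sqrt_of_sq_le (x := -k) (y := s ^ 2 + k ^ 2) (by nlinarith [sq_nonneg s])
      linarith
    refine lt_of_le_of_ne hle fun h => h0 ?_
    rw [him] at h
    have h1 : √(s ^ 2 + k ^ 2) = -k := by linarith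
    rw [h1] at hs
    have h2 : s = 0 := by nlinarith [sq_nonneg s]
    apply Complex.ext
    · rw [hre, h2]; simp
    · rw [him, h]; rfl
  · rintro ⟨h, hp⟩
    have h1 : (l.im + k) ^ 2 = l.re ^ 2 + k ^ 2 := by
      rcases mul_eq_zero.1 h with h | h
      · exact absurd h hD.ne'
      · linarith
    have h2 : 0 ≤ -(l.im + k) := by nlinarith [sq_nonneg l.re]
    refine ⟨⟨-l.re, Complex.ext (by rw [gammaMinus_re]; ring) ?_⟩,
      fun h0 => by simp [h0] at hp⟩
    rw [gammaMinus_im, hk, neg_sq, ← h1, ← neg_sq (l.im + k), Real.sqrt_sq h2]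
    ring

/-- `D₊` lies above `gammaPlus`, hence to its left. -/
theorem gammaPlus_add_mem {D₀ : ℝ} (hD : 0 < D₀) (K₀ s : ℝ) {ε : ℝ} (hε : 0 < ε) :
    gammaPlus D₀ K₀ s + Complex.I * ε ∈ domainPlus D₀ K₀ := by
  have hre : (gammaPlus D₀ K₀ s + Complex.I * ε).re = s := by simp [gammaPlus_re]
  have him : (gammaPlus D₀ K₀ s + Complex.I * ε).im
      = -(K₀ / (2 * D₀)) + √(s ^ 2 + (K₀ / (2 * D₀)) ^ 2) + ε := by simp [gammaPlus_im]
  simp only [domainPlus, mem_ofPred_eq]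
  rw [omega_re hD, hre, him]
  generalize K₀ / (2 * D₀) = k
  have hs : √(s ^ 2 + k ^ 2) ^ 2 = s ^ 2 + k ^ 2 := Real.sq_sqrt (by positivity)
  have hs0 := Real.sqrt_nonneg (s ^ 2 + k ^ 2)
  have := Real.le_sqrt_of_sq_le (x := k) (y := s ^ 2 + k ^ 2) (by nlinarith [sq_nonneg s])
  exact ⟨mul_neg_of_pos_of_neg hD (by nlinarith), by linarith⟩

/-- `D₋` lies below `gammaMinus`, hence to its left. -/
theorem gammaMinus_sub_mem {D₀ : ℝ} (hD : 0 < D₀) (K₀ s : ℝ) {ε : ℝ} (hε : 0 < ε) :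
    gammaMinus D₀ K₀ s - Complex.I * ε ∈ domainMinus D₀ K₀ := by
  have hre : (gammaMinus D₀ K₀ s - Complex.I * ε).re = -s := by simp [gammaMinus_re]
  have him : (gammaMinus D₀ K₀ s - Complex.I * ε).im
      = -(K₀ / (2 * D₀)) - √(s ^ 2 + (K₀ / (2 * D₀)) ^ 2) - ε := by simp [gammaMinus_im]
  simp only [domainMinus, mem_ofPred_eq]
  rw [omega_re hD, hre, him]
  generalize K₀ / (2 * D₀) = k
  have hs : √(s ^ 2 + k ^ 2) ^ 2 = s ^ 2 + k ^ 2 := Real.sq_sqrt (by positivity)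
  have hs0 := Real.sqrt_nonneg (s ^ 2 + k ^ 2)
  have := Real.le_sqrt_of_sq_le (x := -k) (y := s ^ 2 + k ^ 2) (by nlinarith [sq_nonneg s])
  exact ⟨mul_neg_of_pos_of_neg hD (by nlinarith), by linarith⟩

/-! ### The integrands -/

/-- `e^{i l x - ω(l) t} θ̂₀(l)`. -/
def lineIntegrand (D₀ K₀ L : ℝ) (θ₀ : ℝ → ℝ) (x t : ℝ) (l : ℂ) : ℂ :=
  Complex.exp (Complex.I * l * x - omega D₀ K₀ l * t) * fourierHat L θ₀ l

/-- `e^{i l L - ω(l) t} / Δ(l) · sin (x (l + i K₀/(2D₀))) · θ̂₀(l)`. -/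
def initialIntegrand₁ (D₀ K₀ L : ℝ) (θ₀ : ℝ → ℝ) (x t : ℝ) (l : ℂ) : ℂ :=
  Complex.exp (Complex.I * l * L - omega D₀ K₀ l * t) / Delta D₀ K₀ L l
    * Complex.sin (x * shift D₀ K₀ l) * fourierHat L θ₀ l

/-- `e^{- ω(l) t} / Δ(l) · sin ((L - x) (l + i K₀/(2D₀))) · θ̂₀(ν(l))`. -/
def initialIntegrand₂ (D₀ K₀ L : ℝ) (θ₀ : ℝ → ℝ) (x t : ℝ) (l : ℂ) : ℂ :=
  Complex.exp (-(omega D₀ K₀ l * t)) / Delta D₀ K₀ L l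
    * Complex.sin ((L - x) * shift D₀ K₀ l) * fourierHat L θ₀ (nu D₀ K₀ l)

/-- `e^{- ω(l) t} / Δ(l) · (l + i K₀/(2D₀)) · sin ((L - x) (l + i K₀/(2D₀))) · f̃₀(ω(l),t)`. -/
def leftIntegrand (D₀ K₀ L : ℝ) (f : ℝ → ℝ) (x t : ℝ) (l : ℂ) : ℂ :=
  Complex.exp (-(omega D₀ K₀ l * t)) / Delta D₀ K₀ L l * shift D₀ K₀ l
    * Complex.sin ((L - x) * shift D₀ K₀ l) * timeTransform f (omega D₀ K₀ l) t

/-- `e^{- ω(l) t} / Δ(l) · (l + i K₀/(2D₀)) · sin (x (l + i K₀/(2D₀))) · g̃₀(ω(l),t)`. -/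
def rightIntegrand (D₀ K₀ L : ℝ) (g : ℝ → ℝ) (x t : ℝ) (l : ℂ) : ℂ :=
  Complex.exp (-(omega D₀ K₀ l * t)) / Delta D₀ K₀ L l * shift D₀ K₀ l
    * Complex.sin (x * shift D₀ K₀ l) * timeTransform g (omega D₀ K₀ l) t

/-- `e^{i ν(l) L - ω(l) t} / Δ(l) · sin (x (l + i K₀/(2D₀))) · θ̂₀(ν(l))`. -/
def swappedIntegrand₁ (D₀ K₀ L : ℝ) (θ₀ : ℝ → ℝ) (x t : ℝ) (l : ℂ) : ℂ :=
  Complex.exp (Complex.I * nu D₀ K₀ l * L - omega D₀ K₀ l * t) / Delta D₀ K₀ L l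
    * Complex.sin (x * shift D₀ K₀ l) * fourierHat L θ₀ (nu D₀ K₀ l)

/-- `e^{- ω(l) t} / Δ(l) · sin ((L - x) (l + i K₀/(2D₀))) · θ̂₀(l)`. -/
def swappedIntegrand₂ (D₀ K₀ L : ℝ) (θ₀ : ℝ → ℝ) (x t : ℝ) (l : ℂ) : ℂ :=
  Complex.exp (-(omega D₀ K₀ l * t)) / Delta D₀ K₀ L l
    * Complex.sin ((L - x) * shift D₀ K₀ l) * fourierHat L θ₀ l

/-- The right-hand side of the representation formula, with the contour `γ`. -/
def representation (D₀ K₀ L : ℝ) (θ₀ f g : ℝ → ℝ) (γ : ℝ → ℂ) (x t : ℝ) : ℂ :=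
  1 / (2 * Real.pi) * (∫ l : ℝ, lineIntegrand D₀ K₀ L θ₀ x t l)
  + Complex.I / Real.pi * Real.exp (-(K₀ / (2 * D₀)) * (2 * L - x))
      * contourIntegral γ (initialIntegrand₁ D₀ K₀ L θ₀ x t)
  + Complex.I / Real.pi * Real.exp (-(K₀ / (2 * D₀)) * (L - x))
      * contourIntegral γ (initialIntegrand₂ D₀ K₀ L θ₀ x t)
  - 2 * D₀ / Real.pi * Real.exp (-(K₀ / (2 * D₀)) * (L - x))
      * contourIntegral γ (leftIntegrand D₀ K₀ L f x t)
  - 2 * D₀ / Real.pi * Real.exp (-(K₀ / (2 * D₀)) * (2 * L - x))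
      * contourIntegral γ (rightIntegrand D₀ K₀ L g x t)

/-- The right-hand side of the representation formula after the change of variables `l ↦ ν(l)`,
with the contour `γ`: the boundary terms have the same form as in `representation`, in the
contour integrals of the initial datum `l` and `ν(l)` are interchanged. -/
def swappedRepresentation (D₀ K₀ L : ℝ) (θ₀ f g : ℝ → ℝ) (γ : ℝ → ℂ) (x t : ℝ) : ℂ :=
  1 / (2 * Real.pi) * (∫ l : ℝ, lineIntegrand D₀ K₀ L θ₀ x t l)
  - Complex.I / Real.pi * Real.exp (-(K₀ / (2 * D₀)) * (2 * L - x))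
      * contourIntegral γ (swappedIntegrand₁ D₀ K₀ L θ₀ x t)
  - Complex.I / Real.pi * Real.exp (-(K₀ / (2 * D₀)) * (L - x))
      * contourIntegral γ (swappedIntegrand₂ D₀ K₀ L θ₀ x t)
  - 2 * D₀ / Real.pi * Real.exp (-(K₀ / (2 * D₀)) * (L - x))
      * contourIntegral γ (leftIntegrand D₀ K₀ L f x t)
  - 2 * D₀ / Real.pi * Real.exp (-(K₀ / (2 * D₀)) * (2 * L - x))
      * contourIntegral γ (rightIntegrand D₀ K₀ L g x t)

end

end AdvectionDiffusion

open AdvectionDiffusion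

/-! Put `k = K₀/(2D₀)` and `μ = λ + ik`. In this variable the drift disappears: `ω = D₀(μ² + k²)`,
`ν` becomes `μ ↦ -μ`, `Δ = -2i e^{-kL} sin(Lμ)`, and `∂D₊` becomes the hyperbola branch `Im μ =
√((Re μ)² + k²)`. After division by `e^{kx}` every contour term is an integral of a density of at
most linear growth against `sin(aμ)/sin(Lμ)` with `a = x` or `a = L - x`. On the hyperbola this
quotient is at most `2e^{-(L-a)|s|}`, which gives absolute convergence and a growth of order `x⁻³`,
`(L-x)⁻³` at the ends (`norm_sinRatio_le`, `norm_ratioIntegral_le`).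

It remains to show that the resulting function `W` (`reducedRepresentation`) equals `u = e^{-kx}θ`.
Since `W` is not known to be regular at the ends, the boundary values are never examined. Instead
`W` and `u` are paired with `sin⁴(πx/L) sin(nπx/L)`, a finite sum of sines whose zeros absorb the
growth.

For `W`, expanding the sine quotient into exponentials is the method of images. As the test function
is odd and `2L`-periodic, the images of `[0, L]` tile the half line, and pairing with the quotient
on `[0, L]` becomes pairing with one exponential on `(0, ∞)`
(`tendsto_integral_test_mul_expIntegral`). The exponential integrals are Gaussian: shifting the
hyperbola to the real line evaluates them as heat kernels or their derivatives (`expIntegral_gauss`,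
`expIntegral_gauss_mul`). For the initial datum the half-line pieces complete the term from the real
line to a whole-line convolution (`initial_combination`), under which sines are eigenfunctions. The
outcome is `integral_sinePoly_mul_reducedRepresentation`.

For `u`, Green's identity on a slightly smaller rectangle, with a sine vanishing on its lateral
sides, followed by a limit, gives the same Duhamel formula without any information on `θ_x` at the
boundary (`IsSolution.sine_moment`).

Hence `sin⁴(πx/L)(W - u)` is continuous on `[0, L]`, vanishes at the ends and has zero sine
coefficients, so it is zero by Fourier series (`eq_zero_of_sine_coefficients`). The formulas over
`∂D₋` follow from the parity of the integrands under `ν`. -/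

namespace AdvectionDiffusion

noncomputable section

/-! ### The hyperbola `Im μ = √((Re μ)² + k²)` -/

/-- The upper branch of the hyperbola `(Im μ)² - (Re μ)² = k²`, parametrized by the real part. -/
def hyp (k s : ℝ) : ℂ := s + Complex.I * (√(s ^ 2 + k ^ 2) : ℝ)

@[simp] theorem hyp_re (k s : ℝ) : (hyp k s).re = s := by simp [hyp]

@[simp] theorem hyp_im (k s : ℝ) : (hyp k s).im = √(s ^ 2 + k ^ 2) := by simp [hyp]

theorem abs_le_hyp_im (k s : ℝ) : |s| ≤ (hyp k s).im := by
  rw [hyp_im]; exact Real.abs_le_sqrt (by nlinarith [sq_nonneg k])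

theorem hyp_im_le (k s : ℝ) : (hyp k s).im ≤ |s| + |k| := by
  rw [hyp_im, Real.sqrt_le_left (by positivity)]
  nlinarith [sq_abs s, sq_abs k, mul_nonneg (abs_nonneg s) (abs_nonneg k)]

theorem hyp_im_pos {k s : ℝ} (hs : s ≠ 0) : 0 < (hyp k s).im :=
  (abs_pos.2 hs).trans_le (abs_le_hyp_im k s)

theorem norm_hyp_le (k s : ℝ) : ‖hyp k s‖ ≤ 2 * |s| + |k| := by
  refine (Complex.norm_le_abs_re_add_abs_im _).trans ?_
  have h := hyp_im_le k s
  rw [abs_of_nonneg ((abs_nonneg s).trans (abs_le_hyp_im k s)), hyp_re]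
  linarith

/-- As `ω = D₀(μ² + k²)`, this is the defining property `Re ω = 0` of the contour. It makes
`e^{-ω(t-τ)}` unimodular there. -/
theorem hyp_sq (k s : ℝ) :
    hyp k s ^ 2 + k ^ 2 = Complex.I * ((2 * s * √(s ^ 2 + k ^ 2) : ℝ) : ℂ) := by
  have h : ((√(s ^ 2 + k ^ 2) : ℝ) : ℂ) ^ 2 = s ^ 2 + k ^ 2 := by
    rw [← Complex.ofReal_pow, Real.sq_sqrt (by positivity)]; push_cast; ring
  simp only [hyp]
  push_cast
  linear_combination Complex.I ^ 2 * h + (s ^ 2 + k ^ 2 : ℂ) * Complex.I_sq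

@[fun_prop] theorem continuous_hyp (k : ℝ) : Continuous (hyp k) := by
  unfold hyp; fun_prop

/-- For `k = 0` the curve consists of two rays with a corner at `s = 0`, hence the exclusion of that
point. -/
theorem hasDerivAt_hyp (k : ℝ) {s : ℝ} (hs : s ≠ 0) :
    HasDerivAt (hyp k) (1 + Complex.I * ((s / √(s ^ 2 + k ^ 2) : ℝ) : ℂ)) s := by
  have hpos : s ^ 2 + k ^ 2 ≠ 0 := by positivity
  have h1 : HasDerivAt (fun s : ℝ => √(s ^ 2 + k ^ 2)) (s / √(s ^ 2 + k ^ 2)) s := by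
    have := (((hasDerivAt_id s).pow 2).add_const (k ^ 2)).sqrt hpos
    convert this using 1
    simp only [id, Pi.pow_apply]
    norm_num
    rw [mul_div_mul_left _ _ two_ne_zero]
  exact (hasDerivAt_id s).ofReal_comp.add (h1.ofReal_comp.const_mul Complex.I)

theorem norm_deriv_hyp_le (k : ℝ) {s : ℝ} (hs : s ≠ 0) : ‖deriv (hyp k) s‖ ≤ 2 := by
  rw [(hasDerivAt_hyp k hs).deriv]
  refine (norm_add_le _ _).trans ?_
  have h := abs_le_hyp_im k s
  rw [hyp_im] at h
  have : |s| / √(s ^ 2 + k ^ 2) ≤ 1 := div_le_one_of_le₀ h (Real.sqrt_nonneg _)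
  simp only [norm_one, norm_mul, Complex.norm_I, Complex.norm_real, Real.norm_eq_abs, abs_div,
    abs_of_nonneg (Real.sqrt_nonneg _)]
  linarith

theorem ae_norm_deriv_hyp_le (k : ℝ) : ∀ᵐ s : ℝ, ‖deriv (hyp k) s‖ ≤ 2 := by
  filter_upwards [Measure.ae_ne volume (0 : ℝ)] with s hs using norm_deriv_hyp_le k hs

/-- Along the hyperbola exponentials `e^{iμz}` with `z ≥ 0` decay like `e^{-|s|z}`. -/
theorem norm_exp_I_hyp_le (k s : ℝ) {z : ℝ} (hz : 0 ≤ z) :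
    ‖Complex.exp (Complex.I * hyp k s * z)‖ ≤ Real.exp (-(z * |s|)) := by
  rw [Complex.norm_exp, Real.exp_le_exp]
  have : (Complex.I * hyp k s * z).re = -((hyp k s).im * z) := by simp
  rw [this]
  nlinarith [abs_le_hyp_im k s]

/-! ### Quotients of sines -/

theorem norm_sin_sq (z : ℂ) : ‖Complex.sin z‖ ^ 2 = Real.sin z.re ^ 2 + Real.sinh z.im ^ 2 := by
  have h : Complex.sin z = ((Real.sin z.re * Real.cosh z.im : ℝ) : ℂ)
      + ((Real.cos z.re * Real.sinh z.im : ℝ) : ℂ) * Complex.I := by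
    rw [Complex.sin_eq]; push_cast; ring
  rw [h, Complex.sq_norm, Complex.normSq_add_mul_I]
  have h1 := Real.cosh_sq z.im
  have h2 := Real.sin_sq_add_cos_sq z.re
  linear_combination Real.sin z.re ^ 2 * h1 + Real.sinh z.im ^ 2 * h2

theorem sinh_im_le_norm_sin {z : ℂ} : Real.sinh z.im ≤ ‖Complex.sin z‖ := by
  refine le_of_sq_le_sq ?_ (norm_nonneg _) |>.trans le_rfl
  rw [norm_sin_sq]
  nlinarith [sq_nonneg (Real.sin z.re)]

/-- In `norm_sin_sq` the real part contributes `sin² ≤ (Re z)² ≤ (Im z)² ≤ sinh²(Im z)`. A bound by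
`sinh` rather than `cosh` keeps the numerator small near `μ = 0`, where the denominator of the
quotient also vanishes when `k = 0`. -/
theorem norm_sin_le_of_abs_re_le_im {z : ℂ} (h : |z.re| ≤ z.im) :
    ‖Complex.sin z‖ ≤ 2 * Real.sinh z.im := by
  have h0 : 0 ≤ z.im := (abs_nonneg _).trans h
  have h1 : z.im ≤ Real.sinh z.im := Real.self_le_sinh_iff.2 h0
  refine le_of_sq_le_sq ?_ (by linarith)
  rw [norm_sin_sq]
  have h2 : Real.sin z.re ^ 2 ≤ z.re ^ 2 := sq_le_sq.2 Real.abs_sin_le_abs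
  have h3 : z.re ^ 2 ≤ z.im ^ 2 := sq_le_sq.2 (by rwa [abs_of_nonneg h0])
  nlinarith

/-- The growing exponentials on the two sides agree; the decaying one on the right becomes
`e^{(a-2L)h} ≤ e^{-ah}` and is subtracted. -/
theorem sinh_mul_le {a L h : ℝ} (ha : a ≤ L) (hh : 0 ≤ h) :
    Real.sinh (a * h) ≤ Real.exp (-((L - a) * h)) * Real.sinh (L * h) := by
  rw [Real.sinh_eq, Real.sinh_eq]
  have e1 : Real.exp (-((L - a) * h)) * Real.exp (L * h) = Real.exp (a * h) := by
    rw [← Real.exp_add]; ring_nf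
  have e2 : Real.exp (-((L - a) * h)) * Real.exp (-(L * h)) = Real.exp ((a - 2 * L) * h) := by
    rw [← Real.exp_add]; ring_nf
  have e3 : Real.exp ((a - 2 * L) * h) ≤ Real.exp (-(a * h)) :=
    Real.exp_le_exp.2 (by nlinarith)
  linarith

/-- The quotient `sin (aμ) / sin (Lμ)` at the point `μ` of the hyperbola with parameter `s`. -/
def sinRatio (k L a s : ℝ) : ℂ := Complex.sin (a * hyp k s) / Complex.sin (L * hyp k s)

/-- The zeros of `sin` are real, while the contour has positive imaginary part off `s = 0`; so `Δ`
has no zero on it. -/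
theorem sin_hyp_ne_zero {k L s : ℝ} (hL : 0 < L) (hs : s ≠ 0) :
    Complex.sin (L * hyp k s) ≠ 0 := by
  have h : 0 < Real.sinh (L * hyp k s : ℂ).im := by
    rw [Real.sinh_pos_iff, Complex.im_ofReal_mul]
    exact mul_pos hL (hyp_im_pos hs)
  exact norm_pos_iff.1 (h.trans_le sinh_im_le_norm_sin)

theorem norm_sinRatio_le {k L a s : ℝ} (hL : 0 < L) (ha : 0 ≤ a) (haL : a ≤ L) :
    ‖sinRatio k L a s‖ ≤ 2 * Real.exp (-((L - a) * |s|)) := by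
  have him (b : ℝ) : ((b : ℂ) * hyp k s).im = b * (hyp k s).im := by simp
  have hre (b : ℝ) : ((b : ℂ) * hyp k s).re = b * (hyp k s).re := by simp
  have hh := abs_le_hyp_im k s
  have hs0 : 0 ≤ (hyp k s).im := (abs_nonneg s).trans hh
  rw [sinRatio, norm_div]
  refine div_le_of_le_mul₀ (norm_nonneg _) (by positivity) ?_
  have h1 : ‖Complex.sin (a * hyp k s)‖ ≤ 2 * Real.sinh (a * (hyp k s).im) := by
    rw [← him]
    refine norm_sin_le_of_abs_re_le_im ?_
    rw [him, hre, abs_mul, abs_of_nonneg ha, hyp_re]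
    gcongr
  have h2 : Real.sinh (L * (hyp k s).im) ≤ ‖Complex.sin (L * hyp k s)‖ := by
    rw [← him]; exact sinh_im_le_norm_sin
  have h3 := sinh_mul_le haL hs0
  have h4 : Real.exp (-((L - a) * (hyp k s).im)) ≤ Real.exp (-((L - a) * |s|)) :=
    Real.exp_le_exp.2 (by nlinarith)
  have h5 : 0 ≤ Real.sinh (L * (hyp k s).im) := Real.sinh_nonneg_iff.2 (by positivity)
  calc ‖Complex.sin (a * hyp k s)‖
      ≤ 2 * (Real.exp (-((L - a) * (hyp k s).im)) * Real.sinh (L * (hyp k s).im)) := by linarith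
    _ ≤ 2 * (Real.exp (-((L - a) * |s|)) * ‖Complex.sin (L * hyp k s)‖) := by gcongr
    _ = _ := by ring

/-- The expansion of `sin (aμ) / sin (Lμ)` into exponentials, with remainder. -/
theorem sinRatio_expansion {k L s : ℝ} (hL : 0 < L) (hs : s ≠ 0) (a : ℝ) (M : ℕ) :
    sinRatio k L a s * (1 - Complex.exp (Complex.I * hyp k s * (2 * M * L : ℝ)))
      = ∑ m ∈ Finset.range M, (Complex.exp (Complex.I * hyp k s * ((2 * m + 1) * L - a : ℝ))
          - Complex.exp (Complex.I * hyp k s * ((2 * m + 1) * L + a : ℝ))) := by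
  have hne := sin_hyp_ne_zero (k := k) hL hs
  rw [sinRatio, div_mul_eq_mul_div, div_eq_iff hne, Finset.sum_mul]
  -- With `q = e^{iLμ}`, passing from `M` to `M + 1` adds `q^{2M}(1 - q²) sin(aμ)` on the left once
  -- the denominator is cleared. The only relation needed is `q · q⁻¹ = 1`.
  induction M with
  | zero => simp
  | succ M ih =>
    rw [Finset.sum_range_succ, ← ih]
    simp only [Complex.sin]
    set μ := hyp k s
    have h1 : Complex.exp (Complex.I * μ * (2 * (M + 1 : ℕ) * L : ℝ))
        = Complex.exp (Complex.I * μ * (2 * M * L : ℝ)) * Complex.exp (L * μ * Complex.I) ^ 2 := by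
      rw [← Complex.exp_nat_mul, ← Complex.exp_add]; congr 1; push_cast; ring
    have h2 : Complex.exp (Complex.I * μ * ((2 * M + 1) * L - a : ℝ))
        = Complex.exp (Complex.I * μ * (2 * M * L : ℝ)) * Complex.exp (L * μ * Complex.I)
          * Complex.exp (-(a * μ) * Complex.I) := by
      rw [← Complex.exp_add, ← Complex.exp_add]; congr 1; push_cast; ring
    have h3 : Complex.exp (Complex.I * μ * ((2 * M + 1) * L + a : ℝ))
        = Complex.exp (Complex.I * μ * (2 * M * L : ℝ)) * Complex.exp (L * μ * Complex.I)
          * Complex.exp (a * μ * Complex.I) := by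
      rw [← Complex.exp_add, ← Complex.exp_add]; congr 1; push_cast; ring
    have h4 : Complex.exp (L * μ * Complex.I) * Complex.exp (-(L * μ) * Complex.I) = 1 := by
      rw [← Complex.exp_add, ← Complex.exp_zero]; congr 1; ring
    rw [h1, h2, h3]
    linear_combination (-Complex.exp (Complex.I * μ * (2 * M * L : ℝ))
      * (Complex.exp (-(a * μ) * Complex.I) - Complex.exp (a * μ * Complex.I)) * Complex.I / 2) * h4

theorem measurable_sinRatio (k L a : ℝ) : Measurable (sinRatio k L a) := by
  unfold sinRatio
  have := (continuous_hyp k).measurable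
  fun_prop

/-- An elementary bound for `(1 + |s|) e^{-c|s|}`. -/
theorem one_add_abs_mul_exp_le {c L : ℝ} (hc : 0 < c) (hcL : c ≤ L) (s : ℝ) :
    (1 + |s|) * Real.exp (-(c * |s|)) ≤ 27 * (1 + L) ^ 3 / c ^ 3 * (1 + s ^ 2)⁻¹ := by
  have hr : 0 ≤ |s| := abs_nonneg s
  have hL : 0 < L := hc.trans_le hcL
  rw [Real.exp_neg, ← sq_abs s, ← div_eq_mul_inv, ← div_eq_mul_inv, div_div,
    div_le_div_iff₀ (Real.exp_pos _) (by positivity)]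
  -- The cube of `1 + r ≤ 3(1 + r/3) ≤ 3e^{r/3}`. Of the three powers, one pays for the weight `1 +
  -- |s|` and two for the integrable factor `(1 + s²)⁻¹`.
  have h1 : (1 + c * |s|) ^ 3 ≤ 27 * Real.exp (c * |s|) := by
    have e : Real.exp (c * |s|) = Real.exp (c * |s| / 3) ^ 3 := by
      rw [← Real.exp_nat_mul]; congr 1; push_cast; ring
    have h := Real.add_one_le_exp (c * |s| / 3)
    have h' : 1 + c * |s| ≤ 3 * Real.exp (c * |s| / 3) := by linarith
    calc (1 + c * |s|) ^ 3 ≤ (3 * Real.exp (c * |s| / 3)) ^ 3 := by gcongr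
      _ = _ := by rw [e]; ring
  have h2 : c * (1 + |s|) ≤ (1 + L) * (1 + c * |s|) := by nlinarith [mul_nonneg hc.le hr]
  have h3 : c ^ 2 * (1 + |s| ^ 2) ≤ ((1 + L) * (1 + c * |s|)) ^ 2 := by
    have : c ^ 2 * (1 + |s| ^ 2) ≤ (c * (1 + |s|)) ^ 2 := by nlinarith [mul_nonneg (sq_nonneg c) hr]
    exact this.trans (by gcongr)
  calc (1 + |s|) * (c ^ 3 * (1 + |s| ^ 2)) = (c * (1 + |s|)) * (c ^ 2 * (1 + |s| ^ 2)) := by ring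
    _ ≤ ((1 + L) * (1 + c * |s|)) * ((1 + L) * (1 + c * |s|)) ^ 2 := by gcongr
    _ = (1 + L) ^ 3 * (1 + c * |s|) ^ 3 := by ring
    _ ≤ (1 + L) ^ 3 * (27 * Real.exp (c * |s|)) := by
        gcongr
    _ = _ := by ring

end

end AdvectionDiffusion

namespace AdvectionDiffusion

noncomputable section

/-! ### Contour integrals against quotients of sines and against exponentials -/

/-- The integral of `A` against `sin (aμ) / sin (Lμ)` along the hyperbola. -/
def ratioIntegral (k L : ℝ) (A : ℝ → ℂ) (a : ℝ) : ℂ := ∫ s, A s * sinRatio k L a s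

/-- The integral of `A` against `e^{iμz}` along the hyperbola. -/
def expIntegral (k : ℝ) (A : ℝ → ℂ) (z : ℝ) : ℂ :=
  ∫ s, A s * Complex.exp (Complex.I * hyp k s * z)

/-- Measurable functions of at most linear growth. -/
structure LinearGrowth (A : ℝ → ℂ) (C : ℝ) : Prop where
  meas : AEStronglyMeasurable A
  nonneg : 0 ≤ C
  bound : ∀ᵐ s : ℝ, ‖A s‖ ≤ C * (1 + |s|)

/-- The integrable majorant used for all contour integrals. -/
def majorant (C L c s : ℝ) : ℝ := 2 * C * (27 * (1 + L) ^ 3 / c ^ 3 * (1 + s ^ 2)⁻¹)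

theorem integrable_majorant (C L c : ℝ) : Integrable (majorant C L c) :=
  (integrable_inv_one_add_sq.const_mul _).const_mul _

/-- The integral of `majorant C L 1`. -/
def majorantConst (C L : ℝ) : ℝ := 2 * C * (27 * (1 + L) ^ 3 * Real.pi)

theorem integral_majorant (C L c : ℝ) : ∫ s, majorant C L c s = majorantConst C L / c ^ 3 := by
  simp only [majorant, majorantConst, integral_const_mul, integral_univ_inv_one_add_sq]
  ring

theorem majorantConst_nonneg {C L : ℝ} (hC : 0 ≤ C) (hL : 0 < L) : 0 ≤ majorantConst C L := by
  unfold majorantConst; positivity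

variable {k L C : ℝ} {A : ℝ → ℂ}

/-- The null set is fixed before `w`, so one estimate serves both kernels, `e^{iμz}` and the sine
quotient. The factor `2` is the one from `norm_sinRatio_le`. -/
theorem LinearGrowth.mul_le_majorant (hA : LinearGrowth A C) {c : ℝ} (hc : 0 < c) (hcL : c ≤ L) :
    ∀ᵐ s : ℝ, ∀ w : ℂ, ‖w‖ ≤ 2 * Real.exp (-(c * |s|)) → ‖A s * w‖ ≤ majorant C L c s := by
  filter_upwards [hA.bound] with s hs w hw
  have hC := hA.nonneg
  rw [norm_mul]
  calc ‖A s‖ * ‖w‖ ≤ (C * (1 + |s|)) * (2 * Real.exp (-(c * |s|))) := by gcongr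
    _ = 2 * C * ((1 + |s|) * Real.exp (-(c * |s|))) := by ring
    _ ≤ _ := by
      unfold majorant
      exact mul_le_mul_of_nonneg_left (one_add_abs_mul_exp_le hc hcL s) (by positivity)

theorem norm_exp_I_hyp_le_two {c z : ℝ} (hc : 0 < c) (hcz : c ≤ z) (s : ℝ) :
    ‖Complex.exp (Complex.I * hyp k s * z)‖ ≤ 2 * Real.exp (-(c * |s|)) := by
  refine (norm_exp_I_hyp_le k s (hc.le.trans hcz)).trans ?_
  have : Real.exp (-(z * |s|)) ≤ Real.exp (-(c * |s|)) :=
    Real.exp_le_exp.2 (by nlinarith [abs_nonneg s])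
  linarith [Real.exp_pos (-(c * |s|))]

theorem norm_sinRatio_le_two (hL : 0 < L) {a c : ℝ} (ha : 0 ≤ a) (haL : a ≤ L) (hc : c ≤ L - a)
    (s : ℝ) : ‖sinRatio k L a s‖ ≤ 2 * Real.exp (-(c * |s|)) := by
  refine (norm_sinRatio_le hL ha haL).trans ?_
  gcongr

theorem aestronglyMeasurable_mul_exp (hA : LinearGrowth A C) (z : ℝ) :
    AEStronglyMeasurable (fun s => A s * Complex.exp (Complex.I * hyp k s * z)) :=
  hA.meas.mul (by fun_prop)

theorem aestronglyMeasurable_mul_sinRatio (hA : LinearGrowth A C) (a : ℝ) :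
    AEStronglyMeasurable (fun s => A s * sinRatio k L a s) :=
  hA.meas.mul (measurable_sinRatio k L a).aestronglyMeasurable

theorem integrable_mul_exp (hA : LinearGrowth A C) {z : ℝ} (hz : 0 < z) :
    Integrable (fun s => A s * Complex.exp (Complex.I * hyp k s * z)) := by
  refine (integrable_majorant C z z).mono' (aestronglyMeasurable_mul_exp hA z) ?_
  filter_upwards [hA.mul_le_majorant hz le_rfl] with s hs
  exact hs _ (norm_exp_I_hyp_le_two hz le_rfl s)

theorem norm_expIntegral_le (hA : LinearGrowth A C) {c z : ℝ} (hc : 0 < c) (hcL : c ≤ L)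
    (hcz : c ≤ z) : ‖expIntegral k A z‖ ≤ majorantConst C L / c ^ 3 := by
  rw [← integral_majorant]
  refine norm_integral_le_of_norm_le (integrable_majorant C L c) ?_
  filter_upwards [hA.mul_le_majorant hc hcL] with s hs
  exact hs _ (norm_exp_I_hyp_le_two hc hcz s)

theorem continuousOn_expIntegral (hA : LinearGrowth A C) :
    ContinuousOn (expIntegral k A) (Ioi 0) := by
  intro z hz
  have hz' : 0 < z / 2 := half_pos hz
  refine ContinuousAt.continuousWithinAt ?_
  refine continuousAt_of_dominated (bound := majorant C (z / 2) (z / 2))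
    (.of_forall fun w => aestronglyMeasurable_mul_exp hA w) ?_ (integrable_majorant _ _ _)
    (.of_forall fun s => by fun_prop)
  filter_upwards [lt_mem_nhds (half_lt_self hz)] with w hw
  filter_upwards [hA.mul_le_majorant hz' le_rfl] with s hs
  exact hs _ (norm_exp_I_hyp_le_two hz' hw.le s)

theorem integrable_mul_sinRatio (hA : LinearGrowth A C) (hL : 0 < L) {a : ℝ} (ha : 0 ≤ a)
    (haL : a < L) : Integrable (fun s => A s * sinRatio k L a s) := by
  refine (integrable_majorant C L (L - a)).mono' (aestronglyMeasurable_mul_sinRatio hA a) ?_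
  filter_upwards [hA.mul_le_majorant (L := L) (sub_pos.2 haL) (by linarith)] with s hs
  exact hs _ (norm_sinRatio_le_two hL ha haL.le le_rfl s)

/-- The decay rate of the quotient is `L - a`, and integrating the majorant costs its inverse cube.
This blow-up dictates the third-order vanishing in `IsTest`. -/
theorem norm_ratioIntegral_le (hA : LinearGrowth A C) (hL : 0 < L) {a : ℝ} (ha : 0 ≤ a)
    (haL : a < L) : ‖ratioIntegral k L A a‖ ≤ majorantConst C L / (L - a) ^ 3 := by
  rw [← integral_majorant]
  refine norm_integral_le_of_norm_le (integrable_majorant C L (L - a)) ?_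
  filter_upwards [hA.mul_le_majorant (L := L) (sub_pos.2 haL) (by linarith)] with s hs
  exact hs _ (norm_sinRatio_le_two hL ha haL.le le_rfl s)

theorem continuousOn_ratioIntegral (hA : LinearGrowth A C) (hL : 0 < L) :
    ContinuousOn (ratioIntegral k L A) (Ioo 0 L) := by
  intro a ha
  refine ContinuousAt.continuousWithinAt ?_
  have hc : 0 < (L - a) / 2 := half_pos (sub_pos.2 ha.2)
  refine continuousAt_of_dominated (bound := majorant C L ((L - a) / 2))
    (.of_forall fun w => aestronglyMeasurable_mul_sinRatio hA w) ?_ (integrable_majorant _ _ _)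
    (.of_forall fun s => by unfold sinRatio; fun_prop)
  filter_upwards [Ioo_mem_nhds ha.1 (show a < (a + L) / 2 by linarith [ha.2])] with w hw
  filter_upwards [hA.mul_le_majorant (L := L) hc (by linarith [ha.1, ha.2])] with s hs
  exact hs _ (norm_sinRatio_le_two hL hw.1.le (by linarith [hw.2, ha.2]) (by linarith [hw.2]) s)

/-- The partial sums of the expansion of `ratioIntegral` into exponential integrals. -/
def imageSum (k L : ℝ) (A : ℝ → ℂ) (M : ℕ) (x : ℝ) : ℂ :=
  ∑ m ∈ Finset.range M, (expIntegral k A (2 * m * L + x) - expIntegral k A ((2 * m + 2) * L - x))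

/-- This is `sinRatio_expansion` at `a = L - x` under the integral: the exponents `(2m+1)L ∓ a`
become the image points `2mL + x` and `(2m+2)L - x`. -/
theorem imageSum_eq (hA : LinearGrowth A C) {x : ℝ} (hx : x ∈ Ioc 0 L) (M : ℕ) :
    imageSum k L A M x = ∫ s, A s * (sinRatio k L (L - x) s
      * (1 - Complex.exp (Complex.I * hyp k s * (2 * M * L : ℝ)))) := by
  have hL : 0 < L := hx.1.trans_le hx.2
  have h1 (m : ℕ) : 0 < 2 * m * L + x := by have := hx.1; positivity
  have h2 (m : ℕ) : 0 < (2 * m + 2) * L - x := by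
    have := hx.2
    have : 0 ≤ (m : ℝ) * L := by positivity
    nlinarith
  have h3 : ∀ m ∈ Finset.range M, Integrable fun s =>
      A s * Complex.exp (Complex.I * hyp k s * (2 * m * L + x : ℝ))
        - A s * Complex.exp (Complex.I * hyp k s * ((2 * m + 2) * L - x : ℝ)) :=
    fun m _ => (integrable_mul_exp hA (h1 m)).sub (integrable_mul_exp hA (h2 m))
  calc imageSum k L A M x
      = ∑ m ∈ Finset.range M, ∫ s, (A s * Complex.exp (Complex.I * hyp k s * (2 * m * L + x : ℝ))
        - A s * Complex.exp (Complex.I * hyp k s * ((2 * m + 2) * L - x : ℝ))) := by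
        refine Finset.sum_congr rfl fun m _ => ?_
        rw [integral_sub (integrable_mul_exp hA (h1 m)) (integrable_mul_exp hA (h2 m))]
        rfl
    _ = ∫ s, ∑ m ∈ Finset.range M,
        (A s * Complex.exp (Complex.I * hyp k s * (2 * m * L + x : ℝ))
        - A s * Complex.exp (Complex.I * hyp k s * ((2 * m + 2) * L - x : ℝ))) :=
        (integral_finsetSum _ h3).symm
    _ = _ := by
        refine integral_congr_ae ?_
        filter_upwards [Measure.ae_ne volume (0 : ℝ)] with s hs
        rw [sinRatio_expansion hL hs, Finset.mul_sum]
        refine Finset.sum_congr rfl fun m _ => ?_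
        rw [mul_sub]
        congr 1
        · congr 4; ring
        · congr 4; ring

theorem norm_one_sub_exp_le {s z : ℝ} (hz : 0 ≤ z) :
    ‖1 - Complex.exp (Complex.I * hyp k s * z)‖ ≤ 2 := by
  have h := norm_exp_I_hyp_le k s hz
  have : Real.exp (-(z * |s|)) ≤ 1 := Real.exp_le_one_iff.2 (by
    have := mul_nonneg hz (abs_nonneg s); linarith)
  refine (norm_sub_le _ _).trans ?_
  rw [norm_one]; linarith

/-- The bound is uniform in `M` because the whole partial sum is estimated at once, as the sine
quotient times a factor of norm at most `2`. It dominates the passage to the limit in `x`. -/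
theorem norm_imageSum_le (hA : LinearGrowth A C) {x : ℝ} (hx : x ∈ Ioc 0 L) (M : ℕ) :
    ‖imageSum k L A M x‖ ≤ 2 * (majorantConst C L / x ^ 3) := by
  have hL : 0 < L := hx.1.trans_le hx.2
  rw [imageSum_eq hA hx, ← integral_majorant, ← integral_const_mul]
  refine norm_integral_le_of_norm_le ((integrable_majorant C L x).const_mul 2) ?_
  filter_upwards [hA.mul_le_majorant hx.1 hx.2] with s hs
  have h1 := hs _ (norm_sinRatio_le_two (k := k) hL (sub_nonneg.2 hx.2) (by linarith [hx.1])
    (by linarith : x ≤ L - (L - x)) s)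
  have h2 := norm_one_sub_exp_le (k := k) (s := s) (z := 2 * M * L) (by positivity)
  rw [← mul_assoc, norm_mul]
  exact (mul_le_mul h1 h2 (norm_nonneg _) ((norm_nonneg _).trans h1)).trans_eq (mul_comm _ _)

/-- The remainder `e^{2iMLμ}` tends to `0` at every `s ≠ 0`, and twice the majorant dominates. -/
theorem tendsto_imageSum (hA : LinearGrowth A C) {x : ℝ} (hx : x ∈ Ioc 0 L) :
    Tendsto (fun M => imageSum k L A M x) atTop (𝓝 (ratioIntegral k L A (L - x))) := by
  have hL : 0 < L := hx.1.trans_le hx.2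
  simp_rw [imageSum_eq hA hx]
  refine tendsto_integral_of_dominated_convergence (fun s => 2 * majorant C L x s) (fun M => ?_)
    ((integrable_majorant C L x).const_mul 2) (fun M => ?_) ?_
  · exact hA.meas.mul ((measurable_sinRatio k L _).aestronglyMeasurable.mul (by fun_prop))
  · filter_upwards [hA.mul_le_majorant hx.1 hx.2] with s hs
    have h1 := hs _ (norm_sinRatio_le_two (k := k) hL (sub_nonneg.2 hx.2) (by linarith [hx.1])
      (by linarith : x ≤ L - (L - x)) s)
    have h2 := norm_one_sub_exp_le (k := k) (s := s) (z := 2 * M * L) (by positivity)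
    rw [← mul_assoc, norm_mul]
    exact (mul_le_mul h1 h2 (norm_nonneg _) ((norm_nonneg _).trans h1)).trans_eq (mul_comm _ _)
  · filter_upwards [Measure.ae_ne volume (0 : ℝ)] with s hs
    have h : Tendsto (fun M : ℕ => Complex.exp (Complex.I * hyp k s * (2 * M * L : ℝ))) atTop
        (𝓝 0) := by
      rw [tendsto_zero_iff_norm_tendsto_zero]
      refine squeeze_zero (fun _ => norm_nonneg _)
        (fun M => norm_exp_I_hyp_le k s (by positivity)) ?_
      refine Real.tendsto_exp_neg_atTop_nhds_zero.comp ?_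
      refine Tendsto.atTop_mul_const (abs_pos.2 hs) ?_
      refine Tendsto.atTop_mul_const hL ?_
      exact tendsto_natCast_atTop_atTop.const_mul_atTop two_pos
    simpa using ((h.const_sub 1).const_mul (sinRatio k L (L - x) s)).const_mul (A s)

/-- Test functions: continuous, odd, `2L`-periodic and vanishing to third order at `0`. -/
structure IsTest (L B : ℝ) (Φ : ℝ → ℝ) : Prop where
  cont : Continuous Φ
  odd : ∀ x, Φ (-x) = -Φ x
  periodic : Function.Periodic Φ (2 * L)
  bound : ∀ x, |Φ x| ≤ B * |x| ^ 3
  bound' : ∀ x, |Φ x| ≤ B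

/-! ### Unfolding the interval over its images -/

theorem IsTest.shift {B : ℝ} {Φ : ℝ → ℝ} (hΦ : IsTest L B Φ) (m : ℕ) (x : ℝ) :
    Φ (2 * m * L + x) = Φ x := by
  have := hΦ.periodic.nat_mul m x
  rw [← this]; congr 1; ring

/-- The sign produced by oddness cancels the minus sign of the reflected images in `imageSum`, so
that all images add up to a single integral. -/
theorem IsTest.reflect {B : ℝ} {Φ : ℝ → ℝ} (hΦ : IsTest L B Φ) (m : ℕ) (x : ℝ) :
    Φ ((2 * m + 2) * L - x) = -Φ x := by
  have := hΦ.shift (m + 1) (-x)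
  rw [← hΦ.odd, ← this]; congr 1; push_cast; ring

/-- Up to `L` the factor `|z|³` of the test function cancels the `z⁻³` of the exponential integral;
beyond `L` both factors are bounded. -/
theorem intervalIntegrable_test_mul_expIntegral (hA : LinearGrowth A C) (hL : 0 < L) {B : ℝ}
    {Φ : ℝ → ℝ} (hΦ : IsTest L B Φ) {a b : ℝ} (ha : 0 ≤ a) (hb : 0 ≤ b) :
    IntervalIntegrable (fun z => (Φ z : ℂ) * expIntegral k A z) volume a b := by
  suffices h : ∀ b, 0 ≤ b →
      IntervalIntegrable (fun z => (Φ z : ℂ) * expIntegral k A z) volume 0 b from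
    (h a ha).symm.trans (h b hb)
  intro b hb
  rw [intervalIntegrable_iff_integrableOn_Ioc_of_le hb]
  have hB : 0 ≤ B := (abs_nonneg _).trans (hΦ.bound' 0)
  have hK := majorantConst_nonneg hA.nonneg hL
  refine Integrable.of_bound ?_ (B * majorantConst C L * (1 + 1 / L ^ 3)) ?_
  · refine ContinuousOn.aestronglyMeasurable (s := Ioc 0 b) ?_ measurableSet_Ioc
    have := hΦ.cont
    exact (by fun_prop : Continuous fun z => (Φ z : ℂ)).continuousOn.mul
      ((continuousOn_expIntegral hA).mono fun z (hz : z ∈ Ioc 0 b) => hz.1)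
  · refine (ae_restrict_iff' measurableSet_Ioc).2 (Eventually.of_forall fun (z : ℝ) hz => ?_)
    rw [norm_mul, Complex.norm_real, Real.norm_eq_abs]
    have hz0 : 0 < z := hz.1
    rcases le_total z L with hzL | hzL
    · calc |Φ z| * ‖expIntegral k A z‖ ≤ (B * |z| ^ 3) * (majorantConst C L / z ^ 3) := by
            gcongr
            · exact hΦ.bound z
            · exact norm_expIntegral_le hA hz0 hzL le_rfl
        _ = B * majorantConst C L := by rw [abs_of_pos hz0]; field_simp
        _ ≤ _ := le_mul_of_one_le_right (by positivity) (by simp; positivity)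
    · calc |Φ z| * ‖expIntegral k A z‖ ≤ B * (majorantConst C L / L ^ 3) := by
            gcongr
            · exact hΦ.bound' z
            · exact norm_expIntegral_le hA hL le_rfl hzL
        _ = B * majorantConst C L * (1 / L ^ 3) := by ring
        _ ≤ _ := by gcongr; simp

/-- The substitutions `z = 2mL + x` and `z = (2m+2)L - x` carry `[0, L]` onto the two halves of
`[2mL, (2m+2)L]`; these tile `[0, 2ML]`. -/
theorem integral_test_mul_imageSum (hA : LinearGrowth A C) (hL : 0 < L) {B : ℝ}
    {Φ : ℝ → ℝ} (hΦ : IsTest L B Φ) (M : ℕ) :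
    ∫ x in 0..L, (Φ x : ℂ) * imageSum k L A M x
      = ∫ z in 0..(2 * M * L), (Φ z : ℂ) * expIntegral k A z := by
  set H : ℝ → ℂ := fun z => (Φ z : ℂ) * expIntegral k A z with hH
  have hint {a b : ℝ} (ha : 0 ≤ a) (hb : 0 ≤ b) : IntervalIntegrable H volume a b :=
    intervalIntegrable_test_mul_expIntegral hA hL hΦ ha hb
  have e1 (m : ℕ) (x : ℝ) : (Φ x : ℂ) * expIntegral k A (2 * m * L + x) = H (2 * m * L + x) := by
    simp only [hH, hΦ.shift]
  have e2 (m : ℕ) (x : ℝ) :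
      (Φ x : ℂ) * expIntegral k A ((2 * m + 2) * L - x) = -H ((2 * m + 2) * L - x) := by
    simp only [hH, hΦ.reflect]; push_cast; ring
  have i1 (m : ℕ) : IntervalIntegrable (fun x => H (2 * m * L + x)) volume 0 L := by
    have := (hint (a := 2 * m * L) (b := 2 * m * L + L) (by positivity) (by positivity)).comp_add_left
      (2 * m * L)
    simpa using this
  have i2 (m : ℕ) : IntervalIntegrable (fun x => H ((2 * m + 2) * L - x)) volume 0 L := by
    have := (hint (a := (2 * m + 2) * L) (b := (2 * m + 2) * L - L) (by positivity)
      (by have : 0 ≤ (m : ℝ) * L := by positivity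
          linarith)).comp_sub_left ((2 * m + 2) * L)
    simpa using this
  induction M with
  | zero => simp [imageSum]
  | succ M ih =>
    have hs : ∀ x, (Φ x : ℂ) * imageSum k L A (M + 1) x
        = (Φ x : ℂ) * imageSum k L A M x + (H (2 * M * L + x) + H ((2 * M + 2) * L - x)) := by
      intro x
      rw [imageSum, Finset.sum_range_succ, mul_add, mul_sub, e1, e2]
      simp only [imageSum, sub_neg_eq_add]
    have i3 : IntervalIntegrable (fun x => (Φ x : ℂ) * imageSum k L A M x) volume 0 L := by
      have : (fun x => (Φ x : ℂ) * imageSum k L A M x)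
          = fun x => ∑ m ∈ Finset.range M, (H (2 * m * L + x) + H ((2 * m + 2) * L - x)) := by
        ext x
        simp only [imageSum, Finset.mul_sum, mul_sub, e1, e2, sub_neg_eq_add]
      rw [this]
      have := IntervalIntegrable.sum (Finset.range M) fun m _ => (i1 m).add (i2 m)
      simpa [Finset.sum_fn] using this
    simp_rw [hs]
    rw [intervalIntegral.integral_add i3 ((i1 M).add (i2 M)), ih,
      intervalIntegral.integral_add (i1 M) (i2 M), intervalIntegral.integral_comp_add_left,
      intervalIntegral.integral_comp_sub_left, ← add_assoc,
      add_zero, intervalIntegral.integral_add_adjacent_intervals, sub_zero,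
      show 2 * (M : ℝ) * L + L = (2 * M + 2) * L - L by ring,
      intervalIntegral.integral_add_adjacent_intervals]
    · congr 1; push_cast; ring
    all_goals
      apply hint <;>
      · have : 0 ≤ (M : ℝ) * L := by positivity
        nlinarith

/-- Unfolding: on test functions, `ratioIntegral` acts as `expIntegral` on the half line. -/
theorem tendsto_integral_test_mul_expIntegral (hA : LinearGrowth A C) (hL : 0 < L) {B : ℝ}
    {Φ : ℝ → ℝ} (hΦ : IsTest L B Φ) :
    Tendsto (fun M : ℕ => ∫ z in 0..(2 * M * L), (Φ z : ℂ) * expIntegral k A z) atTop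
      (𝓝 (∫ x in 0..L, (Φ x : ℂ) * ratioIntegral k L A (L - x))) := by
  have hB : 0 ≤ B := (abs_nonneg _).trans (hΦ.bound' 0)
  simp_rw [← integral_test_mul_imageSum hA hL hΦ]
  have hcont := hΦ.cont
  refine intervalIntegral.tendsto_integral_filter_of_dominated_convergence
    (fun _ => B * (2 * majorantConst C L)) (.of_forall fun M => ?_) (.of_forall fun M => ?_)
    (by simp) ?_
  · rw [uIoc_of_le hL.le]
    refine ContinuousOn.aestronglyMeasurable ?_ measurableSet_Ioc
    refine (by fun_prop : Continuous fun z => (Φ z : ℂ)).continuousOn.mul ?_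
    refine continuousOn_finsetSum _ fun m _ => ?_
    have hm : 0 ≤ (m : ℝ) * L := by positivity
    refine ((continuousOn_expIntegral hA).comp (by fun_prop) ?_).sub
      ((continuousOn_expIntegral hA).comp (by fun_prop) ?_)
    · intro x hx; simp only [mem_Ioi]; nlinarith [hx.1]
    · intro x hx; simp only [mem_Ioi]; nlinarith [hx.2]
  · refine .of_forall fun x hx => ?_
    rw [uIoc_of_le hL.le] at hx
    have hx0 := hx.1
    rw [norm_mul, Complex.norm_real, Real.norm_eq_abs]
    calc |Φ x| * ‖imageSum k L A M x‖ ≤ (B * |x| ^ 3) * (2 * (majorantConst C L / x ^ 3)) := by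
          gcongr
          · exact hΦ.bound x
          · exact norm_imageSum_le hA hx M
      _ = _ := by rw [abs_of_pos hx0]; field_simp
  · refine .of_forall fun x hx => ?_
    rw [uIoc_of_le hL.le] at hx
    exact (tendsto_imageSum hA hx).const_mul _

end

end AdvectionDiffusion

namespace AdvectionDiffusion

noncomputable section

/-! ### Gaussian integrals along the hyperbola -/

/-- Since `Re μ² = -k²` on the hyperbola, the Gaussian does not decay along it. All decay comes from
`e^{iμz}` with `z > 0`. -/
theorem norm_exp_neg_hyp_sq (k a s : ℝ) :
    ‖Complex.exp (-a * hyp k s ^ 2)‖ = Real.exp (a * k ^ 2) := by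
  have h : hyp k s ^ 2 = Complex.I * ((2 * s * √(s ^ 2 + k ^ 2) : ℝ) : ℂ) - k ^ 2 :=
    eq_sub_of_add_eq (hyp_sq k s)
  rw [Complex.norm_exp, h, mul_sub]
  congr 1
  rw [show (k : ℂ) ^ 2 = ((k ^ 2 : ℝ) : ℂ) by push_cast; rfl]
  simp [-Complex.ofReal_pow, -Complex.ofReal_mul]

theorem linearGrowth_gauss (k a : ℝ) :
    LinearGrowth (fun s => Complex.exp (-a * hyp k s ^ 2) * deriv (hyp k) s)
      (2 * Real.exp (a * k ^ 2)) where
  meas := (by fun_prop : Continuous fun s => Complex.exp (-a * hyp k s ^ 2)).aestronglyMeasurable.mul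
    (measurable_deriv _).aestronglyMeasurable
  nonneg := by positivity
  bound := by
    filter_upwards [ae_norm_deriv_hyp_le k] with s hs
    rw [norm_mul, norm_exp_neg_hyp_sq]
    calc _ ≤ Real.exp (a * k ^ 2) * 2 := by gcongr
      _ = 2 * Real.exp (a * k ^ 2) * 1 := by ring
      _ ≤ _ := by gcongr; linarith [abs_nonneg s]

theorem linearGrowth_gauss_mul (k a : ℝ) :
    LinearGrowth (fun s => Complex.exp (-a * hyp k s ^ 2) * hyp k s * deriv (hyp k) s)
      (2 * Real.exp (a * k ^ 2) * (2 + |k|)) where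
  meas := (by fun_prop : Continuous fun s =>
      Complex.exp (-a * hyp k s ^ 2) * hyp k s).aestronglyMeasurable.mul
    (measurable_deriv _).aestronglyMeasurable
  nonneg := by positivity
  bound := by
    filter_upwards [ae_norm_deriv_hyp_le k] with s hs
    rw [norm_mul, norm_mul, norm_exp_neg_hyp_sq]
    have h := norm_hyp_le k s
    calc _ ≤ Real.exp (a * k ^ 2) * (2 * |s| + |k|) * 2 := by gcongr
      _ = 2 * Real.exp (a * k ^ 2) * (2 * |s| + |k|) := by ring
      _ ≤ 2 * Real.exp (a * k ^ 2) * ((2 + |k|) * (1 + |s|)) := by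
        gcongr; nlinarith [abs_nonneg s, abs_nonneg k]
      _ = _ := by ring

/-- The entire function whose integral along the hyperbola is shifted to the real line. -/
def gaussExp (a z : ℝ) (μ : ℂ) : ℂ := Complex.exp (-a * μ ^ 2 + Complex.I * μ * z)

theorem hasDerivAt_gaussExp (a z : ℝ) (μ : ℂ) :
    HasDerivAt (gaussExp a z) (gaussExp a z μ * (-2 * a * μ + Complex.I * z)) μ := by
  have h : HasDerivAt (fun μ : ℂ => -a * μ ^ 2 + Complex.I * μ * z)
      (-2 * a * μ + Complex.I * z) μ := by
    have := ((hasDerivAt_pow 2 μ).const_mul (-a : ℂ)).add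
      (((hasDerivAt_id μ).const_mul Complex.I).mul_const (z : ℂ))
    refine HasDerivAt.congr_deriv this ?_
    push_cast; ring
  exact h.cexp

theorem gaussExp_hyp (k a z s : ℝ) : gaussExp a z (hyp k s)
    = Complex.exp (-a * hyp k s ^ 2) * Complex.exp (Complex.I * hyp k s * z) := by
  rw [gaussExp, Complex.exp_add]

/-- At the fraction `v` of the height `h` of the hyperbola, the exponent has real part `-a(x² -
v²h²) - vhz`. By `v² ≤ v` it lies below the convex combination of `-ax²` and `ak² - z|x|`, hence
below the larger of the two. -/
theorem norm_gaussExp_segment_le {k a z : ℝ} (ha : 0 ≤ a) (hz : 0 ≤ z) (x : ℝ) {w : ℂ}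
    (hw : w ∈ segment ℝ (x : ℂ) (hyp k x)) :
    ‖gaussExp a z w‖ ≤ Real.exp (-a * x ^ 2) + Real.exp (a * k ^ 2 - z * |x|) := by
  obtain ⟨u, v, hu, hv, huv, rfl⟩ := hw
  set h := (hyp k x).im with hh
  have hxh := abs_le_hyp_im k x
  have hsq : h ^ 2 = x ^ 2 + k ^ 2 := by rw [hh, hyp_im, Real.sq_sqrt (by positivity)]
  have hre : (u • (x : ℂ) + v • hyp k x).re = x := by
    simp; rw [← add_mul, huv, one_mul]
  have him : (u • (x : ℂ) + v • hyp k x).im = v * h := by simp [hh]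
  rw [gaussExp, Complex.norm_exp]
  have hE : (-a * (u • (x : ℂ) + v • hyp k x) ^ 2
      + Complex.I * (u • (x : ℂ) + v • hyp k x) * z).re = -a * (x ^ 2 - (v * h) ^ 2) - v * h * z := by
    generalize u • (x : ℂ) + v • hyp k x = w at hre him
    rw [← hre, ← him]
    simp [pow_two, sub_eq_add_neg]
  rw [hE]
  have hv1 : v ≤ 1 := by linarith
  have h0 : 0 ≤ h := (abs_nonneg x).trans hxh
  have key : -a * (x ^ 2 - (v * h) ^ 2) - v * h * z
      ≤ (1 - v) * (-a * x ^ 2) + v * (a * k ^ 2 - z * |x|) := by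
    have e1 : (v * h) ^ 2 ≤ v * (x ^ 2 + k ^ 2) := by
      rw [← hsq]; nlinarith [sq_nonneg h, mul_nonneg hv (sq_nonneg h)]
    have e2 : v * z * |x| ≤ v * z * h := mul_le_mul_of_nonneg_left hxh (by positivity)
    nlinarith [mul_le_mul_of_nonneg_left e1 ha]
  rcases le_total (-a * x ^ 2) (a * k ^ 2 - z * |x|) with hAB | hAB
  · have : Real.exp (-a * (x ^ 2 - (v * h) ^ 2) - v * h * z) ≤ Real.exp (a * k ^ 2 - z * |x|) :=
      Real.exp_le_exp.2 (by nlinarith)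
    linarith [Real.exp_pos (-a * x ^ 2)]
  · have : Real.exp (-a * (x ^ 2 - (v * h) ^ 2) - v * h * z) ≤ Real.exp (-a * x ^ 2) :=
      Real.exp_le_exp.2 (by nlinarith)
    linarith [Real.exp_pos (a * k ^ 2 - z * |x|)]

theorem intervalIntegrable_comp_hyp_mul_deriv {k : ℝ} {F : ℂ → ℂ} (hF : Continuous F) (a b : ℝ) :
    IntervalIntegrable (fun s => F (hyp k s) * deriv (hyp k) s) volume a b := by
  have h : IntervalIntegrable (deriv (hyp k)) volume a b := by
    refine (intervalIntegrable_const (c := (2 : ℝ))).mono_fun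
      (measurable_deriv _).aestronglyMeasurable ?_
    filter_upwards [ae_restrict_of_ae (ae_norm_deriv_hyp_le k)] with s hs
    simpa using hs
  exact h.continuousOn_mul (by fun_prop)

/-- Cauchy's theorem by means of a primitive `P`: the two integrals differ by the increments of `P`
over the vertical segments at `±S`. Each increment is at most the supremum of `gaussExp` on the
segment times its length, which is at most `S + |k|`. -/
theorem norm_integral_hyp_sub_integral_line_le {k a z : ℝ} (ha : 0 ≤ a) (hz : 0 ≤ z) {S : ℝ}
    (hS : 0 ≤ S) :
    ‖(∫ s in (-S)..S, gaussExp a z (hyp k s) * deriv (hyp k) s) - ∫ s in (-S)..S, gaussExp a z s‖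
      ≤ 2 * ((Real.exp (-a * S ^ 2) + Real.exp (a * k ^ 2 - z * S)) * (S + |k|)) := by
  have hcont : Continuous (gaussExp a z) := by unfold gaussExp; fun_prop
  -- By `norm_hyp_le` this disc contains both paths, and by convexity also the vertical segments.
  obtain ⟨P, hP⟩ : Complex.IsExactOn (gaussExp a z) (Metric.ball 0 (2 * S + |k| + 1)) :=
    DifferentiableOn.isExactOn_ball fun w _ =>
      (hasDerivAt_gaussExp a z w).differentiableAt.differentiableWithinAt
  have hball {s : ℝ} (hs : |s| ≤ S) : hyp k s ∈ Metric.ball (0 : ℂ) (2 * S + |k| + 1) := by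
    rw [mem_ball_zero_iff]; linarith [norm_hyp_le k s]
  have hball' {s : ℝ} (hs : |s| ≤ S) : (s : ℂ) ∈ Metric.ball (0 : ℂ) (2 * S + |k| + 1) := by
    rw [mem_ball_zero_iff, Complex.norm_real, Real.norm_eq_abs]; linarith [abs_nonneg k]
  have habs {s : ℝ} (hs : s ∈ uIcc (-S) S) : |s| ≤ S := by
    rw [uIcc_of_le (by linarith)] at hs; exact abs_le.2 hs
  have h1 : ∫ s in (-S)..S, gaussExp a z (hyp k s) * deriv (hyp k) s
      = P (hyp k S) - P (hyp k (-S)) := by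
    refine integral_eq_of_hasDerivAt_off_countable (fun s => P (hyp k s)) _
      (countable_singleton 0) (fun s hs => ?_) (fun s hs => ?_)
      (intervalIntegrable_comp_hyp_mul_deriv hcont _ _)
    · exact ((hP _ (hball (habs hs))).continuousAt.comp
        (continuous_hyp k).continuousAt).continuousWithinAt
    · have hs0 : s ≠ 0 := hs.2
      have hs1 : |s| ≤ S := by
        have := hs.1
        rw [min_eq_left (by linarith), max_eq_right (by linarith)] at this
        exact abs_le.2 ⟨this.1.le, this.2.le⟩
      have h := hasDerivAt_hyp k hs0
      rw [h.deriv]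
      exact (hP _ (hball hs1)).comp s h
  have h2 : ∫ s in (-S)..S, gaussExp a z s = P S - P ((-S : ℝ) : ℂ) := by
    refine intervalIntegral.integral_eq_sub_of_hasDerivAt (f := fun s : ℝ => P s)
      (fun s hs => (hP _ (hball' (habs hs))).comp_ofReal)
      ((hcont.comp Complex.continuous_ofReal).intervalIntegrable _ _)
  have h3 {x : ℝ} (hx : |x| = S) : ‖P (hyp k x) - P x‖
      ≤ (Real.exp (-a * S ^ 2) + Real.exp (a * k ^ 2 - z * S)) * (S + |k|) := by
    have hle := hx.le
    have := Convex.norm_image_sub_le_of_norm_hasDerivWithin_le (𝕜 := ℂ) (f := P)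
      (f' := gaussExp a z) (s := segment ℝ (x : ℂ) (hyp k x)) (x := x) (y := hyp k x)
      (fun w hw => (hP w ((convex_ball _ _).segment_subset (hball' hle) (hball hle)
        hw)).hasDerivWithinAt)
      (fun w hw => norm_gaussExp_segment_le ha hz x hw) (convex_segment _ _)
      (left_mem_segment _ _ _) (right_mem_segment _ _ _)
    rw [hx, ← sq_abs x, hx] at this
    refine this.trans ?_
    gcongr
    have e : hyp k x - x = Complex.I * (((hyp k x).im : ℝ) : ℂ) := by
      rw [hyp_im]; simp only [hyp]; ring
    rw [e, norm_mul, Complex.norm_I, one_mul, Complex.norm_real, Real.norm_eq_abs,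
      abs_of_nonneg ((abs_nonneg x).trans (abs_le_hyp_im k x)), ← hx]
    exact hyp_im_le k x
  rw [h1, h2, show P (hyp k S) - P (hyp k (-S)) - (P S - P ((-S : ℝ) : ℂ))
    = (P (hyp k S) - P S) - (P (hyp k (-S)) - P ((-S : ℝ) : ℂ)) by ring, two_mul]
  exact (norm_sub_le _ _).trans (add_le_add (h3 (abs_of_nonneg hS))
    (h3 (by rw [abs_neg, abs_of_nonneg hS])))

theorem tendsto_add_mul_exp_neg (k : ℝ) {c : ℝ} (hc : 0 < c) :
    Tendsto (fun S : ℝ => (S + |k|) * Real.exp (-(c * S))) atTop (𝓝 0) := by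
  have h0 : Tendsto (fun S : ℝ => c * S) atTop atTop := tendsto_id.const_mul_atTop hc
  have h1 := (Real.tendsto_pow_mul_exp_neg_atTop_nhds_zero 1).comp h0
  have h2 := Real.tendsto_exp_neg_atTop_nhds_zero.comp h0
  have h3 := (h1.const_mul c⁻¹).add (h2.const_mul |k|)
  rw [mul_zero, mul_zero, add_zero] at h3
  refine h3.congr fun S => ?_
  simp only [Function.comp]
  field_simp

theorem integral_gaussExp_line {a : ℝ} (ha : 0 < a) (z : ℝ) :
    ∫ s : ℝ, gaussExp a z s = ((√(Real.pi / a) * Real.exp (-z ^ 2 / (4 * a)) : ℝ) : ℂ) := by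
  have h := integral_cexp_quadratic (b := -a) (by simpa using ha) (Complex.I * z) 0
  have e : ∀ s : ℝ, gaussExp a z s
      = Complex.exp (-a * (s : ℂ) ^ 2 + Complex.I * z * s + 0) := by
    intro s; rw [gaussExp]; congr 1; ring
  simp_rw [e]
  rw [h, Complex.ofReal_mul, Complex.ofReal_exp, Real.sqrt_eq_rpow,
    Complex.ofReal_cpow (by positivity)]
  push_cast
  congr 2
  · rw [neg_neg]
  · rw [mul_pow, Complex.I_sq]
    have : (a : ℂ) ≠ 0 := by exact_mod_cast ha.ne'
    field_simp
    ring

theorem integrable_gaussExp_line {a : ℝ} (ha : 0 < a) (z : ℝ) :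
    Integrable fun s : ℝ => gaussExp a z s := by
  have h := integrable_cexp_quadratic' (b := -a) (by simpa using ha) (Complex.I * z) 0
  refine h.congr (.of_forall fun s => ?_)
  simp only [gaussExp]; congr 1; ring

/-- The Gaussian integral along the hyperbola. -/
theorem expIntegral_gauss (k : ℝ) {a z : ℝ} (ha : 0 < a) (hz : 0 < z) :
    expIntegral k (fun s => Complex.exp (-a * hyp k s ^ 2) * deriv (hyp k) s) z
      = ((√(Real.pi / a) * Real.exp (-z ^ 2 / (4 * a)) : ℝ) : ℂ) := by
  rw [← integral_gaussExp_line ha]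
  have hint := integrable_mul_exp (k := k) (linearGrowth_gauss k a) hz
  have e (s : ℝ) : Complex.exp (-a * hyp k s ^ 2) * deriv (hyp k) s
      * Complex.exp (Complex.I * hyp k s * z) = gaussExp a z (hyp k s) * deriv (hyp k) s := by
    rw [gaussExp_hyp]; ring
  simp only [expIntegral, e] at hint ⊢
  have t1 := intervalIntegral_tendsto_integral hint tendsto_neg_atTop_atBot tendsto_id
  have t2 := intervalIntegral_tendsto_integral (integrable_gaussExp_line ha z)
    tendsto_neg_atTop_atBot tendsto_id
  refine sub_eq_zero.1 (tendsto_nhds_unique (t1.sub t2) ?_)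
  rw [tendsto_zero_iff_norm_tendsto_zero]
  refine squeeze_zero' (.of_forall fun _ => norm_nonneg _)
    (g := fun S => 2 * ((S + |k|) * Real.exp (-(a * S)))
      + 2 * Real.exp (a * k ^ 2) * ((S + |k|) * Real.exp (-(z * S)))) ?_ ?_
  -- For `S ≥ 1` the factor `e^{-aS²}` is at most `e^{-aS}`, so both error terms have the form
  -- treated by `tendsto_add_mul_exp_neg`.
  · filter_upwards [eventually_ge_atTop 1] with S hS
    refine (norm_integral_hyp_sub_integral_line_le ha.le hz.le (zero_le_one.trans hS)).trans ?_
    have h1 : Real.exp (-a * S ^ 2) ≤ Real.exp (-(a * S)) :=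
      Real.exp_le_exp.2 (by nlinarith [mul_nonneg ha.le (by linarith : 0 ≤ S)])
    have h2 : Real.exp (a * k ^ 2 - z * S) = Real.exp (a * k ^ 2) * Real.exp (-(z * S)) := by
      rw [← Real.exp_add]; congr 1
    rw [h2]
    have h3 : 0 ≤ S + |k| := by linarith [abs_nonneg k]
    nlinarith [mul_le_mul_of_nonneg_left h1 h3]
  · have := ((tendsto_add_mul_exp_neg k ha).const_mul 2).add
      ((tendsto_add_mul_exp_neg k hz).const_mul (2 * Real.exp (a * k ^ 2)))
    simpa using this

/-- The first moment of the Gaussian along the hyperbola. -/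
theorem expIntegral_gauss_mul (k : ℝ) {a z : ℝ} (ha : 0 < a) (hz : 0 < z) :
    expIntegral k (fun s => Complex.exp (-a * hyp k s ^ 2) * hyp k s * deriv (hyp k) s) z
      = Complex.I * ((z / (2 * a) * (√(Real.pi / a) * Real.exp (-z ^ 2 / (4 * a))) : ℝ) : ℂ) := by
  have hi1 := integrable_mul_exp (k := k) (linearGrowth_gauss k a) hz
  have hi2 := integrable_mul_exp (k := k) (linearGrowth_gauss_mul k a) hz
  have hcont : Continuous fun w => gaussExp a z w * (-2 * a * w + Complex.I * z) := by
    unfold gaussExp; fun_prop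
  have e (s : ℝ) : gaussExp a z (hyp k s) * (-2 * a * hyp k s + Complex.I * z) * deriv (hyp k) s
      = (-2 * a) * (Complex.exp (-a * hyp k s ^ 2) * hyp k s * deriv (hyp k) s
          * Complex.exp (Complex.I * hyp k s * z))
        + Complex.I * z * (Complex.exp (-a * hyp k s ^ 2) * deriv (hyp k) s
          * Complex.exp (Complex.I * hyp k s * z)) := by
    rw [gaussExp_hyp]; ring
  have hint : Integrable fun s => gaussExp a z (hyp k s) * (-2 * a * hyp k s + Complex.I * z)
      * deriv (hyp k) s := by
    simp_rw [e]
    exact (hi2.const_mul _).add (hi1.const_mul _)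
  -- The integrand is the derivative of `gaussExp` along the hyperbola, and `gaussExp` vanishes at
  -- both ends. This expresses the first moment through the integral in `expIntegral_gauss`.
  have h0 : ∫ s, gaussExp a z (hyp k s) * (-2 * a * hyp k s + Complex.I * z)
      * deriv (hyp k) s = 0 := by
    have t1 := intervalIntegral_tendsto_integral hint tendsto_neg_atTop_atBot tendsto_id
    refine tendsto_nhds_unique t1 ?_
    have hS (S : ℝ) : ∫ s in (-S)..S, gaussExp a z (hyp k s)
        * (-2 * a * hyp k s + Complex.I * z) * deriv (hyp k) s
        = gaussExp a z (hyp k S) - gaussExp a z (hyp k (-S)) := by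
      refine integral_eq_of_hasDerivAt_off_countable (fun s => gaussExp a z (hyp k s)) _
        (countable_singleton 0) (fun s _ => ?_) (fun s hs => ?_)
        (intervalIntegrable_comp_hyp_mul_deriv hcont _ _)
      · exact ((hasDerivAt_gaussExp a z _).continuousAt.comp
          (continuous_hyp k).continuousAt).continuousWithinAt
      · have h := hasDerivAt_hyp k hs.2
        rw [h.deriv]
        exact (hasDerivAt_gaussExp a z _).comp s h
    simp only [id, hS]
    have hb (s : ℝ) : ‖gaussExp a z (hyp k s)‖ ≤ Real.exp (a * k ^ 2) * Real.exp (-(z * |s|)) := by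
      rw [gaussExp_hyp, norm_mul, norm_exp_neg_hyp_sq]
      gcongr
      exact norm_exp_I_hyp_le k s hz.le
    have hlim : Tendsto (fun S : ℝ => Real.exp (a * k ^ 2) * Real.exp (-(z * |S|))) atTop (𝓝 0) := by
      rw [← mul_zero (Real.exp (a * k ^ 2))]
      exact ((Real.tendsto_exp_neg_atTop_nhds_zero.comp
        (tendsto_abs_atTop_atTop.const_mul_atTop hz)).const_mul _)
    have l1 := squeeze_zero_norm hb hlim
    have l2 := squeeze_zero_norm (fun S => by simpa using hb (-S)) hlim
    simpa using l1.sub l2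
  simp_rw [e] at h0
  rw [integral_add (hi2.const_mul _) (hi1.const_mul _), integral_const_mul, integral_const_mul] at h0
  have h1 := expIntegral_gauss k ha hz
  unfold expIntegral at h1 ⊢
  rw [h1] at h0
  have : (a : ℂ) ≠ 0 := by exact_mod_cast ha.ne'
  push_cast at h0 ⊢
  rw [div_mul_eq_mul_div, mul_div_assoc', eq_div_iff (by simpa using this)]
  linear_combination -h0

end

end AdvectionDiffusion

namespace AdvectionDiffusion

noncomputable section

/-! ### The heat kernel and sines -/

/-- The heat kernel at (scaled) time `a`. -/
def heatKernel (a z : ℝ) : ℝ := √(Real.pi / a) * Real.exp (-z ^ 2 / (4 * a)) / (2 * Real.pi)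

theorem heatKernel_neg (a z : ℝ) : heatKernel a (-z) = heatKernel a z := by
  simp [heatKernel]

theorem heatKernel_nonneg (a z : ℝ) : 0 ≤ heatKernel a z := by
  unfold heatKernel; positivity

theorem heatKernel_le (a z : ℝ) (ha : 0 < a) : heatKernel a z ≤ √(Real.pi / a) := by
  unfold heatKernel
  have h1 : Real.exp (-z ^ 2 / (4 * a)) ≤ 1 := Real.exp_le_one_iff.2
    (div_nonpos_of_nonpos_of_nonneg (by nlinarith [sq_nonneg z]) (by positivity))
  rw [div_le_iff₀ (by positivity)]
  have h2 : 1 ≤ 2 * Real.pi := by linarith [Real.pi_gt_three]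
  exact mul_le_mul_of_nonneg_left (h1.trans h2) (Real.sqrt_nonneg _)

@[fun_prop] theorem continuous_heatKernel (a : ℝ) : Continuous (heatKernel a) := by
  unfold heatKernel; fun_prop

theorem heatKernel_eq (a z : ℝ) : heatKernel a z
    = √(Real.pi / a) / (2 * Real.pi) * Real.exp (-(1 / (4 * a)) * z ^ 2) := by
  rw [heatKernel, mul_div_right_comm]; congr 2; ring

theorem integrable_heatKernel {a : ℝ} (ha : 0 < a) : Integrable (heatKernel a) := by
  simp_rw [funext (heatKernel_eq a)]
  exact (integrable_exp_neg_mul_sq (by positivity)).const_mul _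

theorem integrable_id_mul_heatKernel {a : ℝ} (ha : 0 < a) :
    Integrable fun z => z * heatKernel a z := by
  have h := (integrable_mul_exp_neg_mul_sq (b := 1 / (4 * a)) (by positivity)).const_mul
    (√(Real.pi / a) / (2 * Real.pi))
  refine h.congr (.of_forall fun z => ?_)
  simp only [heatKernel_eq]; ring

theorem hasDerivAt_heatKernel {a : ℝ} (ha : 0 < a) (z : ℝ) :
    HasDerivAt (heatKernel a) (-(z / (2 * a) * heatKernel a z)) z := by
  have h := ((((hasDerivAt_pow 2 z).neg.div_const (4 * a)).exp.const_mul
    (√(Real.pi / a))).div_const (2 * Real.pi))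
  refine HasDerivAt.congr_deriv h ?_
  rw [heatKernel]
  simp only [Pi.neg_apply]
  push_cast
  field_simp
  ring

theorem integral_cexp_mul_heatKernel {a : ℝ} (ha : 0 < a) (l : ℝ) :
    ∫ z : ℝ, Complex.exp (Complex.I * l * z) * (heatKernel a z : ℂ)
      = ((Real.exp (-(a * l ^ 2)) : ℝ) : ℂ) := by
  have h := fourierIntegral_gaussian (b := ((1 / (4 * a) : ℝ) : ℂ))
    (by rw [Complex.ofReal_re]; positivity) l
  have e (z : ℝ) : Complex.exp (Complex.I * l * z) * (heatKernel a z : ℂ)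
      = ((√(Real.pi / a) / (2 * Real.pi) : ℝ) : ℂ) * (Complex.exp (Complex.I * l * z)
        * Complex.exp (-((1 / (4 * a) : ℝ) : ℂ) * z ^ 2)) := by
    rw [heatKernel_eq]; push_cast; ring
  simp_rw [e]
  rw [integral_const_mul, h]
  have h1 : ((Real.pi / ((1 / (4 * a) : ℝ) : ℂ)) ^ (1 / 2 : ℂ))
      = ((√(Real.pi / (1 / (4 * a))) : ℝ) : ℂ) := by
    rw [Real.sqrt_eq_rpow, Complex.ofReal_cpow (by positivity)]; push_cast; rfl
  have h2 : √(Real.pi / a) / (2 * Real.pi) * √(Real.pi / (1 / (4 * a))) = 1 := by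
    rw [div_mul_eq_mul_div, ← Real.sqrt_mul (by positivity),
      show Real.pi / a * (Real.pi / (1 / (4 * a))) = (2 * Real.pi) ^ 2 by field_simp; ring,
      Real.sqrt_sq (by positivity), div_self (by positivity)]
  rw [h1, ← mul_assoc, ← Complex.ofReal_mul, h2, Complex.ofReal_one, one_mul, Complex.ofReal_exp]
  congr 1
  have : (a : ℂ) ≠ 0 := by exact_mod_cast ha.ne'
  push_cast
  field_simp

theorem norm_cexp_I_mul (l z : ℝ) : ‖Complex.exp (Complex.I * l * z)‖ = 1 := by
  rw [Complex.norm_exp]; simp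

/-- Translating the Fourier transform of the kernel and taking imaginary parts shows that sines are
eigenfunctions of the heat semigroup on the whole line. -/
theorem integral_sin_mul_heatKernel_sub {a : ℝ} (ha : 0 < a) (l y : ℝ) :
    ∫ x : ℝ, Real.sin (l * x) * heatKernel a (x - y)
      = Real.exp (-(a * l ^ 2)) * Real.sin (l * y) := by
  have h : ∫ x : ℝ, Complex.exp (Complex.I * l * x) * (heatKernel a (x - y) : ℂ)
      = ((Real.exp (-(a * l ^ 2)) : ℝ) : ℂ) * Complex.exp (Complex.I * l * y) := by
    rw [← integral_add_right_eq_self _ y, ← integral_cexp_mul_heatKernel ha, ← integral_mul_const]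
    refine integral_congr_ae (.of_forall fun x => ?_)
    simp only [add_sub_cancel_right]
    rw [Complex.ofReal_add, mul_add, Complex.exp_add]
    ring
  have hi : Integrable fun x : ℝ => Complex.exp (Complex.I * l * x) * (heatKernel a (x - y) : ℂ) := by
    refine ((integrable_heatKernel ha).comp_sub_right y).ofReal.bdd_mul (c := 1) (by fun_prop)
      (.of_forall fun x => (norm_cexp_I_mul l x).le)
  have him := congrArg Complex.im h
  rw [← RCLike.im_to_complex, ← integral_im hi] at him
  have e1 (x : ℝ) : (Complex.exp (Complex.I * l * x)).im = Real.sin (l * x) := by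
    rw [show Complex.I * l * x = ((l * x : ℝ) : ℂ) * Complex.I by push_cast; ring,
      Complex.exp_ofReal_mul_I_im]
  simpa [e1, Complex.im_mul_ofReal, Complex.im_ofReal_mul, -Complex.ofReal_exp] using him

theorem integral_cos_mul_heatKernel {a : ℝ} (ha : 0 < a) (l : ℝ) :
    ∫ x : ℝ, Real.cos (l * x) * heatKernel a x = Real.exp (-(a * l ^ 2)) := by
  have h := integral_cexp_mul_heatKernel ha l
  have hi : Integrable fun x : ℝ => Complex.exp (Complex.I * l * x) * (heatKernel a x : ℂ) := by
    refine (integrable_heatKernel ha).ofReal.bdd_mul (c := 1) (by fun_prop)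
      (.of_forall fun x => (norm_cexp_I_mul l x).le)
  have hre := congrArg Complex.re h
  rw [← RCLike.re_to_complex, ← integral_re hi] at hre
  have e1 (x : ℝ) : (Complex.exp (Complex.I * l * x)).re = Real.cos (l * x) := by
    rw [show Complex.I * l * x = ((l * x : ℝ) : ℂ) * Complex.I by push_cast; ring,
      Complex.exp_ofReal_mul_I_re]
  simpa [e1, Complex.re_mul_ofReal, Complex.re_ofReal_mul, -Complex.ofReal_exp]
    using hre

/-- The (negative) derivative of the heat kernel. -/
def fluxKernel (a z : ℝ) : ℝ := z / (2 * a) * heatKernel a z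

theorem integrable_fluxKernel {a : ℝ} (ha : 0 < a) : Integrable (fluxKernel a) := by
  refine ((integrable_id_mul_heatKernel ha).const_mul (1 / (2 * a))).congr (.of_forall fun z => ?_)
  simp only [fluxKernel]; ring

theorem integrable_sin_mul_fluxKernel {a : ℝ} (ha : 0 < a) (l : ℝ) :
    Integrable fun x => Real.sin (l * x) * fluxKernel a x :=
  (integrable_fluxKernel ha).bdd_mul (c := 1) (by fun_prop)
    (.of_forall fun x => Real.abs_sin_le_one _)

/-- The derivative of `sin(lx) · heatKernel` has zero integral over the line, which trades the flux
kernel for the cosine transform. The product of the sine and the odd flux kernel is even, so the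
half line gives half of the value. -/
theorem integral_sin_mul_fluxKernel {a : ℝ} (ha : 0 < a) (l : ℝ) :
    ∫ x in Ioi (0 : ℝ), Real.sin (l * x) * fluxKernel a x = l / 2 * Real.exp (-(a * l ^ 2)) := by
  have hd (x : ℝ) : HasDerivAt (fun x => Real.sin (l * x) * heatKernel a x)
      (l * (Real.cos (l * x) * heatKernel a x) - Real.sin (l * x) * fluxKernel a x) x := by
    have h1 : HasDerivAt (fun x => Real.sin (l * x)) (Real.cos (l * x) * (l * 1)) x :=
      ((hasDerivAt_id x).const_mul l).sin
    refine (h1.mul (hasDerivAt_heatKernel ha x)).congr_deriv ?_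
    rw [fluxKernel]; ring
  have i1 : Integrable fun x => Real.cos (l * x) * heatKernel a x :=
    (integrable_heatKernel ha).bdd_mul (c := 1) (by fun_prop)
      (.of_forall fun x => Real.abs_cos_le_one _)
  have i2 := integrable_sin_mul_fluxKernel ha l
  have i3 : Integrable fun x => Real.sin (l * x) * heatKernel a x :=
    (integrable_heatKernel ha).bdd_mul (c := 1) (by fun_prop)
      (.of_forall fun x => Real.abs_sin_le_one _)
  have h0 := integral_eq_zero_of_hasDerivAt_of_integrable hd ((i1.const_mul l).sub i2) i3
  rw [integral_sub (i1.const_mul l) i2, integral_const_mul, integral_cos_mul_heatKernel ha] at h0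
  have h1 := integral_comp_abs (f := fun x => Real.sin (l * x) * fluxKernel a x)
  have e : ∀ x, Real.sin (l * |x|) * fluxKernel a |x| = Real.sin (l * x) * fluxKernel a x := by
    intro x
    rcases abs_cases x with ⟨h, -⟩ | ⟨h, -⟩
    · rw [h]
    · rw [h, fluxKernel, fluxKernel, heatKernel_neg, mul_neg, Real.sin_neg]; ring
  simp_rw [e] at h1
  linarith

/-- A bound for the flux kernel that is uniform in time. -/
theorem fluxKernel_le {a z : ℝ} (ha : 0 < a) (hz : 0 < z) : fluxKernel a z ≤ 32 / z ^ 2 := by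
  -- In the self-similar variable the claim is a bound on `q³e^{-q²/4}`. Uniformity in `a` is what
  -- is needed, because `a = D(t - τ)` tends to `0` as `τ → t`.
  set q := z / √a with hq
  have hsa : 0 < √a := Real.sqrt_pos.2 ha
  have hq0 : 0 < q := by positivity
  have ha2 : √a ^ 2 = a := Real.sq_sqrt ha.le
  have hz' : z = q * √a := by rw [hq]; field_simp
  have h1 : Real.exp (-z ^ 2 / (4 * a)) = (Real.exp (q ^ 2 / 4))⁻¹ := by
    rw [← Real.exp_neg]; congr 1; rw [hz', mul_pow, ha2]; field_simp
  have h2 : q ^ 3 ≤ 16 * Real.exp (q ^ 2 / 4) := by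
    have := Real.quadratic_le_exp_of_nonneg (x := q ^ 2 / 4) (by positivity)
    nlinarith [sq_nonneg (q - 1), sq_nonneg (q ^ 2 - q), sq_nonneg q]
  have h3 : √(Real.pi / a) ≤ 2 / √a := by
    rw [Real.sqrt_div Real.pi_pos.le]
    gcongr
    rw [Real.sqrt_le_left (by norm_num)]
    linarith [Real.pi_lt_four]
  have hE := Real.exp_pos (q ^ 2 / 4)
  have h4 : (Real.exp (q ^ 2 / 4))⁻¹ ≤ 16 / q ^ 3 := by
    rw [inv_eq_one_div, div_le_div_iff₀ hE (by positivity)]; linarith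
  calc fluxKernel a z = z / (2 * a) * (√(Real.pi / a) * (Real.exp (q ^ 2 / 4))⁻¹ / (2 * Real.pi)) := by
        rw [fluxKernel, heatKernel, h1]
    _ ≤ z / (2 * a) * (2 / √a * (16 / q ^ 3) / 1) := by
        gcongr
        linarith [Real.pi_gt_three]
    _ ≤ 32 / z ^ 2 := by
        rw [← ha2, hz']
        have : q * √a / (2 * √a ^ 2) * (2 / √a * (16 / q ^ 3) / 1) = 16 / (q * √a) ^ 2 := by
          field_simp
        rw [Real.sqrt_sq hsa.le, this]
        gcongr
        norm_num

end

end AdvectionDiffusion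

namespace AdvectionDiffusion

noncomputable section

/-! ### Pairing contour integrals with test functions -/

variable {k L T C : ℝ}

theorem linearGrowth_integral {G : ℝ → ℝ → ℂ} (hT : 0 ≤ T) (hG : Measurable (Function.uncurry G))
    (hC : 0 ≤ C) (hb : ∀ᵐ s : ℝ, ∀ y ∈ Ioc 0 T, ‖G s y‖ ≤ C * (1 + |s|)) :
    LinearGrowth (fun s => ∫ y in 0..T, G s y) (C * T) where
  meas := by
    simp_rw [intervalIntegral.integral_of_le hT]
    exact hG.stronglyMeasurable.integral_prod_right.aestronglyMeasurable
  nonneg := by positivity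
  bound := by
    filter_upwards [hb] with s hs
    have := intervalIntegral.norm_integral_le_of_norm_le_const (a := 0) (b := T) (f := G s)
      (C := C * (1 + |s|)) (by rwa [uIoc_of_le hT])
    rw [sub_zero, abs_of_nonneg hT] at this
    linarith

theorem expIntegral_integral {G : ℝ → ℝ → ℂ} (hT : 0 ≤ T) (hG : Measurable (Function.uncurry G))
    (hC : 0 ≤ C) (hb : ∀ᵐ s : ℝ, ∀ y ∈ Ioc 0 T, ‖G s y‖ ≤ C * (1 + |s|)) {z : ℝ} (hz : 0 < z) :
    expIntegral k (fun s => ∫ y in 0..T, G s y) z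
      = ∫ y in 0..T, expIntegral k (fun s => G s y) z := by
  simp only [expIntegral, ← intervalIntegral.integral_mul_const]
  rw [← intervalIntegral_integral_swap (f := fun y s =>
    G s y * Complex.exp (Complex.I * hyp k s * z))]
  rw [uIoc_of_le hT]
  refine ((integrable_majorant C z z).comp_snd _).mono' ?_ ?_
  · refine Measurable.aestronglyMeasurable ?_
    have h1 : Measurable fun p : ℝ × ℝ => G p.2 p.1 := hG.comp measurable_swap
    have h2 : Continuous fun p : ℝ × ℝ => Complex.exp (Complex.I * hyp k p.2 * z) := by fun_prop
    exact h1.mul h2.measurable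
  · filter_upwards [Measure.quasiMeasurePreserving_snd.ae hb,
      Measure.quasiMeasurePreserving_fst.ae (ae_restrict_mem measurableSet_Ioc)] with p h1 h2
    simp only [Function.uncurry]
    rw [norm_mul]
    have h3 := norm_exp_I_hyp_le_two (k := k) hz le_rfl p.2
    calc _ ≤ (C * (1 + |p.2|)) * (2 * Real.exp (-(z * |p.2|))) :=
          mul_le_mul (h1 _ h2) h3 (norm_nonneg _) (by positivity)
      _ = 2 * C * ((1 + |p.2|) * Real.exp (-(z * |p.2|))) := by ring
      _ ≤ _ := mul_le_mul_of_nonneg_left (one_add_abs_mul_exp_le hz le_rfl _) (by positivity)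

/-- The bound `hb`, uniform in `y`, makes `Φ · expIntegral` integrable on the half line. The
unfolding limit along `[0, 2ML]` is therefore its integral over `(0, ∞)`, and Fubini applies. -/
theorem integral_test_mul_ratioIntegral {A : ℝ → ℂ} (hA : LinearGrowth A C) (hL : 0 < L) {B : ℝ}
    {Φ : ℝ → ℝ} (hΦ : IsTest L B Φ) {W : ℝ → ℝ → ℂ} (hT : 0 ≤ T)
    (hW : Measurable (Function.uncurry W))
    (hJ : ∀ z > 0, expIntegral k A z = ∫ y in 0..T, W z y) {g : ℝ → ℝ}
    (hg : IntegrableOn g (Ioi 0)) (hb : ∀ y ∈ Ioc 0 T, ∀ z > 0, ‖(Φ z : ℂ) * W z y‖ ≤ g z) :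
    ∫ x in 0..L, (Φ x : ℂ) * ratioIntegral k L A (L - x)
      = ∫ y in 0..T, ∫ z in Ioi 0, (Φ z : ℂ) * W z y := by
  have hcont := hΦ.cont
  have hint : Integrable (Function.uncurry fun y z => (Φ z : ℂ) * W z y)
      ((volume.restrict (uIoc 0 T)).prod (volume.restrict (Ioi 0))) := by
    rw [uIoc_of_le hT]
    refine (Integrable.comp_snd hg _).mono' ?_ ?_
    · refine Measurable.aestronglyMeasurable ?_
      have h1 : Measurable fun p : ℝ × ℝ => W p.2 p.1 := hW.comp measurable_swap
      have h2 : Continuous fun p : ℝ × ℝ => (Φ p.2 : ℂ) := by fun_prop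
      exact h2.measurable.mul h1
    · filter_upwards [Measure.quasiMeasurePreserving_snd.ae (ae_restrict_mem measurableSet_Ioi),
        Measure.quasiMeasurePreserving_fst.ae (ae_restrict_mem measurableSet_Ioc)] with p h1 h2
      exact hb _ h2 _ h1
  have h1 : IntegrableOn (fun z => (Φ z : ℂ) * expIntegral k A z) (Ioi 0) := by
    have := hint.integral_prod_right
    rw [uIoc_of_le hT] at this
    refine this.congr ?_
    filter_upwards [ae_restrict_mem measurableSet_Ioi] with z hz
    simp only [Function.uncurry]
    rw [hJ z hz, intervalIntegral.integral_of_le hT, integral_const_mul]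
  have htend : Tendsto (fun M : ℕ => 2 * (M : ℝ) * L) atTop atTop :=
    Tendsto.atTop_mul_const hL (tendsto_natCast_atTop_atTop.const_mul_atTop two_pos)
  have h2 := tendsto_nhds_unique (tendsto_integral_test_mul_expIntegral hA hL hΦ)
    (intervalIntegral_tendsto_integral_Ioi 0 h1 htend)
  rw [h2, intervalIntegral_integral_swap hint]
  refine setIntegral_congr_fun measurableSet_Ioi fun z hz => ?_
  rw [hJ z hz, intervalIntegral.integral_const_mul]

/-! ### Sources coming from boundary data -/

/-- The density along the hyperbola that comes from the boundary datum `F`. -/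
def boundaryDensity (D k : ℝ) (F : ℝ → ℝ) (t s τ : ℝ) : ℂ :=
  Complex.exp (-(D * (t - τ) : ℝ) * (hyp k s ^ 2 + k ^ 2)) * hyp k s * deriv (hyp k) s * F τ

theorem measurable_boundaryDensity (D k : ℝ) {F : ℝ → ℝ} (hF : Measurable F) (t : ℝ) :
    Measurable (Function.uncurry (boundaryDensity D k F t)) := by
  unfold boundaryDensity Function.uncurry
  have h1 : Continuous fun p : ℝ × ℝ =>
    Complex.exp (-(D * (t - p.2) : ℝ) * (hyp k p.1 ^ 2 + k ^ 2)) * hyp k p.1 := by fun_prop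
  have h2 : Measurable fun p : ℝ × ℝ => deriv (hyp k) p.1 := (measurable_deriv _).comp measurable_fst
  have h3 : Measurable fun p : ℝ × ℝ => (F p.2 : ℂ) :=
    Complex.measurable_ofReal.comp (hF.comp measurable_snd)
  exact (h1.measurable.mul h2).mul h3

theorem norm_exp_mul_hyp_sq_add (k b s : ℝ) :
    ‖Complex.exp (-b * (hyp k s ^ 2 + k ^ 2))‖ = 1 := by
  rw [Complex.norm_exp, hyp_sq]
  simp

theorem norm_boundaryDensity_le (D k : ℝ) {F : ℝ → ℝ} (hF : ∀ τ, |F τ| ≤ C) (t : ℝ) :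
    ∀ᵐ s : ℝ, ∀ τ, ‖boundaryDensity D k F t s τ‖ ≤ (2 * (2 + |k|) * C) * (1 + |s|) := by
  have hC : 0 ≤ C := (abs_nonneg _).trans (hF 0)
  filter_upwards [ae_norm_deriv_hyp_le k] with s hs τ
  rw [boundaryDensity, norm_mul, norm_mul, norm_mul, norm_exp_mul_hyp_sq_add, one_mul,
    Complex.norm_real, Real.norm_eq_abs]
  have h1 : ‖hyp k s‖ ≤ (2 + |k|) * (1 + |s|) := by
    nlinarith [norm_hyp_le k s, abs_nonneg s, abs_nonneg k]
  calc _ ≤ ((2 + |k|) * (1 + |s|)) * 2 * C := by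
        gcongr
        exact hF τ
    _ = _ := by ring

theorem linearGrowth_boundary (D k : ℝ) {F : ℝ → ℝ} (hFm : Measurable F) (hF : ∀ τ, |F τ| ≤ C)
    {t : ℝ} (ht : 0 ≤ t) : LinearGrowth (fun s => ∫ τ in 0..t, boundaryDensity D k F t s τ)
      (2 * (2 + |k|) * C * t) :=
  linearGrowth_integral ht (measurable_boundaryDensity D k hFm t)
    (by have : 0 ≤ C := (abs_nonneg _).trans (hF 0)
        positivity)
    ((norm_boundaryDensity_le D k hF t).mono fun _ h τ _ => h τ)

theorem sqrt_mul_exp_eq (a z : ℝ) :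
    √(Real.pi / a) * Real.exp (-z ^ 2 / (4 * a)) = 2 * Real.pi * heatKernel a z := by
  rw [heatKernel]; field_simp

/-- For each `τ < t` the integral over the contour is the first Gaussian moment at scaled time `D(t
- τ)`, that is, a flux kernel. The degenerate time `τ = t` is a null set. -/
theorem expIntegral_boundary {D : ℝ} (hD : 0 < D) (k : ℝ) {F : ℝ → ℝ} (hFm : Measurable F)
    (hF : ∀ τ, |F τ| ≤ C) {t : ℝ} (ht : 0 ≤ t) {z : ℝ} (hz : 0 < z) :
    expIntegral k (fun s => ∫ τ in 0..t, boundaryDensity D k F t s τ) z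
      = ∫ τ in 0..t, Complex.I * ((2 * Real.pi * (Real.exp (-(D * k ^ 2 * (t - τ))) * F τ
          * fluxKernel (D * (t - τ)) z) : ℝ) : ℂ) := by
  rw [expIntegral_integral ht (measurable_boundaryDensity D k hFm t)
    (C := 2 * (2 + |k|) * C) (by have : 0 ≤ C := (abs_nonneg _).trans (hF 0)
                                 positivity)
    ((norm_boundaryDensity_le D k hF t).mono fun _ h τ _ => h τ) hz]
  refine intervalIntegral.integral_congr_ae ?_
  filter_upwards [Measure.ae_ne volume t] with τ hτ hmem
  rw [uIoc_of_le ht] at hmem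
  have hτt : 0 < D * (t - τ) := mul_pos hD (sub_pos.2 (lt_of_le_of_ne hmem.2 hτ))
  have h := expIntegral_gauss_mul k hτt hz
  rw [sqrt_mul_exp_eq] at h
  have e : (2 * Real.pi * (Real.exp (-(D * k ^ 2 * (t - τ))) * F τ
      * fluxKernel (D * (t - τ)) z) : ℝ) = (Real.exp (-(D * k ^ 2 * (t - τ))) * F τ)
        * (z / (2 * (D * (t - τ))) * (2 * Real.pi * heatKernel (D * (t - τ)) z)) := by
    rw [fluxKernel]; ring
  rw [e, Complex.ofReal_mul, mul_left_comm, ← h]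
  unfold expIntegral
  rw [← integral_const_mul]
  refine integral_congr_ae (.of_forall fun s => ?_)
  simp only [boundaryDensity]
  rw [mul_add, Complex.exp_add,
    show -((D * (t - τ) : ℝ) : ℂ) * k ^ 2 = ((-(D * k ^ 2 * (t - τ)) : ℝ) : ℂ) by push_cast; ring,
    Complex.ofReal_mul (Real.exp _), Complex.ofReal_exp]
  ring

theorem measurable_fluxKernel (D t : ℝ) :
    Measurable fun p : ℝ × ℝ => fluxKernel (D * (t - p.2)) p.1 := by
  unfold fluxKernel heatKernel
  fun_prop

/-- The kernel is at most `32/z²` for all times. Below `z = 1` the vanishing of the test function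
absorbs this singularity; above, its boundedness suffices. -/
theorem IsTest.mul_fluxKernel_le {B : ℝ} {Φ : ℝ → ℝ} (hΦ : IsTest L B Φ) {a z : ℝ} (ha : 0 ≤ a)
    (hz : 0 < z) : |Φ z| * fluxKernel a z ≤ 64 * B * (1 + z ^ 2)⁻¹ := by
  have hB : 0 ≤ B := (abs_nonneg _).trans (hΦ.bound' 0)
  -- The value `a = 0` occurs at `τ = t`; there division by zero makes the kernel `0`.
  rcases ha.eq_or_lt with rfl | ha
  · simp only [fluxKernel, mul_zero, div_zero, zero_mul]; positivity
  have h := fluxKernel_le ha hz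
  have h0 : 0 ≤ fluxKernel a z := mul_nonneg (by positivity) (heatKernel_nonneg _ _)
  rw [← div_eq_mul_inv, le_div_iff₀ (by positivity)]
  rcases le_total z 1 with h1 | h1
  · calc |Φ z| * fluxKernel a z * (1 + z ^ 2) ≤ (B * |z| ^ 3) * (32 / z ^ 2) * (1 + 1 ^ 2) := by
          gcongr
          · exact hΦ.bound z
      _ = 64 * B * z := by rw [abs_of_pos hz]; field_simp; ring
      _ ≤ 64 * B := mul_le_of_le_one_right (by positivity) h1
  · calc |Φ z| * fluxKernel a z * (1 + z ^ 2) ≤ B * (32 / z ^ 2) * (z ^ 2 + z ^ 2) := by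
          gcongr
          · exact hΦ.bound' z
          · nlinarith
      _ = 64 * B := by field_simp; ring

theorem integral_test_mul_boundary {D : ℝ} (hD : 0 < D) (k : ℝ) (hL : 0 < L) {F : ℝ → ℝ}
    (hFm : Measurable F) (hF : ∀ τ, |F τ| ≤ C) {t : ℝ} (ht : 0 ≤ t) {B : ℝ} {Φ : ℝ → ℝ}
    (hΦ : IsTest L B Φ) :
    ∫ x in 0..L, (Φ x : ℂ)
        * ratioIntegral k L (fun s => ∫ τ in 0..t, boundaryDensity D k F t s τ) (L - x)
      = Complex.I * ((2 * Real.pi * ∫ τ in 0..t, Real.exp (-(D * k ^ 2 * (t - τ))) * F τ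
          * ∫ z in Ioi 0, Φ z * fluxKernel (D * (t - τ)) z : ℝ) : ℂ) := by
  have hC : 0 ≤ C := (abs_nonneg _).trans (hF 0)
  rw [integral_test_mul_ratioIntegral (linearGrowth_boundary D k hFm hF ht) hL hΦ ht
    (W := fun z τ => Complex.I * ((2 * Real.pi * (Real.exp (-(D * k ^ 2 * (t - τ))) * F τ
          * fluxKernel (D * (t - τ)) z) : ℝ) : ℂ)) ?_
    (fun z hz => expIntegral_boundary hD k hFm hF ht hz)
    (g := fun z => 2 * Real.pi * C * (64 * B * (1 + z ^ 2)⁻¹))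
    ((integrable_inv_one_add_sq.const_mul _).const_mul _).integrableOn ?_]
  · rw [← intervalIntegral.integral_const_mul, ← intervalIntegral.integral_ofReal,
      ← intervalIntegral.integral_const_mul]
    refine intervalIntegral.integral_congr fun τ _ => ?_
    rw [← mul_assoc, ← integral_const_mul, ← integral_complex_ofReal, ← integral_const_mul]
    refine integral_congr_ae (.of_forall fun z => ?_)
    push_cast
    ring
  · have h1 := measurable_fluxKernel D t
    simp only [Function.uncurry_def]
    refine measurable_const.mul (Complex.measurable_ofReal.comp (measurable_const.mul
      (Measurable.mul (Measurable.mul ?_ (hFm.comp measurable_snd)) h1)))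
    fun_prop
  · intro τ hτ z hz
    have h0 : 0 ≤ D * (t - τ) := mul_nonneg hD.le (sub_nonneg.2 hτ.2)
    have h1 := hΦ.mul_fluxKernel_le h0 hz
    have h2 : Real.exp (-(D * k ^ 2 * (t - τ))) ≤ 1 := Real.exp_le_one_iff.2 (by
      nlinarith [mul_nonneg h0 (sq_nonneg k)])
    have h3 : 0 ≤ fluxKernel (D * (t - τ)) z :=
      mul_nonneg (by have : 0 < z := hz; positivity) (heatKernel_nonneg _ _)
    simp only [norm_mul, Complex.norm_I, Complex.norm_real, Real.norm_eq_abs, one_mul,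
      abs_of_nonneg h3, abs_of_pos Real.pi_pos, Real.abs_exp, abs_two]
    calc _ = 2 * Real.pi * (Real.exp (-(D * k ^ 2 * (t - τ))) * |F τ|)
          * (|Φ z| * fluxKernel (D * (t - τ)) z) := by ring
      _ ≤ 2 * Real.pi * (1 * C) * (64 * B * (1 + z ^ 2)⁻¹) := by
        gcongr
        exact hF τ
      _ = _ := by ring

/-! ### Sources coming from the initial datum -/

/-- The density along the hyperbola that comes from the initial datum `ρ`. -/
def initialDensity (k a : ℝ) (ρ : ℝ → ℝ) (s y : ℝ) : ℂ :=
  Complex.exp (-a * hyp k s ^ 2) * deriv (hyp k) s * (Complex.exp (Complex.I * hyp k s * y) * ρ y)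

theorem measurable_initialDensity (k a : ℝ) {ρ : ℝ → ℝ} (hρ : Measurable ρ) :
    Measurable (Function.uncurry (initialDensity k a ρ)) := by
  unfold initialDensity Function.uncurry
  have h1 : Continuous fun p : ℝ × ℝ => Complex.exp (-a * hyp k p.1 ^ 2) := by fun_prop
  have h2 : Measurable fun p : ℝ × ℝ => deriv (hyp k) p.1 := (measurable_deriv _).comp measurable_fst
  have h3 : Continuous fun p : ℝ × ℝ => Complex.exp (Complex.I * hyp k p.1 * p.2) := by fun_prop
  have h4 : Measurable fun p : ℝ × ℝ => (ρ p.2 : ℂ) :=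
    Complex.measurable_ofReal.comp (hρ.comp measurable_snd)
  exact (h1.measurable.mul h2).mul (h3.measurable.mul h4)

theorem norm_initialDensity_le (k a : ℝ) {ρ : ℝ → ℝ} (hρ : ∀ y, |ρ y| ≤ C) (L : ℝ) :
    ∀ᵐ s : ℝ, ∀ y ∈ Ioc 0 L, ‖initialDensity k a ρ s y‖
      ≤ (2 * Real.exp (a * k ^ 2) * C) * (1 + |s|) := by
  have hC : 0 ≤ C := (abs_nonneg _).trans (hρ 0)
  filter_upwards [ae_norm_deriv_hyp_le k] with s hs y hy
  rw [initialDensity, norm_mul, norm_mul, norm_mul, norm_exp_neg_hyp_sq, Complex.norm_real,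
    Real.norm_eq_abs]
  have h1 : ‖Complex.exp (Complex.I * hyp k s * y)‖ ≤ 1 :=
    (norm_exp_I_hyp_le k s hy.1.le).trans (Real.exp_le_one_iff.2 (by
      have := mul_nonneg hy.1.le (abs_nonneg s); linarith))
  calc _ ≤ Real.exp (a * k ^ 2) * 2 * (1 * C) := by
        gcongr
        exact hρ y
    _ = (2 * Real.exp (a * k ^ 2) * C) * 1 := by ring
    _ ≤ _ := by gcongr; linarith [abs_nonneg s]

theorem linearGrowth_initial (k a : ℝ) {ρ : ℝ → ℝ} (hρm : Measurable ρ) (hρ : ∀ y, |ρ y| ≤ C)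
    (hL : 0 ≤ L) : LinearGrowth (fun s => ∫ y in 0..L, initialDensity k a ρ s y)
      (2 * Real.exp (a * k ^ 2) * C * L) :=
  linearGrowth_integral hL (measurable_initialDensity k a hρm)
    (by have : 0 ≤ C := (abs_nonneg _).trans (hρ 0)
        positivity)
    (norm_initialDensity_le k a hρ L)

/-- The factor `e^{iμy}` of the density joins `e^{iμz}`, so the Gaussian integral is evaluated at `z
+ y`: the heat kernel between `z` and the mirror image `-y`. -/
theorem expIntegral_initial {a : ℝ} (ha : 0 < a) (k : ℝ) {ρ : ℝ → ℝ} (hρm : Measurable ρ)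
    (hρ : ∀ y, |ρ y| ≤ C) (hL : 0 ≤ L) {z : ℝ} (hz : 0 < z) :
    expIntegral k (fun s => ∫ y in 0..L, initialDensity k a ρ s y) z
      = ∫ y in 0..L, ((2 * Real.pi * (ρ y * heatKernel a (z + y)) : ℝ) : ℂ) := by
  rw [expIntegral_integral hL (measurable_initialDensity k a hρm)
    (C := 2 * Real.exp (a * k ^ 2) * C) (by have : 0 ≤ C := (abs_nonneg _).trans (hρ 0)
                                            positivity)
    (norm_initialDensity_le k a hρ L) hz]
  refine intervalIntegral.integral_congr_ae (.of_forall fun y hy => ?_)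
  rw [uIoc_of_le hL] at hy
  have h := expIntegral_gauss k ha (add_pos hz hy.1)
  rw [sqrt_mul_exp_eq] at h
  rw [mul_left_comm, Complex.ofReal_mul, ← h]
  unfold expIntegral
  rw [← integral_const_mul]
  refine integral_congr_ae (.of_forall fun s => ?_)
  simp only [initialDensity]
  rw [Complex.ofReal_add, mul_add, Complex.exp_add]
  ring

theorem heatKernel_anti {a z w : ℝ} (ha : 0 < a) (hz : 0 ≤ z) (hzw : z ≤ w) :
    heatKernel a w ≤ heatKernel a z := by
  unfold heatKernel
  gcongr

theorem integral_test_mul_initial {a : ℝ} (ha : 0 < a) (k : ℝ) (hL : 0 < L) {ρ : ℝ → ℝ}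
    (hρm : Measurable ρ) (hρ : ∀ τ, |ρ τ| ≤ C) {B : ℝ} {Φ : ℝ → ℝ} (hΦ : IsTest L B Φ) :
    ∫ x in 0..L, (Φ x : ℂ)
        * ratioIntegral k L (fun s => ∫ y in 0..L, initialDensity k a ρ s y) (L - x)
      = ((2 * Real.pi * ∫ y in 0..L, ρ y * ∫ z in Ioi 0, Φ z * heatKernel a (z + y) : ℝ) : ℂ) := by
  have hC : 0 ≤ C := (abs_nonneg _).trans (hρ 0)
  have hB : 0 ≤ B := (abs_nonneg _).trans (hΦ.bound' 0)
  rw [integral_test_mul_ratioIntegral (linearGrowth_initial k a hρm hρ hL.le) hL hΦ hL.le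
    (W := fun z y => ((2 * Real.pi * (ρ y * heatKernel a (z + y)) : ℝ) : ℂ)) ?_
    (fun z hz => expIntegral_initial ha k hρm hρ hL.le hz)
    (g := fun z => 2 * Real.pi * C * B * heatKernel a z)
    ((integrable_heatKernel ha).const_mul _).integrableOn ?_]
  · rw [← intervalIntegral.integral_const_mul, ← intervalIntegral.integral_ofReal]
    refine intervalIntegral.integral_congr fun y _ => ?_
    rw [← mul_assoc, ← integral_const_mul, ← integral_complex_ofReal]
    refine integral_congr_ae (.of_forall fun z => ?_)
    push_cast
    ring
  · have h1 : Continuous fun p : ℝ × ℝ => heatKernel a (p.1 + p.2) := by fun_prop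
    simp only [Function.uncurry_def]
    exact Complex.measurable_ofReal.comp (measurable_const.mul
      ((hρm.comp measurable_snd).mul h1.measurable))
  · intro y hy z hz
    have h1 : heatKernel a (z + y) ≤ heatKernel a z :=
      heatKernel_anti ha (le_of_lt hz) (by linarith [hy.1])
    have h0 := heatKernel_nonneg a (z + y)
    simp only [norm_mul, Complex.norm_real, Real.norm_eq_abs,
      abs_of_nonneg h0, abs_of_pos Real.pi_pos, abs_two]
    calc _ ≤ B * (2 * Real.pi * (C * heatKernel a z)) := by
          gcongr
          · exact hΦ.bound' z
          · exact hρ y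
      _ = _ := by ring

end

end AdvectionDiffusion

namespace AdvectionDiffusion

noncomputable section

/-! ### Sine coefficients of the right-hand side -/

variable {L C B : ℝ}

theorem IsTest.integrable_mul_heatKernel {Φ : ℝ → ℝ} (hΦ : IsTest L B Φ) {a : ℝ} (ha : 0 < a)
    (y : ℝ) : Integrable fun x => Φ x * heatKernel a (x - y) := by
  have := hΦ.cont
  exact ((integrable_heatKernel ha).comp_sub_right y).bdd_mul (c := B) (by fun_prop)
    (.of_forall fun x => hΦ.bound' x)

theorem IsTest.intervalIntegrable_mul_setIntegral {Φ : ℝ → ℝ} (hΦ : IsTest L B Φ) {a : ℝ}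
    (ha : 0 < a) {ρ : ℝ → ℝ} (hρm : Measurable ρ) (hρ : ∀ y, |ρ y| ≤ C) (S : Set ℝ) :
    IntervalIntegrable (fun y => ρ y * ∫ x in S, Φ x * heatKernel a (x - y)) volume 0 L := by
  have hcont := hΦ.cont
  have hm : StronglyMeasurable fun y => ∫ x in S, Φ x * heatKernel a (x - y) := by
    have h : Continuous fun p : ℝ × ℝ => Φ p.2 * heatKernel a (p.2 - p.1) := by fun_prop
    exact h.stronglyMeasurable.integral_prod_right (ν := volume.restrict S)
  refine (intervalIntegrable_const (c := C * (B * ∫ x, heatKernel a x))).mono_fun'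
    (hρm.stronglyMeasurable.mul hm).aestronglyMeasurable (.of_forall fun y => ?_)
  have hC : 0 ≤ C := (abs_nonneg _).trans (hρ 0)
  beta_reduce
  rw [norm_mul]
  gcongr
  · exact hρ y
  · have hi := ((integrable_heatKernel ha).comp_sub_right y).const_mul B
    calc ‖∫ x in S, Φ x * heatKernel a (x - y)‖ ≤ ∫ x in S, B * heatKernel a (x - y) := by
          refine norm_integral_le_of_norm_le hi.integrableOn (.of_forall fun x => ?_)
          rw [norm_mul, Real.norm_eq_abs, Real.norm_eq_abs, abs_of_nonneg (heatKernel_nonneg _ _)]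
          exact mul_le_mul_of_nonneg_right (hΦ.bound' x) (heatKernel_nonneg _ _)
      _ ≤ ∫ x, B * heatKernel a (x - y) := by
          refine setIntegral_le_integral hi (.of_forall fun x => ?_)
          exact mul_nonneg ((abs_nonneg _).trans (hΦ.bound' 0)) (heatKernel_nonneg _ _)
      _ = B * ∫ x, heatKernel a x := by
          rw [integral_const_mul, integral_sub_right_eq_self (heatKernel a)]

theorem integral_test_mul_integral_heatKernel {Φ : ℝ → ℝ} (hΦ : IsTest L B Φ) {a : ℝ}
    (ha : 0 < a) {ρ : ℝ → ℝ} (hρm : Measurable ρ) (hρ : ∀ y, |ρ y| ≤ C) (hL : 0 ≤ L) :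
    ∫ x in 0..L, Φ x * ∫ y in 0..L, ρ y * heatKernel a (x - y)
      = ∫ y in 0..L, ρ y * ∫ x in Ioc 0 L, Φ x * heatKernel a (x - y) := by
  have hcont := hΦ.cont
  simp_rw [← intervalIntegral.integral_const_mul, ← integral_const_mul,
    ← intervalIntegral.integral_of_le hL]
  simp_rw [intervalIntegral.integral_of_le hL]
  rw [integral_integral_swap]
  · simp_rw [mul_left_comm]
  · refine Integrable.of_bound (C := B * (C * √(Real.pi / a))) ?_ ?_
    · have h : Continuous fun p : ℝ × ℝ => heatKernel a (p.1 - p.2) := by fun_prop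
      exact ((hcont.measurable.comp measurable_fst).mul
        ((hρm.comp measurable_snd).mul h.measurable)).aestronglyMeasurable
    · refine .of_forall fun p => ?_
      have hC : 0 ≤ C := (abs_nonneg _).trans (hρ 0)
      simp only [Function.uncurry_def, norm_mul, Real.norm_eq_abs,
        abs_of_nonneg (heatKernel_nonneg _ _)]
      have hB : 0 ≤ B := (abs_nonneg _).trans (hΦ.bound' 0)
      have := heatKernel_nonneg a (p.1 - p.2)
      gcongr
      · exact hΦ.bound' _
      · exact hρ _
      · exact heatKernel_le _ _ ha

theorem continuous_integral_heatKernel {a : ℝ} (ha : 0 < a) {ρ : ℝ → ℝ} (hρm : Measurable ρ)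
    (hρ : ∀ y, |ρ y| ≤ C) (L : ℝ) :
    Continuous fun x => ∫ y in 0..L, ρ y * heatKernel a (x - y) := by
  refine intervalIntegral.continuous_of_dominated_interval (bound := fun _ => C * √(Real.pi / a))
    (fun x => ?_) (fun x => .of_forall fun y _ => ?_) (by simp)
    (.of_forall fun y _ => by fun_prop)
  · have h : Continuous fun y => heatKernel a (x - y) := by fun_prop
    exact (hρm.mul h.measurable).aestronglyMeasurable
  · have hC : 0 ≤ C := (abs_nonneg _).trans (hρ 0)
    rw [norm_mul, Real.norm_eq_abs, Real.norm_eq_abs, abs_of_nonneg (heatKernel_nonneg _ _)]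
    have := heatKernel_nonneg a (x - y)
    gcongr
    · exact hρ y
    · exact heatKernel_le _ _ ha

/-- The combination of whole-line heat kernels produced by the initial datum. -/
theorem initial_combination {Φ : ℝ → ℝ} (hΦ : IsTest L B Φ) {a : ℝ}
    (ha : 0 < a) {ρ : ℝ → ℝ} (hρm : Measurable ρ) (hρ : ∀ y, |ρ y| ≤ C) (hL : 0 ≤ L) :
    (∫ x in 0..L, Φ x * ∫ y in 0..L, ρ y * heatKernel a (x - y))
      - (∫ y in 0..L, ρ y * ∫ z in Ioi 0, Φ z * heatKernel a (z + y))
      - (∫ y in 0..L, ρ (L - y) * ∫ z in Ioi 0, Φ (L - z) * heatKernel a (z + y))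
      = ∫ y in 0..L, ρ y * ∫ x, Φ x * heatKernel a (x - y) := by
  -- Oddness about `0` turns the mirrored kernel into an integral over `(-∞, 0]`; `h3` does the same
  -- about `L` for `(L, ∞)`. With the direct term on `(0, L]` they fill the line.
  have h2 (y : ℝ) : ∫ z in Ioi 0, Φ z * heatKernel a (z + y)
      = -∫ x in Iic 0, Φ x * heatKernel a (x - y) := by
    have := integral_comp_neg_Ioi 0 (fun x => Φ x * heatKernel a (x - y))
    rw [neg_zero] at this
    rw [← this, ← integral_neg]
    refine integral_congr_ae (.of_forall fun z => ?_)
    simp only [hΦ.odd]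
    rw [← heatKernel_neg, show -(z + y) = -z - y by ring]; ring
  have h3 (y : ℝ) : ∫ z in Ioi 0, Φ (L - z) * heatKernel a (z + (L - y))
      = -∫ x in Ioi L, Φ x * heatKernel a (x - y) := by
    have hp : MeasurePreserving (fun z : ℝ => z + L) := measurePreserving_add_right volume L
    have := hp.setIntegral_preimage_emb (measurableEmbedding_addRight L)
      (fun x => Φ x * heatKernel a (x - y)) (Ioi L)
    rw [← this, ← integral_neg]
    have hs : (fun z : ℝ => z + L) ⁻¹' Ioi L = Ioi 0 := by ext z; simp
    rw [hs]
    refine integral_congr_ae (.of_forall fun z => ?_)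
    simp only
    have e := hΦ.reflect 0 (L + z)
    rw [show (2 * ((0 : ℕ) : ℝ) + 2) * L - (L + z) = L - z by push_cast; ring] at e
    rw [e, show z + (L - y) = z + L - y by ring, add_comm L z]; ring
  have h4 : ∫ y in 0..L, ρ (L - y) * ∫ z in Ioi 0, Φ (L - z) * heatKernel a (z + y)
      = ∫ y in 0..L, -(ρ y * ∫ x in Ioi L, Φ x * heatKernel a (x - y)) := by
    have := intervalIntegral.integral_comp_sub_left (a := 0) (b := L)
      (fun y => -(ρ y * ∫ x in Ioi L, Φ x * heatKernel a (x - y))) L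
    rw [sub_self, sub_zero] at this
    rw [← this]
    refine intervalIntegral.integral_congr fun y _ => ?_
    rw [← mul_neg, ← h3, sub_sub_cancel]
  have i1 := hΦ.intervalIntegrable_mul_setIntegral ha hρm hρ (Ioc 0 L)
  have i2 := hΦ.intervalIntegrable_mul_setIntegral ha hρm hρ (Iic 0)
  have i3 := hΦ.intervalIntegrable_mul_setIntegral ha hρm hρ (Ioi L)
  rw [integral_test_mul_integral_heatKernel hΦ ha hρm hρ hL, h4]
  simp_rw [h2, mul_neg, intervalIntegral.integral_neg, sub_neg_eq_add]
  rw [← intervalIntegral.integral_add i1 i2, ← intervalIntegral.integral_add (i1.add i2) i3]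
  refine intervalIntegral.integral_congr fun y _ => ?_
  have hi := hΦ.integrable_mul_heatKernel ha y
  rw [← intervalIntegral.integral_Iic_add_Ioi (b := 0) hi.integrableOn hi.integrableOn,
    ← Ioc_union_Ioi_eq_Ioi hL, setIntegral_union (Ioc_disjoint_Ioi le_rfl) measurableSet_Ioi
      hi.integrableOn hi.integrableOn]
  ring

/-! ### Sine polynomials -/

variable {ι : Type} [Fintype ι]

/-- A finite combination of sines with frequencies `l i`. -/
def sinePoly (c l : ι → ℝ) (x : ℝ) : ℝ := ∑ i, c i * Real.sin (l i * x)

/-- With this, a term attached to the right end is treated as one attached to the left end with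
changed coefficients. -/
theorem sinePoly_reflect {c l : ι → ℝ} (hl : ∀ i, Real.sin (l i * L) = 0) (x : ℝ) :
    sinePoly c l (L - x) = sinePoly (fun i => -(c i * Real.cos (l i * L))) l x := by
  refine Finset.sum_congr rfl fun i _ => ?_
  rw [mul_sub, Real.sin_sub, hl]; ring

theorem integral_sinePoly_mul_heatKernel (c l : ι → ℝ) {a : ℝ} (ha : 0 < a) (y : ℝ) :
    ∫ x, sinePoly c l x * heatKernel a (x - y)
      = ∑ i, c i * (Real.exp (-(a * l i ^ 2)) * Real.sin (l i * y)) := by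
  simp_rw [sinePoly, Finset.sum_mul, mul_assoc]
  rw [integral_finsetSum]
  · simp_rw [integral_const_mul, integral_sin_mul_heatKernel_sub ha]
  · intro i _
    exact (((integrable_heatKernel ha).comp_sub_right y).bdd_mul (c := 1) (by fun_prop)
      (.of_forall fun x => Real.abs_sin_le_one _)).const_mul _

theorem integral_sinePoly_mul_fluxKernel (c l : ι → ℝ) {a : ℝ} (ha : 0 < a) :
    ∫ x in Ioi (0 : ℝ), sinePoly c l x * fluxKernel a x
      = ∑ i, c i * (l i / 2 * Real.exp (-(a * l i ^ 2))) := by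
  simp_rw [sinePoly, Finset.sum_mul, mul_assoc]
  rw [integral_finsetSum]
  · simp_rw [integral_const_mul, integral_sin_mul_fluxKernel ha]
  · intro i _
    exact (integrable_sin_mul_fluxKernel ha (l i)).integrableOn.const_mul _

/-- The right-hand side of the representation formula, multiplied by `e^{-kx}` and written with
densities along the hyperbola. -/
def reducedRepresentation (D k L : ℝ) (ρ F G : ℝ → ℝ) (t x : ℝ) : ℂ :=
  Real.exp (-(D * t * k ^ 2)) * (((∫ y in 0..L, ρ y * heatKernel (D * t) (x - y) : ℝ) : ℂ)
      - 1 / (2 * Real.pi) * (ratioIntegral k L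
          (fun s => ∫ y in 0..L, initialDensity k (D * t) (fun y => ρ (L - y)) s y) x
        + ratioIntegral k L (fun s => ∫ y in 0..L, initialDensity k (D * t) ρ s y) (L - x)))
    - Complex.I * D / Real.pi * (ratioIntegral k L
          (fun s => ∫ τ in 0..t, boundaryDensity D k F t s τ) (L - x)
        + Real.exp (-(k * L)) * ratioIntegral k L
          (fun s => ∫ τ in 0..t, boundaryDensity D k G t s τ) x)

theorem integral_sinePoly_mul_boundary {D : ℝ} (hD : 0 < D) (k : ℝ) (hL : 0 < L) {F : ℝ → ℝ}
    (hFm : Measurable F) (hF : ∀ τ, |F τ| ≤ C) {t : ℝ} (ht : 0 ≤ t) {c l : ι → ℝ}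
    (hΦ : IsTest L B (sinePoly c l)) :
    ∫ x in 0..L, (sinePoly c l x : ℂ)
        * ratioIntegral k L (fun s => ∫ τ in 0..t, boundaryDensity D k F t s τ) (L - x)
      = Complex.I * ((Real.pi * ∑ i, c i * (l i * ∫ τ in 0..t,
          Real.exp (-(D * (l i ^ 2 + k ^ 2) * (t - τ))) * F τ) : ℝ) : ℂ) := by
  rw [integral_test_mul_boundary hD k hL hFm hF ht hΦ]
  congr 2
  have e : ∫ τ in 0..t, Real.exp (-(D * k ^ 2 * (t - τ))) * F τ
          * ∫ z in Ioi 0, sinePoly c l z * fluxKernel (D * (t - τ)) z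
      = ∫ τ in 0..t, ∑ i, c i * (l i / 2) * (Real.exp (-(D * (l i ^ 2 + k ^ 2) * (t - τ))) * F τ) := by
    refine intervalIntegral.integral_congr_ae ?_
    filter_upwards [Measure.ae_ne volume t] with τ hτ hmem
    rw [uIoc_of_le ht] at hmem
    rw [integral_sinePoly_mul_fluxKernel _ _ (mul_pos hD (sub_pos.2 (lt_of_le_of_ne hmem.2 hτ))),
      Finset.mul_sum]
    refine Finset.sum_congr rfl fun i _ => ?_
    rw [show -(D * (l i ^ 2 + k ^ 2) * (t - τ)) = -(D * k ^ 2 * (t - τ)) + -(D * (t - τ) * l i ^ 2)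
      by ring, Real.exp_add]
    ring
  have hi (i : ι) : IntervalIntegrable
      (fun τ => Real.exp (-(D * (l i ^ 2 + k ^ 2) * (t - τ))) * F τ) volume 0 t := by
    have h : IntervalIntegrable F volume 0 t :=
      (intervalIntegrable_const (c := C)).mono_fun' hFm.aestronglyMeasurable (.of_forall hF)
    exact h.continuousOn_mul (by fun_prop)
  rw [e, intervalIntegral.integral_finsetSum fun i _ => (hi i).const_mul _]
  simp_rw [intervalIntegral.integral_const_mul]
  rw [Finset.mul_sum, Finset.mul_sum]
  refine Finset.sum_congr rfl fun i _ => ?_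
  ring

theorem integral_reflect (Φ : ℝ → ℝ) (V : ℝ → ℂ) :
    ∫ x in 0..L, (Φ x : ℂ) * V x = ∫ x in 0..L, (Φ (L - x) : ℂ) * V (L - x) := by
  have := intervalIntegral.integral_comp_sub_left (a := 0) (b := L) (fun x => (Φ x : ℂ) * V x) L
  rw [sub_self, sub_zero] at this
  exact this.symm

theorem intervalIntegrable_test_mul_ratioIntegral {k : ℝ} {A : ℝ → ℂ} (hA : LinearGrowth A C)
    (hL : 0 < L) {Φ : ℝ → ℝ} (hΦ : IsTest L B Φ) :
    IntervalIntegrable (fun x => (Φ x : ℂ) * ratioIntegral k L A (L - x)) volume 0 L := by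
  have hB : 0 ≤ B := (abs_nonneg _).trans (hΦ.bound' 0)
  have hcont := hΦ.cont
  rw [intervalIntegrable_iff_integrableOn_Ioo_of_le hL.le]
  refine Integrable.of_bound ?_ (B * majorantConst C L) ?_
  · refine ContinuousOn.aestronglyMeasurable ?_ measurableSet_Ioo
    refine (by fun_prop : Continuous fun z => (Φ z : ℂ)).continuousOn.mul
      ((continuousOn_ratioIntegral hA hL).comp (by fun_prop) ?_)
    intro x hx
    exact ⟨by linarith [hx.2], by linarith [hx.1]⟩
  · refine (ae_restrict_iff' measurableSet_Ioo).2 (.of_forall fun x hx => ?_)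
    have hx0 : 0 < x := hx.1
    rw [norm_mul, Complex.norm_real, Real.norm_eq_abs]
    have h := norm_ratioIntegral_le (k := k) hA hL (a := L - x) (by linarith [hx.2]) (by linarith)
    rw [sub_sub_cancel] at h
    calc _ ≤ (B * |x| ^ 3) * (majorantConst C L / x ^ 3) := by
          gcongr
          exact hΦ.bound x
      _ = _ := by rw [abs_of_pos hx0]; field_simp

/-- The value is the `c`-combination of the right-hand sides in `IsSolution.sine_moment`. The terms
with quotient argument `x` are reflected to `L - x` first, and for these the reflected polynomial
must be a test function as well. -/
theorem integral_sinePoly_mul_reducedRepresentation {D : ℝ} (hD : 0 < D) (k : ℝ) (hL : 0 < L)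
    {ρ F G : ℝ → ℝ} (hρm : Measurable ρ) (hρ : ∀ y, |ρ y| ≤ C) (hFm : Measurable F)
    (hF : ∀ y, |F y| ≤ C) (hGm : Measurable G) (hG : ∀ y, |G y| ≤ C) {t : ℝ} (ht : 0 < t)
    {c l : ι → ℝ} (hl : ∀ i, Real.sin (l i * L) = 0) (hΦ : IsTest L B (sinePoly c l))
    (hΦ' : IsTest L B fun x => sinePoly c l (L - x)) :
    ∫ x in 0..L, (sinePoly c l x : ℂ) * reducedRepresentation D k L ρ F G t x
      = ((∑ i, c i * (Real.exp (-(D * (l i ^ 2 + k ^ 2) * t)) * (∫ y in 0..L, ρ y * Real.sin (l i * y))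
          + D * l i * ((∫ τ in 0..t, Real.exp (-(D * (l i ^ 2 + k ^ 2) * (t - τ))) * F τ)
            - Real.cos (l i * L) * Real.exp (-(k * L))
              * ∫ τ in 0..t, Real.exp (-(D * (l i ^ 2 + k ^ 2) * (t - τ))) * G τ)) : ℝ) : ℂ) := by
  have ha : 0 < D * t := mul_pos hD ht
  have hρ' : Measurable fun y => ρ (L - y) := hρm.comp (by fun_prop)
  have g1 := linearGrowth_initial k (D * t) hρ' (fun y => hρ _) hL.le
  have g2 := linearGrowth_initial k (D * t) hρm hρ hL.le
  have g3 := linearGrowth_boundary D k hFm hF ht.le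
  have g4 := linearGrowth_boundary D k hGm hG ht.le
  have refl {A : ℝ → ℂ} {C' : ℝ} (g : LinearGrowth A C') :
      IntervalIntegrable (fun x => (sinePoly c l x : ℂ) * ratioIntegral k L A x) volume 0 L := by
    have := (intervalIntegrable_test_mul_ratioIntegral (k := k) g hL hΦ').comp_sub_left L
    simpa using this.symm
  have i1 := refl g1
  have i2 := intervalIntegrable_test_mul_ratioIntegral (k := k) g2 hL hΦ
  have i3 := intervalIntegrable_test_mul_ratioIntegral (k := k) g3 hL hΦ
  have i4 := refl g4
  have i0 : IntervalIntegrable (fun x => (sinePoly c l x : ℂ)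
      * ((∫ y in 0..L, ρ y * heatKernel (D * t) (x - y) : ℝ) : ℂ)) volume 0 L := by
    have h1 := hΦ.cont
    have h2 := continuous_integral_heatKernel ha hρm hρ L
    exact Continuous.intervalIntegrable (by fun_prop) _ _
  have v1 := integral_test_mul_initial ha k hL hρ' (fun y => hρ _) hΦ'
  have v2 := integral_test_mul_initial ha k hL hρm hρ hΦ
  have v3 := integral_sinePoly_mul_boundary hD k hL hFm hF ht.le hΦ
  have v4 := integral_sinePoly_mul_boundary hD k hL hGm hG ht.le
    (c := fun i => -(c i * Real.cos (l i * L))) (l := l) (B := B)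
    (by simpa only [sinePoly_reflect hl] using hΦ')
  have v0 := initial_combination hΦ ha hρm hρ hL.le
  simp_rw [integral_sinePoly_mul_heatKernel c l ha] at v0
  have v5 : ∫ y in 0..L, ρ y * ∑ i, c i * (Real.exp (-(D * t * l i ^ 2)) * Real.sin (l i * y))
      = ∑ i, c i * Real.exp (-(D * t * l i ^ 2)) * ∫ y in 0..L, ρ y * Real.sin (l i * y) := by
    have h : IntervalIntegrable ρ volume 0 L :=
      (intervalIntegrable_const (c := C)).mono_fun' hρm.aestronglyMeasurable (.of_forall hρ)
    have hi (i : ι) : IntervalIntegrable (fun y => ρ y * Real.sin (l i * y)) volume 0 L :=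
      h.mul_continuousOn (by fun_prop)
    simp_rw [← intervalIntegral.integral_const_mul]
    rw [← intervalIntegral.integral_finsetSum fun i _ => (hi i).const_mul _]
    refine intervalIntegral.integral_congr fun y _ => ?_
    rw [Finset.mul_sum]
    exact Finset.sum_congr rfl fun i _ => by ring
  rw [v5] at v0
  rw [← integral_reflect (sinePoly c l)
    (ratioIntegral k L fun s => ∫ y in 0..L, initialDensity k (D * t) (fun y => ρ (L - y)) s y)] at v1
  simp_rw [← sinePoly_reflect (c := c) hl] at v4
  rw [← integral_reflect (sinePoly c l)
    (ratioIntegral k L fun s => ∫ τ in 0..t, boundaryDensity D k G t s τ)] at v4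
  have e (x : ℝ) : (sinePoly c l x : ℂ) * reducedRepresentation D k L ρ F G t x
      = Real.exp (-(D * t * k ^ 2)) * ((sinePoly c l x : ℂ)
          * ((∫ y in 0..L, ρ y * heatKernel (D * t) (x - y) : ℝ) : ℂ))
        - Real.exp (-(D * t * k ^ 2)) * (1 / (2 * Real.pi)) * ((sinePoly c l x : ℂ)
          * ratioIntegral k L (fun s => ∫ y in 0..L,
            initialDensity k (D * t) (fun y => ρ (L - y)) s y) x)
        - Real.exp (-(D * t * k ^ 2)) * (1 / (2 * Real.pi)) * ((sinePoly c l x : ℂ)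
          * ratioIntegral k L (fun s => ∫ y in 0..L, initialDensity k (D * t) ρ s y) (L - x))
        - Complex.I * D / Real.pi * ((sinePoly c l x : ℂ)
          * ratioIntegral k L (fun s => ∫ τ in 0..t, boundaryDensity D k F t s τ) (L - x))
        - Complex.I * D / Real.pi * Real.exp (-(k * L)) * ((sinePoly c l x : ℂ)
          * ratioIntegral k L (fun s => ∫ τ in 0..t, boundaryDensity D k G t s τ) x) := by
    unfold reducedRepresentation
    ring
  have v6 : ∫ x in 0..L, (sinePoly c l x : ℂ)
      * ((∫ y in 0..L, ρ y * heatKernel (D * t) (x - y) : ℝ) : ℂ)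
      = ((∫ x in 0..L, sinePoly c l x * ∫ y in 0..L, ρ y * heatKernel (D * t) (x - y) : ℝ) : ℂ) := by
    rw [← intervalIntegral.integral_ofReal]
    simp_rw [Complex.ofReal_mul]
  simp_rw [e]
  rw [intervalIntegral.integral_sub ((((i0.const_mul _).sub (i1.const_mul _)).sub
      (i2.const_mul _)).sub (i3.const_mul _)) (i4.const_mul _),
    intervalIntegral.integral_sub (((i0.const_mul _).sub (i1.const_mul _)).sub
      (i2.const_mul _)) (i3.const_mul _),
    intervalIntegral.integral_sub ((i0.const_mul _).sub (i1.const_mul _)) (i2.const_mul _),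
    intervalIntegral.integral_sub (i0.const_mul _) (i1.const_mul _)]
  simp_rw [intervalIntegral.integral_const_mul]
  rw [v1, v2, v3, v4, v6]
  have hsum : (∑ i, c i * (Real.exp (-(D * (l i ^ 2 + k ^ 2) * t))
        * (∫ y in 0..L, ρ y * Real.sin (l i * y))
      + D * l i * ((∫ τ in 0..t, Real.exp (-(D * (l i ^ 2 + k ^ 2) * (t - τ))) * F τ)
        - Real.cos (l i * L) * Real.exp (-(k * L))
          * ∫ τ in 0..t, Real.exp (-(D * (l i ^ 2 + k ^ 2) * (t - τ))) * G τ)))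
      = Real.exp (-(D * t * k ^ 2)) * (∑ i, c i * Real.exp (-(D * t * l i ^ 2))
          * ∫ y in 0..L, ρ y * Real.sin (l i * y))
        + D * (∑ i, c i * (l i * ∫ τ in 0..t,
          Real.exp (-(D * (l i ^ 2 + k ^ 2) * (t - τ))) * F τ))
        + D * Real.exp (-(k * L)) * (∑ i, -(c i * Real.cos (l i * L)) * (l i * ∫ τ in 0..t,
          Real.exp (-(D * (l i ^ 2 + k ^ 2) * (t - τ))) * G τ)) := by
    rw [Finset.mul_sum, Finset.mul_sum, Finset.mul_sum, ← Finset.sum_add_distrib,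
      ← Finset.sum_add_distrib]
    refine Finset.sum_congr rfl fun i _ => ?_
    rw [show -(D * (l i ^ 2 + k ^ 2) * t) = -(D * t * k ^ 2) + -(D * t * l i ^ 2) by ring,
      Real.exp_add]
    ring
  rw [hsum, ← v0]
  have hpi : (Real.pi : ℂ) ≠ 0 := by exact_mod_cast Real.pi_ne_zero
  simp only [Complex.ofReal_add, Complex.ofReal_sub, Complex.ofReal_mul, Complex.ofReal_ofNat]
  have h2 (p q : ℂ) : p * (1 / (2 * Real.pi)) * (2 * Real.pi * q) = p * q := by field_simp
  have h3 (q : ℂ) : Complex.I * D / Real.pi * (Complex.I * (Real.pi * q)) = -(D * q) := by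
    field_simp
    rw [Complex.I_sq]; ring
  have h4 (p q : ℂ) : Complex.I * D / Real.pi * p * (Complex.I * (Real.pi * q)) = -(D * p * q) := by
    field_simp
    rw [Complex.I_sq]; ring
  rw [h2, h2, h3, h4]
  ring

end

end AdvectionDiffusion

namespace AdvectionDiffusion

noncomputable section

/-! ### Sine moments of a solution -/

variable {D₀ K₀ L : ℝ} {θ₀ f g : ℝ → ℝ} {θ : ℝ → ℝ → ℝ}

/-- Green's identity on a rectangle inside the half strip, for the test function
`e^{-kx} sin (λ(x - a))`, which vanishes at both ends of `[a, b]`. -/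
theorem IsSolution.green_rectangle (hD : 0 < D₀) (hθ : IsSolution D₀ K₀ L θ₀ f g θ) {k l κ : ℝ}
    (hk : k = K₀ / (2 * D₀)) (hκ : κ = D₀ * (l ^ 2 + k ^ 2)) {a b t₀ t : ℝ} (ha : 0 < a)
    (hab : a ≤ b) (hb : b < L) (ht₀ : 0 < t₀) (ht : t₀ ≤ t) (hl : Real.sin (l * (b - a)) = 0) :
    Real.exp (κ * t) * (∫ x in a..b, θ x t * (Real.exp (-(k * x)) * Real.sin (l * (x - a))))
      - Real.exp (κ * t₀) * (∫ x in a..b, θ x t₀ * (Real.exp (-(k * x)) * Real.sin (l * (x - a))))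
      = (∫ τ in t₀..t, D₀ * (Real.exp (κ * τ) * (Real.exp (-(k * a)) * l * θ a τ)))
        - ∫ τ in t₀..t, D₀ * (Real.exp (κ * τ)
          * (Real.exp (-(k * b)) * l * Real.cos (l * (b - a)) * θ b τ)) := by
  have hK : K₀ = 2 * D₀ * k := by rw [hk]; field_simp
  have hmem {x : ℝ} (hx : x ∈ Icc a b) : x ∈ Ioo 0 L := ⟨ha.trans_le hx.1, hx.2.trans_lt hb⟩
  have hpos {τ : ℝ} (hτ : τ ∈ Icc t₀ t) : τ ∈ Ioi (0 : ℝ) := ht₀.trans_le hτ.1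
  have hsub : Icc a b ×ˢ Icc t₀ t ⊆ Ioo 0 L ×ˢ Ioi 0 := prod_mono (fun _ => hmem) (fun _ => hpos)
  set ψ : ℝ → ℝ := fun x => Real.exp (-(k * x)) * Real.sin (l * (x - a)) with hψ
  have hψc : Continuous ψ := by fun_prop
  set θt : ℝ → ℝ → ℝ := fun x τ => deriv (fun τ => θ x τ) τ
  set θx : ℝ → ℝ → ℝ := fun x τ => deriv (fun ξ => θ ξ τ) x
  set θxx : ℝ → ℝ → ℝ := fun x τ => deriv (deriv fun ξ => θ ξ τ) x
  -- This is the time derivative of `e^{κτ}θψ`. As `D₀ψ'' + K₀ψ' = -κψ`, the equation makes it also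
  -- an exact `x`-derivative.
  set H : ℝ → ℝ → ℝ := fun x τ => Real.exp (κ * τ) * ((κ * θ x τ + θt x τ) * ψ x) with hH
  have hHc : ContinuousOn (fun p : ℝ × ℝ => H p.1 p.2) (Icc a b ×ˢ Icc t₀ t) := by
    have h1 := hθ.continuous.mono hsub
    have h2 : ContinuousOn (fun p : ℝ × ℝ => θt p.1 p.2) (Icc a b ×ˢ Icc t₀ t) :=
      hθ.continuous_t.mono hsub
    exact (by fun_prop : Continuous fun p : ℝ × ℝ => Real.exp (κ * p.2)).continuousOn.mul
      (((continuousOn_const.mul h1).add h2).mul (by fun_prop))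
  have hslice_x {x : ℝ} (hx : x ∈ Icc a b) : ContinuousOn (H x) (Icc t₀ t) :=
    hHc.comp (f := fun τ => (x, τ)) (by fun_prop) fun τ hτ => ⟨hx, hτ⟩
  have hslice_t {τ : ℝ} (hτ : τ ∈ Icc t₀ t) : ContinuousOn (fun x => H x τ) (Icc a b) :=
    hHc.comp (f := fun x => (x, τ)) (by fun_prop) fun x hx => ⟨hx, hτ⟩
  have hθslice {τ : ℝ} (hτ : τ ∈ Icc t₀ t) : ContinuousOn (fun x => θ x τ) (Icc a b) :=
    (hθ.continuous.mono hsub).comp (f := fun x => (x, τ)) (by fun_prop) fun x hx => ⟨hx, hτ⟩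
  have hθslice' {x : ℝ} (hx : x ∈ Icc a b) : ContinuousOn (fun τ => θ x τ) (Icc t₀ t) :=
    (hθ.continuous.mono hsub).comp (f := fun τ => (x, τ)) (by fun_prop) fun τ hτ => ⟨hx, hτ⟩
  have ii {τ : ℝ} (hτ : τ ∈ Icc t₀ t) :
      IntervalIntegrable (fun x => Real.exp (κ * τ) * (θ x τ * ψ x)) volume a b := by
    refine ContinuousOn.intervalIntegrable_of_Icc hab ?_
    exact continuousOn_const.mul ((hθslice hτ).mul hψc.continuousOn)
  -- time direction
  have e1 {x : ℝ} (hx : x ∈ Icc a b) : ∫ τ in t₀..t, H x τ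
      = Real.exp (κ * t) * (θ x t * ψ x) - Real.exp (κ * t₀) * (θ x t₀ * ψ x) := by
    refine intervalIntegral.integral_eq_sub_of_hasDerivAt
      (f := fun τ => Real.exp (κ * τ) * (θ x τ * ψ x)) (fun τ hτ => ?_)
      ((hslice_x hx).intervalIntegrable_of_Icc ht)
    rw [uIcc_of_le ht] at hτ
    have h1 : HasDerivAt (fun τ => Real.exp (κ * τ)) (Real.exp (κ * τ) * (κ * 1)) τ :=
      ((hasDerivAt_id τ).const_mul κ).exp
    have h2 : HasDerivAt (fun τ => θ x τ) (θt x τ) τ :=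
      (hθ.differentiable_t x (hmem hx) τ (hpos hτ)).hasDerivAt
    refine (h1.mul (h2.mul_const (ψ x))).congr_deriv ?_
    simp only [hH]; ring
  -- space direction
  have e2 {τ : ℝ} (hτ : τ ∈ Icc t₀ t) : ∫ x in a..b, H x τ
      = D₀ * (Real.exp (κ * τ) * (Real.exp (-(k * a)) * l * θ a τ))
        - D₀ * (Real.exp (κ * τ) * (Real.exp (-(k * b)) * l * Real.cos (l * (b - a)) * θ b τ)) := by
    -- The primitive is `e^{κτ}(D₀(θ_xψ - θψ') - K₀θψ)`. At the ends `ψ = 0`, so only `-D₀θψ'`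
    -- survives.
    have h := intervalIntegral.integral_eq_sub_of_hasDerivAt (a := a) (b := b)
      (f := fun x => Real.exp (κ * τ) * (D₀ * (Real.exp (-(k * x)) * (θx x τ * Real.sin (l * (x - a))
        - θ x τ * (l * Real.cos (l * (x - a)) + k * Real.sin (l * (x - a)))))))
      (f' := fun x => H x τ) (fun x hx => ?_) ((hslice_t hτ).intervalIntegrable_of_Icc hab)
    · rw [h, hl, sub_self a, mul_zero l, Real.sin_zero, Real.cos_zero]; ring
    rw [uIcc_of_le hab] at hx
    have h1 : HasDerivAt (fun x => Real.exp (-(k * x))) (Real.exp (-(k * x)) * -(k * 1)) x :=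
      ((hasDerivAt_id x).const_mul k).neg.exp
    have h2 : HasDerivAt (fun x => θ x τ) (θx x τ) x :=
      (hθ.differentiable_x x (hmem hx) τ (hpos hτ)).hasDerivAt
    have h3 : HasDerivAt (fun x => θx x τ) (θxx x τ) x :=
      (hθ.differentiable_xx x (hmem hx) τ (hpos hτ)).hasDerivAt
    have h0 : HasDerivAt (fun x => l * (x - a)) (l * 1) x :=
      ((hasDerivAt_id x).sub_const a).const_mul l
    have h4 := h0.sin
    have h5 := h0.cos
    have hpde : θt x τ + K₀ * θx x τ = D₀ * θxx x τ := hθ.pde x (hmem hx) τ (hpos hτ)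
    refine ((h1.mul ((h3.mul h4).sub (h2.mul ((h5.const_mul l).add (h4.const_mul k))))).const_mul
      D₀ |>.const_mul (Real.exp (κ * τ))).congr_deriv ?_
    have hθt : θt x τ = D₀ * θxx x τ - 2 * D₀ * k * θx x τ := by rw [← hK]; linarith
    simp only [hH, hψ, hθt, hκ, Pi.add_apply, Pi.sub_apply, Pi.mul_apply]
    ring
  have hint : Integrable (Function.uncurry H)
      ((volume.restrict (uIoc a b)).prod (volume.restrict (Ioc t₀ t))) := by
    rw [uIoc_of_le hab, Measure.prod_restrict]
    exact (hHc.integrableOn_compact (isCompact_Icc.prod isCompact_Icc)).mono_set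
      (prod_mono Ioc_subset_Icc_self Ioc_subset_Icc_self)
  have hswap : ∫ x in a..b, ∫ τ in t₀..t, H x τ = ∫ τ in t₀..t, ∫ x in a..b, H x τ := by
    simp_rw [intervalIntegral.integral_of_le ht]
    exact intervalIntegral_integral_swap hint
  have ib {c w : ℝ} (hc : c ∈ Icc a b) :
      IntervalIntegrable (fun τ => D₀ * (Real.exp (κ * τ) * (w * θ c τ))) volume t₀ t := by
    refine ContinuousOn.intervalIntegrable_of_Icc ht ?_
    have := hθslice' hc
    fun_prop
  rw [← intervalIntegral.integral_sub (ib ⟨le_rfl, hab⟩) (ib ⟨hab, le_rfl⟩),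
    ← intervalIntegral.integral_const_mul, ← intervalIntegral.integral_const_mul,
    ← intervalIntegral.integral_sub (ii ⟨ht, le_rfl⟩) (ii ⟨le_rfl, ht⟩)]
  rw [← intervalIntegral.integral_congr (g := fun x => _) fun x hx =>
    e1 (by rwa [uIcc_of_le hab] at hx), hswap]
  exact intervalIntegral.integral_congr fun τ hτ => e2 (by rwa [uIcc_of_le ht] at hτ)

/-- Extension by zero to `[a₀, b₀]` reduces this to dominated convergence with a constant bound;
every interior point eventually lies in the moving interval. -/
theorem tendsto_integral_of_shrinking {a b : ℝ → ℝ} {F : ℝ → ℝ → ℝ} {F₀ : ℝ → ℝ} {a₀ b₀ C : ℝ}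
    (h₀ : a₀ ≤ b₀) (ha : ∀ᶠ ε in 𝓝[>] (0 : ℝ), a₀ ≤ a ε ∧ a ε ≤ b ε ∧ b ε ≤ b₀)
    (hta : Tendsto a (𝓝[>] 0) (𝓝 a₀)) (htb : Tendsto b (𝓝[>] 0) (𝓝 b₀))
    (hc : ∀ᶠ ε in 𝓝[>] (0 : ℝ), ContinuousOn (F ε) (Icc (a ε) (b ε)))
    (hb : ∀ᶠ ε in 𝓝[>] (0 : ℝ), ∀ x ∈ Icc (a ε) (b ε), |F ε x| ≤ C)
    (hF : ∀ x ∈ Ioo a₀ b₀, Tendsto (fun ε => F ε x) (𝓝[>] 0) (𝓝 (F₀ x))) :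
    Tendsto (fun ε => ∫ x in a ε..b ε, F ε x) (𝓝[>] 0) (𝓝 (∫ x in a₀..b₀, F₀ x)) := by
  have hC : ∀ᶠ ε in 𝓝[>] (0 : ℝ), 0 ≤ C := by
    filter_upwards [ha, hb] with ε h1 h2
    exact (abs_nonneg _).trans (h2 _ ⟨le_rfl, h1.2.1⟩)
  have e : ∀ᶠ ε in 𝓝[>] (0 : ℝ), (∫ x in a₀..b₀, (Icc (a ε) (b ε)).indicator (F ε) x)
      = ∫ x in a ε..b ε, F ε x := by
    filter_upwards [ha] with ε h
    rw [intervalIntegral.integral_of_le h₀, intervalIntegral.integral_of_le h.2.1,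
      ← integral_Icc_eq_integral_Ioc, ← integral_Icc_eq_integral_Ioc,
      setIntegral_indicator measurableSet_Icc, inter_eq_right.2 (Icc_subset_Icc h.1 h.2.2)]
  refine Tendsto.congr' e ?_
  refine intervalIntegral.tendsto_integral_filter_of_dominated_convergence (fun _ => C) ?_ ?_
    (by simp) ?_
  · filter_upwards [hc] with ε h
    refine AEStronglyMeasurable.restrict ?_
    rw [aestronglyMeasurable_indicator_iff measurableSet_Icc]
    exact h.aestronglyMeasurable measurableSet_Icc
  · filter_upwards [hb, hC] with ε h h'
    refine .of_forall fun x _ => ?_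
    rw [Real.norm_eq_abs]
    by_cases hx : x ∈ Icc (a ε) (b ε)
    · rw [indicator_of_mem hx]; exact h x hx
    · rw [indicator_of_notMem hx, abs_zero]; exact h'
  · filter_upwards [Measure.ae_ne volume b₀] with x hx hmem
    rw [uIoc_of_le h₀] at hmem
    have hx' : x ∈ Ioo a₀ b₀ := ⟨hmem.1, lt_of_le_of_ne hmem.2 hx⟩
    refine (hF x hx').congr' ?_
    filter_upwards [hta.eventually (gt_mem_nhds hx'.1), htb.eventually (lt_mem_nhds hx'.2)]
      with ε h1 h2
    rw [indicator_of_mem (show x ∈ Icc (a ε) (b ε) from ⟨le_of_lt h1, le_of_lt h2⟩)]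

/-- The evolution of the sine moments of a solution. -/
theorem IsSolution.sine_moment (hD : 0 < D₀) (hL : 0 < L) (hθ : IsSolution D₀ K₀ L θ₀ f g θ)
    {k : ℝ} (hk : k = K₀ / (2 * D₀)) (n : ℤ) {l : ℝ} (hl : l = n * Real.pi / L) {t : ℝ}
    (ht : 0 < t) :
    ∫ x in 0..L, θ x t * (Real.exp (-(k * x)) * Real.sin (l * x))
      = Real.exp (-(D₀ * (l ^ 2 + k ^ 2) * t))
          * (∫ x in 0..L, θ₀ x * (Real.exp (-(k * x)) * Real.sin (l * x)))
        + D₀ * l * ((∫ τ in 0..t, Real.exp (-(D₀ * (l ^ 2 + k ^ 2) * (t - τ))) * f τ)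
          - Real.cos (l * L) * Real.exp (-(k * L))
            * ∫ τ in 0..t, Real.exp (-(D₀ * (l ^ 2 + k ^ 2) * (t - τ))) * g τ) := by
  -- The bound holds on an open time interval, and the time `t` itself must be covered.
  obtain ⟨C, hC⟩ := hθ.bounded (t + 1) (by linarith)
  set κ : ℝ := D₀ * (l ^ 2 + k ^ 2) with hκ
  -- With this frequency `sin(lε(x - ε))` vanishes at both `ε` and `L - ε`, so no value of `θ_x`
  -- enters the boundary terms. Starting at time `ε` likewise avoids the corners.
  set lε : ℝ → ℝ := fun ε => n * Real.pi / (L - 2 * ε) with hlε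
  set κε : ℝ → ℝ := fun ε => D₀ * (lε ε ^ 2 + k ^ 2) with hκε
  have hsmall : ∀ᶠ ε in 𝓝[>] (0 : ℝ), 0 < ε ∧ ε < L / 4 ∧ ε < t := by
    filter_upwards [self_mem_nhdsWithin, nhdsWithin_le_nhds (gt_mem_nhds (by positivity : 0 < L / 4)),
      nhdsWithin_le_nhds (gt_mem_nhds ht)] with ε h1 h2 h3
    exact ⟨h1, h2, h3⟩
  have hlim : Tendsto lε (𝓝[>] 0) (𝓝 l) := by
    have : ContinuousAt lε 0 := by
      refine ContinuousAt.div (by fun_prop) (by fun_prop) (by simpa using hL.ne')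
    have h := this.tendsto.mono_left (nhdsWithin_le_nhds (s := Ioi 0))
    simpa [hlε, hl] using h
  have hid : Tendsto (fun ε : ℝ => ε) (𝓝[>] 0) (𝓝 0) := tendsto_id.mono_left nhdsWithin_le_nhds
  have hLε : Tendsto (fun ε : ℝ => L - ε) (𝓝[>] 0) (𝓝 L) := by simpa using hid.const_sub L
  have hκlim : Tendsto κε (𝓝[>] 0) (𝓝 κ) := ((hlim.pow 2).add_const _).const_mul _
  have hC0 : 0 ≤ C := (abs_nonneg _).trans
    (hC (L / 2) ⟨by linarith, by linarith⟩ t ⟨ht, by linarith⟩)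
  have hexp {x : ℝ} (hx : x ∈ Ioo 0 L) : Real.exp (-(k * x)) ≤ Real.exp (|k| * L) := by
    rw [Real.exp_le_exp]
    nlinarith [neg_abs_le k, abs_nonneg k, hx.1, hx.2, mul_le_mul_of_nonneg_left hx.2.le (abs_nonneg k)]
  have hθc (τ : ℝ) (hτ : 0 < τ) : ContinuousOn (fun x => θ x τ) (Ioo 0 L) :=
    hθ.continuous.comp (f := fun x => (x, τ)) (by fun_prop) fun x hx => ⟨hx, hτ⟩
  have hθc' (x : ℝ) (hx : x ∈ Ioo 0 L) : ContinuousOn (fun τ => θ x τ) (Ioi 0) :=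
    hθ.continuous.comp (f := fun τ => (x, τ)) (by fun_prop) fun τ hτ => ⟨hx, hτ⟩
  have hsubε {ε x : ℝ} (hε : 0 < ε) (hx : x ∈ Icc ε (L - ε)) : x ∈ Ioo 0 L :=
    ⟨hε.trans_le hx.1, hx.2.trans_lt (by linarith)⟩
  have hsinlim (x : ℝ) : Tendsto (fun ε => Real.exp (-(k * x)) * Real.sin (lε ε * (x - ε)))
      (𝓝[>] 0) (𝓝 (Real.exp (-(k * x)) * Real.sin (l * x))) := by
    have h := ((Real.continuous_sin.tendsto _).comp (hlim.mul (hid.const_sub x))).const_mul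
      (Real.exp (-(k * x)))
    simpa [Function.comp_def] using h
  have hspace : ∀ᶠ ε in 𝓝[>] (0 : ℝ), 0 ≤ ε ∧ ε ≤ L - ε ∧ L - ε ≤ L := by
    filter_upwards [hsmall] with ε h
    exact ⟨h.1.le, by linarith, by linarith⟩
  have htime : ∀ᶠ ε in 𝓝[>] (0 : ℝ), 0 ≤ ε ∧ ε ≤ t ∧ t ≤ t := by
    filter_upwards [hsmall] with ε h
    exact ⟨h.1.le, h.2.2.le, le_rfl⟩
  have hspace_bound {x w τ : ℝ} (hx : x ∈ Ioo 0 L) (hτ : τ ∈ Ioo 0 (t + 1)) :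
      |θ x τ * (Real.exp (-(k * x)) * Real.sin w)| ≤ C * (Real.exp (|k| * L) * 1) := by
    rw [abs_mul, abs_mul, Real.abs_exp]
    have h1 := hC x hx τ hτ
    have h2 := hexp hx
    have h3 := Real.abs_sin_le_one w
    gcongr
  have G1 : Tendsto (fun ε => ∫ x in ε..(L - ε),
      θ x t * (Real.exp (-(k * x)) * Real.sin (lε ε * (x - ε)))) (𝓝[>] 0)
      (𝓝 (∫ x in 0..L, θ x t * (Real.exp (-(k * x)) * Real.sin (l * x)))) := by
    refine tendsto_integral_of_shrinking (C := C * (Real.exp (|k| * L) * 1)) hL.le hspace hid hLε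
      ?_ ?_ fun x _ => (hsinlim x).const_mul _
    · filter_upwards [hsmall] with ε h
      exact ((hθc t ht).mono fun x hx => hsubε h.1 hx).mul (by fun_prop)
    · filter_upwards [hsmall] with ε h x hx
      exact hspace_bound (hsubε h.1 hx) ⟨ht, by linarith⟩
  have G2 : Tendsto (fun ε => ∫ x in ε..(L - ε),
      θ x ε * (Real.exp (-(k * x)) * Real.sin (lε ε * (x - ε)))) (𝓝[>] 0)
      (𝓝 (∫ x in 0..L, θ₀ x * (Real.exp (-(k * x)) * Real.sin (l * x)))) := by
    refine tendsto_integral_of_shrinking (C := C * (Real.exp (|k| * L) * 1)) hL.le hspace hid hLε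
      ?_ ?_ fun x hx => (hθ.initial x hx).mul (hsinlim x)
    · filter_upwards [hsmall] with ε h
      exact ((hθc ε h.1).mono fun x hx => hsubε h.1 hx).mul (by fun_prop)
    · filter_upwards [hsmall] with ε h x hx
      exact hspace_bound (hsubε h.1 hx) ⟨h.1, by linarith⟩
  have hexplim (τ : ℝ) : Tendsto (fun ε => Real.exp (κε ε * τ)) (𝓝[>] 0) (𝓝 (Real.exp (κ * τ))) :=
    (Real.continuous_exp.tendsto _).comp (hκlim.mul_const τ)
  have hκ1 : ∀ᶠ ε in 𝓝[>] (0 : ℝ), κε ε ≤ κ + 1 :=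
    hκlim.eventually (Iic_mem_nhds (by linarith))
  have hl1 : ∀ᶠ ε in 𝓝[>] (0 : ℝ), |lε ε| ≤ |l| + 1 :=
    hlim.abs.eventually (Iic_mem_nhds (by linarith))
  have hκ0 : 0 ≤ κ := by positivity
  have hboundary {ε x τ w : ℝ} (h : 0 < ε) (hε : κε ε ≤ κ + 1) (hε' : |lε ε| ≤ |l| + 1)
      (hw : |w| ≤ 1) (hx : x ∈ Ioo 0 L) (hτ : τ ∈ Icc ε t) :
      |D₀ * (Real.exp (κε ε * τ) * (Real.exp (-(k * x)) * lε ε * w * θ x τ))|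
        ≤ D₀ * (Real.exp ((κ + 1) * t) * (Real.exp (|k| * L) * (|l| + 1) * 1 * C)) := by
    have hτ0 : 0 < τ := h.trans_le hτ.1
    have h1 := hC x hx τ ⟨hτ0, by linarith [hτ.2]⟩
    have h2 := hexp hx
    have h3 : Real.exp (κε ε * τ) ≤ Real.exp ((κ + 1) * t) := by
      rw [Real.exp_le_exp]
      exact mul_le_mul hε hτ.2 hτ0.le (by linarith)
    simp only [abs_mul, Real.abs_exp, abs_of_pos hD]
    gcongr
  have G3 : Tendsto (fun ε => ∫ τ in ε..t, D₀ * (Real.exp (κε ε * τ)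
      * (Real.exp (-(k * ε)) * lε ε * θ ε τ))) (𝓝[>] 0)
      (𝓝 (∫ τ in 0..t, D₀ * (Real.exp (κ * τ) * (1 * l * f τ)))) := by
    refine tendsto_integral_of_shrinking (b := fun _ => t)
      (C := D₀ * (Real.exp ((κ + 1) * t) * (Real.exp (|k| * L) * (|l| + 1) * 1 * C)))
      ht.le htime hid tendsto_const_nhds ?_ ?_ fun τ hτ => ?_
    · filter_upwards [hsmall] with ε h
      have := (hθc' ε ⟨h.1, by linarith⟩).mono fun τ (hτ : τ ∈ Icc ε t) => h.1.trans_le hτ.1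
      fun_prop
    · filter_upwards [hsmall, hκ1, hl1] with ε h h1 h2 τ hτ
      have := hboundary (x := ε) (w := 1) h.1 h1 h2 (by simp) ⟨h.1, by linarith⟩ hτ
      rwa [mul_one (Real.exp (-(k * ε)) * lε ε)] at this
    · refine ((hexplim τ).mul ((Tendsto.mul ?_ hlim).mul (hθ.left τ hτ.1))).const_mul _
      have := (Real.continuous_exp.tendsto _).comp ((hid.const_mul k).neg)
      simpa [Function.comp_def] using this
  have G4 : Tendsto (fun ε => ∫ τ in ε..t, D₀ * (Real.exp (κε ε * τ)
      * (Real.exp (-(k * (L - ε))) * lε ε * Real.cos (lε ε * (L - ε - ε)) * θ (L - ε) τ))) (𝓝[>] 0)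
      (𝓝 (∫ τ in 0..t, D₀ * (Real.exp (κ * τ)
        * (Real.exp (-(k * L)) * l * Real.cos (l * L) * g τ)))) := by
    refine tendsto_integral_of_shrinking (b := fun _ => t)
      (C := D₀ * (Real.exp ((κ + 1) * t) * (Real.exp (|k| * L) * (|l| + 1) * 1 * C)))
      ht.le htime hid tendsto_const_nhds ?_ ?_ fun τ hτ => ?_
    · filter_upwards [hsmall] with ε h
      have := (hθc' (L - ε) ⟨by linarith, by linarith⟩).mono
        fun τ (hτ : τ ∈ Icc ε t) => h.1.trans_le hτ.1
      fun_prop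
    · filter_upwards [hsmall, hκ1, hl1] with ε h h1 h2 τ hτ
      exact hboundary h.1 h1 h2 (Real.abs_cos_le_one _) ⟨by linarith, by linarith⟩ hτ
    · have hr : Tendsto (fun ε : ℝ => L - ε) (𝓝[>] 0) (𝓝[<] L) := by
        refine tendsto_nhdsWithin_iff.2 ⟨hLε, ?_⟩
        filter_upwards [self_mem_nhdsWithin] with ε (hε : 0 < ε)
        exact sub_lt_self L hε
      refine ((hexplim τ).mul (((Tendsto.mul ?_ hlim).mul ?_).mul
        ((hθ.right τ hτ.1).comp hr))).const_mul _
      · exact (Real.continuous_exp.tendsto _).comp ((hLε.const_mul k).neg)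
      · have h := (Real.continuous_cos.tendsto _).comp (hlim.mul (hLε.sub hid))
        simpa [Function.comp_def] using h
  have hgreen : ∀ᶠ ε in 𝓝[>] (0 : ℝ),
      Real.exp (κε ε * t) * (∫ x in ε..(L - ε),
          θ x t * (Real.exp (-(k * x)) * Real.sin (lε ε * (x - ε))))
        - Real.exp (κε ε * ε) * (∫ x in ε..(L - ε),
          θ x ε * (Real.exp (-(k * x)) * Real.sin (lε ε * (x - ε))))
      = (∫ τ in ε..t, D₀ * (Real.exp (κε ε * τ) * (Real.exp (-(k * ε)) * lε ε * θ ε τ)))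
        - ∫ τ in ε..t, D₀ * (Real.exp (κε ε * τ)
          * (Real.exp (-(k * (L - ε))) * lε ε * Real.cos (lε ε * (L - ε - ε)) * θ (L - ε) τ)) := by
    filter_upwards [hsmall] with ε h
    refine hθ.green_rectangle hD hk rfl h.1 (by linarith) (by linarith) h.1 h.2.2.le ?_
    have hne : L - 2 * ε ≠ 0 := by linarith
    rw [show lε ε * (L - ε - ε) = n * Real.pi by simp only [hlε]; field_simp; ring]
    exact Real.sin_int_mul_pi n
  have hκε0 : Tendsto (fun ε => Real.exp (κε ε * ε)) (𝓝[>] 0) (𝓝 1) := by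
    have := (Real.continuous_exp.tendsto _).comp (hκlim.mul hid)
    simpa [Function.comp_def] using this
  have key := tendsto_nhds_unique ((((hexplim t).mul G1).sub (hκε0.mul G2)).congr' hgreen)
    (G3.sub G4)
  have hsplit (h : ℝ → ℝ) : ∫ τ in 0..t, Real.exp (-(κ * (t - τ))) * h τ
      = Real.exp (-(κ * t)) * ∫ τ in 0..t, Real.exp (κ * τ) * h τ := by
    rw [← intervalIntegral.integral_const_mul]
    refine intervalIntegral.integral_congr fun τ _ => ?_
    rw [← mul_assoc, ← Real.exp_add]
    congr 2; ring
  have e3 : ∫ τ in 0..t, D₀ * (Real.exp (κ * τ) * (1 * l * f τ))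
      = D₀ * l * ∫ τ in 0..t, Real.exp (κ * τ) * f τ := by
    rw [← intervalIntegral.integral_const_mul]
    exact intervalIntegral.integral_congr fun τ _ => by ring
  have e4 : ∫ τ in 0..t, D₀ * (Real.exp (κ * τ) * (Real.exp (-(k * L)) * l * Real.cos (l * L) * g τ))
      = D₀ * l * (Real.cos (l * L) * Real.exp (-(k * L))) * ∫ τ in 0..t, Real.exp (κ * τ) * g τ := by
    rw [← intervalIntegral.integral_const_mul]
    exact intervalIntegral.integral_congr fun τ _ => by ring
  rw [e3, e4] at key
  rw [hsplit, hsplit]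
  have hone : Real.exp (-(κ * t)) * Real.exp (κ * t) = 1 := by
    rw [← Real.exp_add, neg_add_cancel, Real.exp_zero]
  linear_combination Real.exp (-(κ * t)) * key
    - (∫ x in 0..L, θ x t * (Real.exp (-(k * x)) * Real.sin (l * x))) * hone

end

end AdvectionDiffusion

namespace AdvectionDiffusion

noncomputable section

/-! ### Completeness of the sines -/

/-- A continuous function on `[0, L]` that vanishes at both ends and whose sine coefficients all
vanish is zero. -/
theorem eq_zero_of_sine_coefficients {L : ℝ} (hL : 0 < L) {d : ℝ → ℂ}
    (hd : ContinuousOn d (Icc 0 L)) (h0 : d 0 = 0) (h1 : d L = 0)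
    (hcoef : ∀ n : ℤ, ∫ x in 0..L, (Real.sin (n * Real.pi / L * x) : ℂ) * d x = 0)
    {x : ℝ} (hx : x ∈ Icc 0 L) : d x = 0 := by
  have : Fact (0 < 2 * L) := ⟨by linarith⟩
  set e : ℝ → ℂ := IccExtend hL.le ((Icc 0 L).domRestrict d) with he
  have hec : Continuous e := (continuousOn_iff_continuous_domRestrict.1 hd).Icc_extend'
  have heq {y : ℝ} (hy : y ∈ Icc 0 L) : e y = d y := by
    rw [he, IccExtend_of_mem _ _ hy]; rfl
  have hneg {y : ℝ} (hy : y ≤ 0) : e y = 0 := by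
    rw [he, IccExtend_of_le_left _ _ hy]; exact h0
  -- Since `e` vanishes on the negative half line, this is the odd extension of `d` to `[-L, L]`.
  -- Its Fourier coefficients reduce to the sine coefficients of `d`.
  set D : ℝ → ℂ := fun y => e y - e (-y) with hDdef
  have hDc : Continuous D := by fun_prop
  have hD {y : ℝ} (hy : y ∈ Icc 0 L) : D y = d y := by
    simp only [hDdef]
    rw [heq hy, hneg (neg_nonpos.2 hy.1), sub_zero]
  have hDodd (y : ℝ) : D (-y) = -D y := by simp [hDdef]
  have hend : D (-L) = D (-L + 2 * L) := by
    rw [show -L + 2 * L = L by ring, hDodd, hD ⟨hL.le, le_rfl⟩, h1, neg_zero]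
  set F : C(AddCircle (2 * L), ℂ) :=
    ⟨AddCircle.liftIco (2 * L) (-L) D, AddCircle.liftIco_continuous hend hDc.continuousOn⟩ with hF
  have hcoefF (n : ℤ) : fourierCoeff F n = 0 := by
    have h2 : fourierCoeff F n = fourierCoeffOn (by linarith : -L < -L + 2 * L) D n :=
      fourierCoeff_liftIco_eq D n
    rw [h2, fourierCoeffOn_eq_integral]
    have hE (y : ℝ) : fourier (-n) (y : AddCircle (-L + 2 * L - -L))
        = Complex.exp (-((n * Real.pi / L * y : ℝ) : ℂ) * Complex.I) := by
      rw [fourier_coe_apply]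
      congr 1
      have : (L : ℂ) ≠ 0 := by exact_mod_cast hL.ne'
      push_cast
      field_simp
      ring
    have hzero : ∫ y in (-L)..(-L + 2 * L), fourier (-n) (y : AddCircle (-L + 2 * L - -L)) • D y
        = 0 := by
      simp_rw [hE, smul_eq_mul]
      set H : ℝ → ℂ := fun y => Complex.exp (-((n * Real.pi / L * y : ℝ) : ℂ) * Complex.I) * D y
        with hH
      have hHc : Continuous H := by fun_prop
      rw [show -L + 2 * L = L by ring, ← intervalIntegral.integral_add_adjacent_intervals
        (hHc.intervalIntegrable (-L) 0) (hHc.intervalIntegrable 0 L)]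
      have h3 := intervalIntegral.integral_comp_neg (a := 0) (b := L) H
      rw [neg_zero] at h3
      rw [← h3, ← intervalIntegral.integral_add
        ((by fun_prop : Continuous fun y => H (-y)).intervalIntegrable _ _)
        (hHc.intervalIntegrable 0 L)]
      have h4 : ∫ y in 0..L, (H (-y) + H y)
          = ∫ y in 0..L, (-2 * Complex.I) * ((Real.sin (n * Real.pi / L * y) : ℂ) * d y) := by
        refine intervalIntegral.integral_congr fun y hy => ?_
        rw [uIcc_of_le hL.le] at hy
        simp only [hH, hDodd, hD hy]
        rw [Complex.ofReal_sin, Complex.sin, show ((n * Real.pi / L * -y : ℝ) : ℂ)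
          = -((n * Real.pi / L * y : ℝ) : ℂ) by push_cast; ring, neg_neg]
        linear_combination (d y * (Complex.exp (-((n * Real.pi / L * y : ℝ) : ℂ) * Complex.I)
          - Complex.exp (((n * Real.pi / L * y : ℝ) : ℂ) * Complex.I))) * Complex.I_sq
      rw [h4, intervalIntegral.integral_const_mul, hcoef, mul_zero]
    rw [hzero, smul_zero]
  -- Vanishing coefficients are summable, so the Fourier series of the continuous function `F`
  -- converges to it pointwise; its sum is `0`.
  have hsum : Summable (fourierCoeff F) := by
    rw [show fourierCoeff F = fun _ => 0 from funext hcoefF]; exact summable_zero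
  rcases eq_or_lt_of_le hx.2 with rfl | hxL
  · exact h1
  have h5 := has_pointwise_sum_fourier_series_of_summable hsum (x : AddCircle (2 * L))
  simp_rw [hcoefF, zero_smul] at h5
  have hx' : x ∈ Ico (-L) (-L + 2 * L) := ⟨by linarith [hx.1], by linarith⟩
  have h6 : F (x : AddCircle (2 * L)) = D x := by
    change AddCircle.liftIco (2 * L) (-L) D (x : AddCircle (2 * L)) = D x
    exact AddCircle.liftIco_coe_apply hx'
  rw [← hD hx, ← h6]
  exact h5.unique hasSum_zero

end

end AdvectionDiffusion

namespace AdvectionDiffusion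

noncomputable section

/-! ### The reduced representation equals the solution -/

/-- Frequencies of the expansion of `sin⁴ (πx/L) sin (nπx/L)`. -/
def testFrequency (n : ℤ) : Fin 5 → ℤ := ![n, n + 2, n - 2, n + 4, n - 4]

/-- Coefficients of the expansion of `sin⁴ (πx/L) sin (nπx/L)`. -/
def testCoefficient : Fin 5 → ℝ := ![3 / 8, -1 / 4, -1 / 4, 1 / 16, 1 / 16]

/-- Three powers of `sin(πx/L)` compensate the cubic blow-up at the ends and the fourth forces the
weighted difference to vanish there. The product stays a finite sum of sines, whose moments are
known on both sides. -/
theorem sin_pow_four_mul_sin (α β : ℝ) : Real.sin α ^ 4 * Real.sin β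
    = 3 / 8 * Real.sin β - 1 / 4 * Real.sin (β + 2 * α) - 1 / 4 * Real.sin (β - 2 * α)
      + 1 / 16 * Real.sin (β + 4 * α) + 1 / 16 * Real.sin (β - 4 * α) := by
  have h4 : (4 : ℝ) * α = 2 * (2 * α) := by ring
  rw [Real.sin_add, Real.sin_sub, Real.sin_add, Real.sin_sub, h4, Real.cos_two_mul (2 * α),
    Real.cos_two_mul]
  have h := Real.cos_sq' α
  rw [h]
  ring

theorem sinePoly_test (n : ℤ) (L x : ℝ) :
    sinePoly testCoefficient (fun i => testFrequency n i * Real.pi / L) x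
      = Real.sin (Real.pi / L * x) ^ 4 * Real.sin (n * Real.pi / L * x) := by
  rw [sin_pow_four_mul_sin, sinePoly, Fin.sum_univ_five]
  simp only [testCoefficient, testFrequency, Fin.isValue, Matrix.cons_val]
  push_cast
  rw [show (n + 2 : ℝ) * Real.pi / L * x = n * Real.pi / L * x + 2 * (Real.pi / L * x) by ring,
    show (n - 2 : ℝ) * Real.pi / L * x = n * Real.pi / L * x - 2 * (Real.pi / L * x) by ring,
    show (n + 4 : ℝ) * Real.pi / L * x = n * Real.pi / L * x + 4 * (Real.pi / L * x) by ring,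
    show (n - 4 : ℝ) * Real.pi / L * x = n * Real.pi / L * x - 4 * (Real.pi / L * x) by ring]
  ring

theorem sin_mul_length {L : ℝ} (hL : 0 < L) (n : ℤ) : Real.sin (n * Real.pi / L * L) = 0 := by
  rw [div_mul_cancel₀ _ hL.ne']; exact Real.sin_int_mul_pi n

theorem abs_sin_pow_le {L : ℝ} (hL : 0 < L) (x : ℝ) (w : ℝ) :
    |Real.sin (Real.pi / L * x) ^ 4 * Real.sin w| ≤ (Real.pi / L) ^ 3 * |x| ^ 3 := by
  have h1 : |Real.sin (Real.pi / L * x)| ≤ Real.pi / L * |x| := by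
    refine Real.abs_sin_le_abs.trans_eq ?_
    rw [abs_mul, abs_of_pos (by positivity)]
  rw [abs_mul, abs_pow, pow_succ, ← mul_pow]
  have h2 := Real.abs_sin_le_one (Real.pi / L * x)
  have h3 := Real.abs_sin_le_one w
  calc _ ≤ (Real.pi / L * |x|) ^ 3 * 1 * 1 := by gcongr
    _ = _ := by ring

theorem isTest_test {L : ℝ} (hL : 0 < L) (n : ℤ) : IsTest L (1 + (Real.pi / L) ^ 3)
    (sinePoly testCoefficient fun i => testFrequency n i * Real.pi / L) where
  cont := by unfold sinePoly; fun_prop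
  odd x := by simp only [sinePoly_test, mul_neg, Real.sin_neg]; ring
  periodic x := by
    simp only [sinePoly_test]
    have e1 : Real.pi / L * (x + 2 * L) = Real.pi / L * x + 2 * Real.pi := by field_simp
    have e2 : n * Real.pi / L * (x + 2 * L) = n * Real.pi / L * x + n * (2 * Real.pi) := by
      field_simp
    rw [e1, e2, Real.sin_add_two_pi, Real.sin_add_int_mul_two_pi]
  bound x := by
    rw [sinePoly_test]
    refine (abs_sin_pow_le hL x _).trans ?_
    gcongr
    linarith
  bound' x := by
    rw [sinePoly_test, abs_mul, abs_pow]
    have h1 := Real.abs_sin_le_one (Real.pi / L * x)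
    have h2 := Real.abs_sin_le_one (n * Real.pi / L * x)
    calc _ ≤ (1 : ℝ) ^ 4 * 1 := by gcongr
      _ ≤ _ := by have : 0 ≤ (Real.pi / L) ^ 3 := by positivity
                  linarith

theorem isTest_test_reflect {L : ℝ} (hL : 0 < L) (n : ℤ) : IsTest L (1 + (Real.pi / L) ^ 3)
    fun x => sinePoly testCoefficient (fun i => testFrequency n i * Real.pi / L) (L - x) := by
  have h := isTest_test hL n
  have hshift (x : ℝ) := h.reflect 0 x
  refine ⟨h.cont.comp (by fun_prop), fun x => ?_, fun x => ?_, fun x => ?_, fun x => h.bound' _⟩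
  · have := hshift (L - x)
    rw [← this]; congr 1; push_cast; ring
  · have := h.periodic (L - (x + 2 * L))
    rw [← this]; congr 1; ring
  · rw [sinePoly_test]
    have e : Real.sin (Real.pi / L * (L - x)) = Real.sin (Real.pi / L * x) := by
      rw [mul_sub, div_mul_cancel₀ _ hL.ne', Real.sin_pi_sub]
    rw [e]
    refine (abs_sin_pow_le hL x _).trans ?_
    gcongr
    linarith

/-! ### Continuity and boundary growth of the reduced representation, and its identification with
the solution -/

variable {D k L C : ℝ} {ρ F G : ℝ → ℝ}

theorem continuousOn_reducedRepresentation (hD : 0 < D) (k : ℝ) (hL : 0 < L)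
    (hρm : Measurable ρ) (hρ : ∀ y, |ρ y| ≤ C) (hFm : Measurable F)
    (hF : ∀ y, |F y| ≤ C) (hGm : Measurable G) (hG : ∀ y, |G y| ≤ C) {t : ℝ} (ht : 0 < t) :
    ContinuousOn (reducedRepresentation D k L ρ F G t) (Ioo 0 L) := by
  have hρ' : Measurable fun y => ρ (L - y) := hρm.comp (by fun_prop)
  have c1 := continuousOn_ratioIntegral (k := k)
    (linearGrowth_initial k (D * t) hρ' (fun y => hρ _) hL.le) hL
  have c2 := continuousOn_ratioIntegral (k := k) (linearGrowth_initial k (D * t) hρm hρ hL.le) hL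
  have c3 := continuousOn_ratioIntegral (k := k) (linearGrowth_boundary D k hFm hF ht.le) hL
  have c4 := continuousOn_ratioIntegral (k := k) (linearGrowth_boundary D k hGm hG ht.le) hL
  have c0 := continuous_integral_heatKernel (mul_pos hD ht) hρm hρ L
  have hm : MapsTo (fun x => L - x) (Ioo 0 L) (Ioo 0 L) := fun x hx =>
    ⟨by linarith [hx.2], by linarith [hx.1]⟩
  have c2' := c2.comp (by fun_prop) hm
  have c3' := c3.comp (by fun_prop) hm
  unfold reducedRepresentation
  exact (continuousOn_const.mul (ContinuousOn.sub
    (Complex.continuous_ofReal.comp c0).continuousOn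
    (continuousOn_const.mul (c1.add c2')))).sub
    (continuousOn_const.mul (c3'.add (continuousOn_const.mul c4)))

/-- The contour terms with quotient argument `L - x` grow like `x⁻³`, those with argument `x` like
`(L - x)⁻³`; the heat-kernel term is continuous on `[0, L]`. -/
theorem exists_bound_reducedRepresentation (hD : 0 < D) (k : ℝ) (hL : 0 < L)
    (hρm : Measurable ρ) (hρ : ∀ y, |ρ y| ≤ C) (hFm : Measurable F)
    (hF : ∀ y, |F y| ≤ C) (hGm : Measurable G) (hG : ∀ y, |G y| ≤ C) {t : ℝ} (ht : 0 < t) :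
    ∃ K : ℝ, ∀ x ∈ Ioo 0 L,
      ‖reducedRepresentation D k L ρ F G t x‖ ≤ K * (1 + 1 / x ^ 3 + 1 / (L - x) ^ 3) := by
  have hρ' : Measurable fun y => ρ (L - y) := hρm.comp (by fun_prop)
  have aux {A : ℝ → ℂ} {C' : ℝ} (hA : LinearGrowth A C') : ∃ K : ℝ, 0 ≤ K ∧ ∀ x ∈ Ioo 0 L,
      ‖ratioIntegral k L A x‖ ≤ K * (1 + 1 / x ^ 3 + 1 / (L - x) ^ 3) ∧
      ‖ratioIntegral k L A (L - x)‖ ≤ K * (1 + 1 / x ^ 3 + 1 / (L - x) ^ 3) := by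
    have hK := majorantConst_nonneg hA.nonneg hL
    refine ⟨majorantConst C' L, hK, fun x hx => ?_⟩
    have hx0 : 0 < x := hx.1
    have hx1 : 0 < L - x := sub_pos.2 hx.2
    have p1 : 0 < 1 / x ^ 3 := by positivity
    have p2 : 0 < 1 / (L - x) ^ 3 := by positivity
    constructor
    · refine (norm_ratioIntegral_le hA hL hx0.le hx.2).trans ?_
      rw [div_eq_mul_one_div]
      gcongr
      linarith
    · refine (norm_ratioIntegral_le hA hL hx1.le (by linarith)).trans ?_
      rw [sub_sub_cancel, div_eq_mul_one_div]
      gcongr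
      linarith
  obtain ⟨K1, hK1, b1⟩ := aux (linearGrowth_initial k (D * t) hρ' (fun y => hρ _) hL.le)
  obtain ⟨K2, hK2, b2⟩ := aux (linearGrowth_initial k (D * t) hρm hρ hL.le)
  obtain ⟨K3, hK3, b3⟩ := aux (linearGrowth_boundary D k hFm hF ht.le)
  obtain ⟨K4, hK4, b4⟩ := aux (linearGrowth_boundary D k hGm hG ht.le)
  obtain ⟨K0, hK0⟩ := (isCompact_Icc (a := (0 : ℝ)) (b := L)).exists_bound_of_continuousOn
    (continuous_integral_heatKernel (mul_pos hD ht) hρm hρ L).continuousOn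
  have hK0' : 0 ≤ K0 := (norm_nonneg _).trans (hK0 0 ⟨le_rfl, hL.le⟩)
  refine ⟨‖(Real.exp (-(D * t * k ^ 2)) : ℂ)‖ * (K0 + ‖(1 / (2 * Real.pi) : ℂ)‖ * (K1 + K2))
    + ‖(Complex.I * D / Real.pi : ℂ)‖ * (K3 + ‖(Real.exp (-(k * L)) : ℂ)‖ * K4), fun x hx => ?_⟩
  have hx0 : 0 < x := hx.1
  have hx1 : 0 < L - x := sub_pos.2 hx.2
  set P := 1 + 1 / x ^ 3 + 1 / (L - x) ^ 3 with hP
  have hP1 : 1 ≤ P := by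
    have p1 : 0 < 1 / x ^ 3 := by positivity
    have p2 : 0 < 1 / (L - x) ^ 3 := by positivity
    linarith
  have h0 := hK0 x ⟨hx.1.le, hx.2.le⟩
  have h0' : ‖((∫ y in 0..L, ρ y * heatKernel (D * t) (x - y) : ℝ) : ℂ)‖ ≤ K0 * P := by
    rw [Complex.norm_real]
    exact h0.trans (le_mul_of_one_le_right hK0' hP1)
  have h1 := (b1 x hx).1
  have h2 := (b2 x hx).2
  have h3 := (b3 x hx).2
  have h4 := (b4 x hx).1
  unfold reducedRepresentation
  calc _ ≤ ‖(Real.exp (-(D * t * k ^ 2)) : ℂ)‖ * (K0 * P + ‖(1 / (2 * Real.pi) : ℂ)‖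
          * (K1 * P + K2 * P))
        + ‖(Complex.I * D / Real.pi : ℂ)‖ * (K3 * P + ‖(Real.exp (-(k * L)) : ℂ)‖ * (K4 * P)) := by
        refine (norm_sub_le _ _).trans ?_
        rw [norm_mul, norm_mul (Complex.I * D / Real.pi)]
        gcongr
        · refine (norm_sub_le _ _).trans ?_
          rw [norm_mul]
          gcongr
          refine (norm_add_le _ _).trans ?_
          gcongr
        · refine (norm_add_le _ _).trans ?_
          rw [norm_mul]
          gcongr
    _ = _ := by ring

theorem abs_sin_pi_div_le {L : ℝ} (hL : 0 < L) {x : ℝ} (hx : x ∈ Ioo 0 L) :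
    |Real.sin (Real.pi / L * x)| ≤ Real.pi / L * x
      ∧ |Real.sin (Real.pi / L * x)| ≤ Real.pi / L * (L - x) := by
  have h (y : ℝ) (hy : 0 < y) : |Real.sin (Real.pi / L * y)| ≤ Real.pi / L * y := by
    refine Real.abs_sin_le_abs.trans_eq (abs_of_pos (by positivity))
  refine ⟨h x hx.1, ?_⟩
  have e : Real.sin (Real.pi / L * x) = Real.sin (Real.pi / L * (L - x)) := by
    rw [mul_sub, div_mul_cancel₀ _ hL.ne', Real.sin_pi_sub]
  rw [e]
  exact h _ (sub_pos.2 hx.2)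

theorem intervalIntegrable_of_continuousOn_Ioo {E : Type*} [NormedAddCommGroup E] {h : ℝ → E}
    {L B : ℝ} (hL : 0 ≤ L) (hc : ContinuousOn h (Ioo 0 L)) (hb : ∀ x ∈ Ioo 0 L, ‖h x‖ ≤ B) :
    IntervalIntegrable h volume 0 L := by
  rw [intervalIntegrable_iff_integrableOn_Ioo_of_le hL]
  exact Integrable.of_bound (hc.aestronglyMeasurable measurableSet_Ioo) B
    ((ae_restrict_mem measurableSet_Ioo).mono hb)

theorem intervalIntegral_congr_Ioo {E : Type*} [NormedAddCommGroup E] [NormedSpace ℝ E]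
    {h₁ h₂ : ℝ → E} {a b : ℝ} (hab : a ≤ b) (h : ∀ x ∈ Ioo a b, h₁ x = h₂ x) :
    ∫ x in a..b, h₁ x = ∫ x in a..b, h₂ x := by
  rw [intervalIntegral.integral_of_le hab, intervalIntegral.integral_of_le hab,
    integral_Ioc_eq_integral_Ioo, integral_Ioc_eq_integral_Ioo]
  exact setIntegral_congr_fun measurableSet_Ioo h

theorem IsSolution.reducedRepresentation_eq {D₀ K₀ L : ℝ} {θ₀ f g : ℝ → ℝ} {θ : ℝ → ℝ → ℝ}
    (hD : 0 < D₀) (hL : 0 < L) (hθ : IsSolution D₀ K₀ L θ₀ f g θ) {k : ℝ}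
    (hk : k = K₀ / (2 * D₀)) {ρ F G : ℝ → ℝ} {C : ℝ}
    (hρm : Measurable ρ) (hρ : ∀ y, |ρ y| ≤ C) (hFm : Measurable F)
    (hF : ∀ y, |F y| ≤ C) (hGm : Measurable G) (hG : ∀ y, |G y| ≤ C) {t : ℝ} (ht : 0 < t)
    (hρθ : ∀ y ∈ Ioo 0 L, ρ y = Real.exp (-(k * y)) * θ₀ y) (hFf : ∀ τ ∈ Ioc 0 t, F τ = f τ)
    (hGg : ∀ τ ∈ Ioc 0 t, G τ = g τ) {x : ℝ} (hx : x ∈ Ioo 0 L) :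
    reducedRepresentation D₀ k L ρ F G t x = ((Real.exp (-(k * x)) * θ x t : ℝ) : ℂ) := by
  set W := reducedRepresentation D₀ k L ρ F G t with hW
  set u : ℝ → ℝ := fun x => Real.exp (-(k * x)) * θ x t with hu
  have hWc := continuousOn_reducedRepresentation hD k hL hρm hρ hFm hF hGm hG ht
  obtain ⟨K, hK⟩ := exists_bound_reducedRepresentation hD k hL hρm hρ hFm hF hGm hG ht
  obtain ⟨C', hC'⟩ := hθ.bounded (t + 1) (by linarith)
  have hθc : ContinuousOn (fun x => θ x t) (Ioo 0 L) :=
    hθ.continuous.comp (f := fun x => (x, t)) (by fun_prop) fun x hx => ⟨hx, ht⟩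
  have huc : ContinuousOn u (Ioo 0 L) := by fun_prop
  have hexp {x : ℝ} (hx : x ∈ Ioo 0 L) : Real.exp (-(k * x)) ≤ Real.exp (|k| * L) := by
    rw [Real.exp_le_exp]
    nlinarith [neg_abs_le k, abs_nonneg k, hx.1, hx.2, mul_le_mul_of_nonneg_left hx.2.le (abs_nonneg k)]
  have hub : ∀ x ∈ Ioo 0 L, |u x| ≤ Real.exp (|k| * L) * C' := fun x hx => by
    have h1 := hC' x hx t ⟨ht, by linarith⟩
    have h2 := hexp hx
    rw [hu, abs_mul, Real.abs_exp]
    gcongr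
  set S : ℝ → ℝ := fun x => Real.sin (Real.pi / L * x) with hS
  have hKnn : 0 ≤ K := by
    have h := (norm_nonneg _).trans (hK (L / 2) ⟨by linarith, by linarith⟩)
    refine nonneg_of_mul_nonneg_left h ?_
    have : 0 < L - L / 2 := by linarith
    positivity
  have hSW {x : ℝ} (hx : x ∈ Ioo 0 L) : |S x| ^ 3 * ‖W x‖ ≤ K * (1 + 2 * (Real.pi / L) ^ 3) := by
    have hx0 : 0 < x := hx.1
    have hx1 : 0 < L - x := sub_pos.2 hx.2
    have h1 : |S x| ^ 3 ≤ 1 := pow_le_one₀ (abs_nonneg _) (Real.abs_sin_le_one _)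
    have h2 : |S x| ^ 3 * (1 / x ^ 3) ≤ (Real.pi / L) ^ 3 := by
      rw [mul_one_div, div_le_iff₀ (by positivity), ← mul_pow]
      exact pow_le_pow_left₀ (abs_nonneg _) (abs_sin_pi_div_le hL hx).1 3
    have h3 : |S x| ^ 3 * (1 / (L - x) ^ 3) ≤ (Real.pi / L) ^ 3 := by
      rw [mul_one_div, div_le_iff₀ (by positivity), ← mul_pow]
      exact pow_le_pow_left₀ (abs_nonneg _) (abs_sin_pi_div_le hL hx).2 3
    calc |S x| ^ 3 * ‖W x‖ ≤ |S x| ^ 3 * (K * (1 + 1 / x ^ 3 + 1 / (L - x) ^ 3)) := by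
          gcongr
          exact hK x hx
      _ = K * (|S x| ^ 3 + |S x| ^ 3 * (1 / x ^ 3) + |S x| ^ 3 * (1 / (L - x) ^ 3)) := by ring
      _ ≤ K * (1 + (Real.pi / L) ^ 3 + (Real.pi / L) ^ 3) := by gcongr
      _ = _ := by ring
  set d : ℝ → ℂ := (Ioo 0 L).indicator fun x => (S x : ℂ) ^ 4 * (W x - u x) with hd
  set K' := Real.exp (|k| * L) * C' + K * (1 + 2 * (Real.pi / L) ^ 3) with hK'
  have hd0 {x : ℝ} (hx : x ∉ Ioo 0 L) : d x = 0 := indicator_of_notMem hx _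
  -- Three of the four powers of `S` keep `S³W` bounded; the remaining one tends to `0` at the ends
  -- and gives continuity of `d` there.
  have hdb (x : ℝ) (hx : x ∈ Icc 0 L) : ‖d x‖ ≤ K' * |S x| := by
    by_cases hx' : x ∈ Ioo 0 L
    · have h1 : |S x| ^ 3 ≤ 1 := pow_le_one₀ (abs_nonneg _) (Real.abs_sin_le_one _)
      have h2 := hub x hx'
      have h3 := hSW hx'
      rw [hd, indicator_of_mem hx', norm_mul, norm_pow, Complex.norm_real, Real.norm_eq_abs]
      calc |S x| ^ 4 * ‖W x - u x‖ ≤ |S x| ^ 4 * (‖W x‖ + |u x|) := by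
            gcongr
            refine (norm_sub_le _ _).trans_eq ?_
            rw [Complex.norm_real, Real.norm_eq_abs]
        _ = (|S x| ^ 3 * ‖W x‖ + |S x| ^ 3 * |u x|) * |S x| := by ring
        _ ≤ (K * (1 + 2 * (Real.pi / L) ^ 3) + 1 * (Real.exp (|k| * L) * C')) * |S x| := by
            gcongr
        _ = _ := by rw [hK']; ring
    · rw [hd0 hx', norm_zero]
      have h2 := (abs_nonneg _).trans (hub (L / 2) ⟨by linarith, by linarith⟩)
      positivity
  have hdc : ContinuousOn d (Icc 0 L) := by
    intro y hy
    by_cases hy' : y ∈ Ioo 0 L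
    · have h1 : ContinuousOn (fun x => (S x : ℂ) ^ 4 * (W x - u x)) (Ioo 0 L) := by fun_prop
      have h2 : ContinuousAt d y := (h1.continuousAt (isOpen_Ioo.mem_nhds hy')).congr
        ((eqOn_indicator (s := Ioo 0 L)).symm.eventuallyEq_of_mem (isOpen_Ioo.mem_nhds hy'))
      exact h2.continuousWithinAt
    · rw [ContinuousWithinAt, hd0 hy']
      have hSy : S y = 0 := by
        have : y = 0 ∨ y = L := by
          by_contra hne
          rw [not_or] at hne
          exact hy' ⟨lt_of_le_of_ne hy.1 (Ne.symm hne.1), lt_of_le_of_ne hy.2 hne.2⟩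
        rcases this with rfl | rfl
        · simp [hS]
        · simp only [hS]; rw [div_mul_cancel₀ _ hL.ne', Real.sin_pi]
      have hlim : Tendsto (fun x => K' * |S x|) (𝓝[Icc 0 L] y) (𝓝 0) := by
        have : Continuous fun x => K' * |S x| := by fun_prop
        have h := (this.tendsto y).mono_left (nhdsWithin_le_nhds (s := Icc 0 L))
        simpa [hSy] using h
      rw [tendsto_zero_iff_norm_tendsto_zero]
      exact squeeze_zero' (.of_forall fun _ => norm_nonneg _)
        (eventually_nhdsWithin_of_forall hdb) hlim
  have hcoef (n : ℤ) : ∫ x in 0..L, (Real.sin (n * Real.pi / L * x) : ℂ) * d x = 0 := by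
    set c := testCoefficient
    set l : Fin 5 → ℝ := fun i => testFrequency n i * Real.pi / L with hl
    have hΦ := isTest_test hL n
    have hΦ' := isTest_test_reflect hL n
    have hmain := integral_sinePoly_mul_reducedRepresentation hD k hL hρm hρ hFm hF hGm hG ht
      (fun i => sin_mul_length hL (testFrequency n i)) hΦ hΦ'
    set Φ := sinePoly c l with hΦdef
    have hΦS (x : ℝ) : Φ x = S x ^ 4 * Real.sin (n * Real.pi / L * x) := sinePoly_test n L x
    have hΦc : Continuous Φ := hΦ.cont
    have hΦb {x : ℝ} : |Φ x| ≤ |S x| ^ 3 := by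
      rw [hΦS, abs_mul, abs_pow]
      calc |S x| ^ 4 * |Real.sin (n * Real.pi / L * x)| = |S x| ^ 3 * |S x|
            * |Real.sin (n * Real.pi / L * x)| := by ring
        _ ≤ |S x| ^ 3 * 1 * 1 := by
          gcongr
          · exact Real.abs_sin_le_one _
          · exact Real.abs_sin_le_one _
        _ = _ := by ring
    have hiW : IntervalIntegrable (fun x => (Φ x : ℂ) * W x) volume 0 L := by
      refine intervalIntegrable_of_continuousOn_Ioo hL.le
        (B := K * (1 + 2 * (Real.pi / L) ^ 3)) (by fun_prop) fun x hx => ?_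
      rw [norm_mul, Complex.norm_real, Real.norm_eq_abs]
      exact (mul_le_mul_of_nonneg_right hΦb (norm_nonneg _)).trans (hSW hx)
    have hiu (i : Fin 5) : IntervalIntegrable
        (fun x => c i * (θ x t * (Real.exp (-(k * x)) * Real.sin (l i * x)))) volume 0 L := by
      refine (intervalIntegrable_of_continuousOn_Ioo hL.le (B := Real.exp (|k| * L) * C' * 1)
        (by fun_prop) fun x hx => ?_).const_mul _
      rw [← mul_assoc, mul_comm (θ x t), norm_mul, Real.norm_eq_abs, Real.norm_eq_abs]
      have h1 := hub x hx
      have h2 := Real.abs_sin_le_one (l i * x)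
      have h3 := (abs_nonneg _).trans h1
      gcongr
    have hΦu (x : ℝ) : Φ x * u x
        = ∑ i, c i * (θ x t * (Real.exp (-(k * x)) * Real.sin (l i * x))) := by
      rw [hΦdef, sinePoly, Finset.sum_mul]
      exact Finset.sum_congr rfl fun i _ => by simp only [hu]; ring
    have hiΦu : IntervalIntegrable (fun x => Φ x * u x) volume 0 L := by
      simp_rw [hΦu]
      have h := IntervalIntegrable.sum Finset.univ fun i _ => hiu i
      exact h.congr (fun x _ => by simp only [Finset.sum_apply])
    have hiΦu' : IntervalIntegrable (fun x => (Φ x : ℂ) * (u x : ℂ)) volume 0 L := by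
      have h : IntervalIntegrable (fun x => ((Φ x * u x : ℝ) : ℂ)) volume 0 L :=
        ⟨hiΦu.1.ofReal, hiΦu.2.ofReal⟩
      simpa only [Complex.ofReal_mul] using h
    -- The two evolutions of sine moments meet here: Green's identity for `u` and the image
    -- expansion for `W`.
    have hu' : ∫ x in 0..L, (Φ x : ℂ) * (u x : ℂ) = ∫ x in 0..L, (Φ x : ℂ) * W x := by
      simp_rw [← Complex.ofReal_mul]
      rw [intervalIntegral.integral_ofReal, hmain]
      congr 1
      simp_rw [hΦu]
      rw [intervalIntegral.integral_finsetSum fun i _ => hiu i]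
      refine Finset.sum_congr rfl fun i _ => ?_
      rw [intervalIntegral.integral_const_mul,
        hθ.sine_moment hD hL hk (testFrequency n i) (l := l i) rfl ht]
      have e1 : ∫ y in 0..L, ρ y * Real.sin (l i * y)
          = ∫ y in 0..L, θ₀ y * (Real.exp (-(k * y)) * Real.sin (l i * y)) :=
        intervalIntegral_congr_Ioo hL.le fun y hy => by rw [hρθ y hy]; ring
      have e2 : ∫ τ in 0..t, Real.exp (-(D₀ * (l i ^ 2 + k ^ 2) * (t - τ))) * F τ
          = ∫ τ in 0..t, Real.exp (-(D₀ * (l i ^ 2 + k ^ 2) * (t - τ))) * f τ :=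
        intervalIntegral_congr_Ioo ht.le fun y hy => by rw [hFf y ⟨hy.1, hy.2.le⟩]
      have e3 : ∫ τ in 0..t, Real.exp (-(D₀ * (l i ^ 2 + k ^ 2) * (t - τ))) * G τ
          = ∫ τ in 0..t, Real.exp (-(D₀ * (l i ^ 2 + k ^ 2) * (t - τ))) * g τ :=
        intervalIntegral_congr_Ioo ht.le fun y hy => by rw [hGg y ⟨hy.1, hy.2.le⟩]
      rw [e1, e2, e3]
    calc ∫ x in 0..L, (Real.sin (n * Real.pi / L * x) : ℂ) * d x
        = ∫ x in 0..L, ((Φ x : ℂ) * W x - (Φ x : ℂ) * (u x : ℂ)) := by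
          refine intervalIntegral_congr_Ioo hL.le fun x hx => ?_
          rw [hd, indicator_of_mem hx, hΦS]
          push_cast
          ring
      _ = 0 := by
          rw [intervalIntegral.integral_sub hiW hiΦu', hu', sub_self]
  have hzero := eq_zero_of_sine_coefficients hL hdc (hd0 (by simp)) (hd0 (by simp)) hcoef
    ⟨hx.1.le, hx.2.le⟩
  rw [hd, indicator_of_mem hx] at hzero
  have hSx : (S x : ℂ) ^ 4 ≠ 0 := by
    have : 0 < S x := Real.sin_pos_of_pos_of_lt_pi (mul_pos (by positivity) hx.1) (by
      rw [div_mul_eq_mul_div, div_lt_iff₀ hL]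
      exact mul_lt_mul_of_pos_left hx.2 Real.pi_pos)
    exact pow_ne_zero _ (by exact_mod_cast this.ne')
  exact sub_eq_zero.1 ((mul_eq_zero.1 hzero).resolve_left hSx)

end

end AdvectionDiffusion

namespace AdvectionDiffusion

noncomputable section

/-! ### Measurable bounded data -/

theorem measurable_indicator_of_tendsto {h : ℝ → ℝ} {v : ℕ → ℝ → ℝ} {s : Set ℝ} {C : ℝ}
    (hs : MeasurableSet s) (hv : ∀ n, ContinuousOn (v n) s)
    (hlim : ∀ x ∈ s, Tendsto (fun n => v n x) atTop (𝓝 (h x)))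
    (hb : ∀ n, ∀ x ∈ s, |v n x| ≤ C) (hC : 0 ≤ C) :
    Measurable (s.indicator h) ∧ ∀ y, |s.indicator h y| ≤ C := by
  constructor
  · refine measurable_of_tendsto_metrizable (f := fun n => s.indicator (v n)) (fun n => ?_)
      (tendsto_pi_nhds.2 fun x => ?_)
    · classical
      rw [← piecewise_eq_indicator]
      exact (hv n).measurable_piecewise continuousOn_const hs
    · by_cases hx : x ∈ s
      · simpa only [indicator_of_mem hx] using hlim x hx
      · simp only [indicator_of_notMem hx, tendsto_const_nhds]
  · intro y
    by_cases hy : y ∈ s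
    · rw [indicator_of_mem hy]
      exact le_of_tendsto (hlim y hy).abs (.of_forall fun n => hb n y hy)
    · rwa [indicator_of_notMem hy, abs_zero]

/-- The data come with no regularity assumption. They are pointwise limits of slices of `θ`, which
are continuous and uniformly bounded, and so are measurable and bounded where they matter; elsewhere
they are replaced by `0`. -/
theorem IsSolution.exists_measurable_data {D₀ K₀ L : ℝ} {θ₀ f g : ℝ → ℝ} {θ : ℝ → ℝ → ℝ}
    (hL : 0 < L) (hθ : IsSolution D₀ K₀ L θ₀ f g θ) (k : ℝ) {t : ℝ}
    (ht : 0 < t) :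
    ∃ C : ℝ, ∃ ρ F G : ℝ → ℝ, (Measurable ρ ∧ ∀ y, |ρ y| ≤ C) ∧ (Measurable F ∧ ∀ y, |F y| ≤ C) ∧
      (Measurable G ∧ ∀ y, |G y| ≤ C) ∧ (∀ y ∈ Ioo 0 L, ρ y = Real.exp (-(k * y)) * θ₀ y) ∧
      (∀ τ ∈ Ioc 0 t, F τ = f τ) ∧ ∀ τ ∈ Ioc 0 t, G τ = g τ := by
  obtain ⟨C, hC⟩ := hθ.bounded (t + 1) (by linarith)
  have hC0 : 0 ≤ C := (abs_nonneg _).trans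
    (hC (L / 2) ⟨by linarith, by linarith⟩ t ⟨ht, by linarith⟩)
  -- The factor `1/2` makes `ε n < 1` also at `n = 0`, so that `L * ε n` stays strictly inside `(0,
  -- L)` and `ε n` strictly below `t + 1`.
  set ε : ℕ → ℝ := fun n => 1 / ((n : ℝ) + 1) / 2 with hε
  have hε0 (n : ℕ) : 0 < ε n := by positivity
  have hε1 (n : ℕ) : ε n < 1 := by
    have : 1 / ((n : ℝ) + 1) ≤ 1 := by
      rw [div_le_one (by positivity)]
      linarith [(Nat.cast_nonneg n : (0 : ℝ) ≤ n)]
    simp only [hε]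
    linarith
  have hεlim : Tendsto ε atTop (𝓝 0) := by
    simpa only [zero_div] using (tendsto_one_div_add_atTop_nhds_zero_nat (𝕜 := ℝ)).div_const 2
  have hεlim' : Tendsto ε atTop (𝓝[>] 0) :=
    tendsto_nhdsWithin_iff.2 ⟨hεlim, .of_forall hε0⟩
  have hL0 (n : ℕ) : L * ε n ∈ Ioo 0 L :=
    ⟨mul_pos hL (hε0 n), by nlinarith [hε1 n]⟩
  have hL1 (n : ℕ) : L - L * ε n ∈ Ioo 0 L :=
    ⟨by linarith [(hL0 n).2], by linarith [(hL0 n).1]⟩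
  have hlimL : Tendsto (fun n => L * ε n) atTop (𝓝[>] 0) :=
    tendsto_nhdsWithin_iff.2 ⟨by simpa using hεlim.const_mul L, .of_forall fun n => (hL0 n).1⟩
  have hlimR : Tendsto (fun n => L - L * ε n) atTop (𝓝[<] L) :=
    tendsto_nhdsWithin_iff.2 ⟨by simpa using (hεlim.const_mul L).const_sub L,
      .of_forall fun n => (hL1 n).2⟩
  have hexp {x : ℝ} (hx : x ∈ Ioo 0 L) : Real.exp (-(k * x)) ≤ Real.exp (|k| * L) := by
    rw [Real.exp_le_exp]
    nlinarith [neg_abs_le k, hx.1, mul_le_mul_of_nonneg_left hx.2.le (abs_nonneg k)]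
  have hCC : C ≤ Real.exp (|k| * L) * C :=
    le_mul_of_one_le_left hC0 (Real.one_le_exp (by positivity))
  have hC0' := hC0.trans hCC
  refine ⟨Real.exp (|k| * L) * C, (Ioo 0 L).indicator fun y => Real.exp (-(k * y)) * θ₀ y,
    (Ioo 0 (t + 1)).indicator f, (Ioo 0 (t + 1)).indicator g,
    ?_, ?_, ?_, fun y hy => indicator_of_mem hy _,
    fun τ hτ => indicator_of_mem (show τ ∈ Ioo 0 (t + 1) from ⟨hτ.1, by linarith [hτ.2]⟩) _,
    fun τ hτ => indicator_of_mem (show τ ∈ Ioo 0 (t + 1) from ⟨hτ.1, by linarith [hτ.2]⟩) _⟩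
  · refine measurable_indicator_of_tendsto (v := fun n x => Real.exp (-(k * x)) * θ x (ε n))
      measurableSet_Ioo (fun n => ContinuousOn.mul (by fun_prop) (hθ.continuous.comp
        (f := fun x => (x, ε n)) (by fun_prop) fun x hx => ⟨hx, hε0 n⟩))
      (fun x hx => ((hθ.initial x hx).comp hεlim').const_mul _) (fun n x hx => ?_) hC0'
    rw [abs_mul, Real.abs_exp]
    have h1 := hexp hx
    have h2 := hC x hx _ ⟨hε0 n, by linarith [hε1 n]⟩
    gcongr
  · exact measurable_indicator_of_tendsto (v := fun n τ => θ (L * ε n) τ) measurableSet_Ioo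
      (fun n => hθ.continuous.comp (f := fun τ => (L * ε n, τ)) (by fun_prop)
        fun τ hτ => ⟨hL0 n, hτ.1⟩)
      (fun τ hτ => (hθ.left τ hτ.1).comp hlimL) (fun n τ hτ => (hC _ (hL0 n) τ hτ).trans hCC) hC0'
  · exact measurable_indicator_of_tendsto (v := fun n τ => θ (L - L * ε n) τ) measurableSet_Ioo
      (fun n => hθ.continuous.comp (f := fun τ => (L - L * ε n, τ)) (by fun_prop)
        fun τ hτ => ⟨hL1 n, hτ.1⟩)
      (fun τ hτ => (hθ.right τ hτ.1).comp hlimR) (fun n τ hτ => (hC _ (hL1 n) τ hτ).trans hCC) hC0'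

end

end AdvectionDiffusion

namespace AdvectionDiffusion

noncomputable section

/-! ### The contour integrands in the symmetric variable -/

variable {D k : ℝ}

theorem half_advection (hD : 0 < D) (k : ℝ) : 2 * D * k / (2 * D) = k :=
  mul_div_cancel_left₀ k (by positivity)

/-- The substitution `λ = μ - ik` centres the contour about the fixed point `-ik` of `ν`. -/
theorem gammaPlus_eq (hD : 0 < D) (k s : ℝ) :
    gammaPlus D (2 * D * k) s = hyp k s - Complex.I * k := by
  unfold gammaPlus hyp
  rw [half_advection hD]
  push_cast
  ring

theorem deriv_gammaPlus (hD : 0 < D) (k s : ℝ) :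
    deriv (gammaPlus D (2 * D * k)) s = deriv (hyp k) s := by
  rw [show gammaPlus D (2 * D * k) = fun s => hyp k s - Complex.I * k from
    funext (gammaPlus_eq hD k), deriv_sub_const]

theorem shift_sub (hD : 0 < D) (k : ℝ) (m : ℂ) :
    shift D ((2 * D * k : ℝ)) (m - Complex.I * k) = m := by
  have h : (((2 * D * k : ℝ) : ℂ) / (2 * D)) = k := by
    exact_mod_cast congrArg ((↑) : ℝ → ℂ) (half_advection hD k)
  rw [shift, h, sub_add_cancel]

theorem nu_sub (hD : 0 < D) (k : ℝ) (m : ℂ) :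
    nu D (2 * D * k) (m - Complex.I * k) = -m - Complex.I * k := by
  have h : (D : ℂ) ≠ 0 := by exact_mod_cast hD.ne'
  unfold nu
  push_cast
  field_simp
  ring

theorem omega_sub (D k : ℝ) (m : ℂ) :
    omega D (2 * D * k) (m - Complex.I * k) = D * (m ^ 2 + k ^ 2) := by
  unfold omega
  push_cast
  linear_combination (-(D : ℂ) * k ^ 2) * Complex.I_sq

theorem Delta_sub (hD : 0 < D) (k L : ℝ) (m : ℂ) :
    Delta D (2 * D * k) L (m - Complex.I * k)
      = -2 * Complex.I * Complex.exp (-(k * L)) * Complex.sin (L * m) := by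
  rw [Delta, nu_sub hD, Complex.sin,
    show -(Complex.I * (m - Complex.I * k) * L) = -(k * L) + -(L * m) * Complex.I by
      linear_combination (k * L : ℂ) * Complex.I_sq,
    show -(Complex.I * (-m - Complex.I * k) * L) = -(k * L) + L * m * Complex.I by
      linear_combination (k * L : ℂ) * Complex.I_sq,
    Complex.exp_add, Complex.exp_add]
  linear_combination (Complex.exp (-(k * L)) * (Complex.exp (-(L * m) * Complex.I)
    - Complex.exp (L * m * Complex.I))) * Complex.I_sq

/-- The shift by `-ik` produces `e^{-ky}`, which turns `θ₀` into the initial datum of `e^{-kx}θ`. -/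
theorem fourierHat_sub {L : ℝ} (hL : 0 ≤ L) {θ₀ ρ : ℝ → ℝ}
    (hρ : ∀ y ∈ Ioo 0 L, ρ y = Real.exp (-(k * y)) * θ₀ y) (m : ℂ) :
    fourierHat L θ₀ (m - Complex.I * k)
      = ∫ y in 0..L, Complex.exp (-(Complex.I * m * y)) * ρ y := by
  refine intervalIntegral_congr_Ioo hL fun y hy => ?_
  rw [hρ y hy, Complex.ofReal_mul, Complex.ofReal_exp, ← mul_assoc, ← Complex.exp_add]
  congr 2
  push_cast
  linear_combination (k * y : ℂ) * Complex.I_sq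

variable {L t x : ℝ} {θ₀ ρ : ℝ → ℝ}

/-- Evaluating the transform at `ν(λ)` changes `e^{-iμy}` into `e^{iμy}`, which is bounded on the
hyperbola. The constant `i/2` is `1/(-2i)` from `Delta_sub`. -/
theorem initialIntegrand₂_gammaPlus (hD : 0 < D) (hL : 0 ≤ L)
    (hρ : ∀ y ∈ Ioo 0 L, ρ y = Real.exp (-(k * y)) * θ₀ y) (s : ℝ) :
    initialIntegrand₂ D (2 * D * k) L θ₀ x t (gammaPlus D (2 * D * k) s)
        * deriv (gammaPlus D (2 * D * k)) s
      = (Complex.I / 2 * Complex.exp (k * L) * Complex.exp (-(D * t * k ^ 2)))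
        * ((∫ y in 0..L, initialDensity k (D * t) ρ s y) * sinRatio k L (L - x) s) := by
  rw [deriv_gammaPlus hD, gammaPlus_eq hD, initialIntegrand₂, omega_sub, Delta_sub hD,
    shift_sub hD, nu_sub hD, fourierHat_sub hL hρ, sinRatio]
  unfold initialDensity
  rw [intervalIntegral.integral_const_mul]
  have e1 : ∫ y in 0..L, Complex.exp (-(Complex.I * -hyp k s * y)) * ρ y
      = ∫ y in 0..L, Complex.exp (Complex.I * hyp k s * y) * ρ y := by
    simp only [mul_neg, neg_mul, neg_neg]
  rw [e1, show (-(D * (hyp k s ^ 2 + k ^ 2) * t) : ℂ)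
    = -(D * t * k ^ 2) + -(D * t : ℝ) * hyp k s ^ 2 by push_cast; ring, Complex.exp_add,
    Complex.exp_neg (k * L : ℂ)]
  push_cast
  simp only [div_eq_mul_inv, mul_inv, inv_inv, Complex.inv_I, inv_neg]
  ring

/-- Here `e^{iμL}` combines with `e^{-iμy}` to the bounded factor `e^{iμ(L-y)}`; reflecting `y`
gives the same density for the reflected datum. -/
theorem initialIntegrand₁_gammaPlus (hD : 0 < D) (hL : 0 ≤ L)
    (hρ : ∀ y ∈ Ioo 0 L, ρ y = Real.exp (-(k * y)) * θ₀ y) (s : ℝ) :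
    initialIntegrand₁ D (2 * D * k) L θ₀ x t (gammaPlus D (2 * D * k) s)
        * deriv (gammaPlus D (2 * D * k)) s
      = (Complex.I / 2 * Complex.exp (2 * k * L) * Complex.exp (-(D * t * k ^ 2)))
        * ((∫ y in 0..L, initialDensity k (D * t) (fun y => ρ (L - y)) s y)
          * sinRatio k L x s) := by
  rw [deriv_gammaPlus hD, gammaPlus_eq hD, initialIntegrand₁, omega_sub, Delta_sub hD,
    shift_sub hD, fourierHat_sub hL hρ, sinRatio]
  unfold initialDensity
  rw [intervalIntegral.integral_const_mul]
  have e1 : ∫ y in 0..L, Complex.exp (Complex.I * hyp k s * y) * ρ (L - y)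
      = Complex.exp (Complex.I * hyp k s * L)
        * ∫ y in 0..L, Complex.exp (-(Complex.I * hyp k s * y)) * ρ y := by
    have h := intervalIntegral.integral_comp_sub_left (a := 0) (b := L)
      (fun y => Complex.exp (Complex.I * hyp k s * L)
        * (Complex.exp (-(Complex.I * hyp k s * y)) * ρ y)) L
    rw [sub_self, sub_zero] at h
    rw [← intervalIntegral.integral_const_mul, ← h]
    congr 1
    ext y
    rw [← mul_assoc, ← Complex.exp_add]
    congr 2
    push_cast
    ring
  rw [e1, show (Complex.I * (hyp k s - Complex.I * k) * L - D * (hyp k s ^ 2 + k ^ 2) * t : ℂ)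
    = k * L + Complex.I * hyp k s * L + -(D * t * k ^ 2) + -(D * t : ℝ) * hyp k s ^ 2 by
      push_cast; linear_combination (-(k * L) : ℂ) * Complex.I_sq,
    Complex.exp_add, Complex.exp_add, Complex.exp_add, Complex.exp_neg (k * L : ℂ),
    show (2 * k * L : ℂ) = k * L + k * L by ring, Complex.exp_add]
  simp only [div_eq_mul_inv, mul_inv, inv_inv, Complex.inv_I, inv_neg]
  ring

/-- Merging `e^{-ωt}` with `e^{ωτ}` leaves `e^{-ω(t-τ)}`, the propagator over the remaining time. -/
theorem exp_mul_timeTransform (k : ℝ) {f F : ℝ → ℝ} (ht : 0 ≤ t)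
    (hF : ∀ τ ∈ Ioc 0 t, F τ = f τ) (s : ℝ) :
    Complex.exp (-(D * (hyp k s ^ 2 + k ^ 2) * t)) * hyp k s * deriv (hyp k) s
        * timeTransform f (D * (hyp k s ^ 2 + k ^ 2)) t
      = ∫ τ in 0..t, boundaryDensity D k F t s τ := by
  rw [timeTransform, ← intervalIntegral.integral_const_mul]
  refine intervalIntegral_congr_Ioo ht fun τ hτ => ?_
  rw [boundaryDensity, hF τ ⟨hτ.1, hτ.2.le⟩, show (-(D * (t - τ) : ℝ) * (hyp k s ^ 2 + k ^ 2) : ℂ)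
    = -(D * (hyp k s ^ 2 + k ^ 2) * t) + D * (hyp k s ^ 2 + k ^ 2) * τ by push_cast; ring,
    Complex.exp_add]
  ring

theorem leftIntegrand_gammaPlus (hD : 0 < D) {f F : ℝ → ℝ} (ht : 0 ≤ t)
    (hF : ∀ τ ∈ Ioc 0 t, F τ = f τ) (s : ℝ) :
    leftIntegrand D (2 * D * k) L f x t (gammaPlus D (2 * D * k) s)
        * deriv (gammaPlus D (2 * D * k)) s
      = (Complex.I / 2 * Complex.exp (k * L))
        * ((∫ τ in 0..t, boundaryDensity D k F t s τ) * sinRatio k L (L - x) s) := by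
  rw [deriv_gammaPlus hD, gammaPlus_eq hD, leftIntegrand, omega_sub, Delta_sub hD,
    shift_sub hD, sinRatio, ← exp_mul_timeTransform k ht hF, Complex.exp_neg (k * L : ℂ)]
  push_cast
  simp only [div_eq_mul_inv, mul_inv, inv_inv, Complex.inv_I, inv_neg]
  ring

theorem rightIntegrand_gammaPlus (hD : 0 < D) {g G : ℝ → ℝ} (ht : 0 ≤ t)
    (hG : ∀ τ ∈ Ioc 0 t, G τ = g τ) (s : ℝ) :
    rightIntegrand D (2 * D * k) L g x t (gammaPlus D (2 * D * k) s)
        * deriv (gammaPlus D (2 * D * k)) s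
      = (Complex.I / 2 * Complex.exp (k * L))
        * ((∫ τ in 0..t, boundaryDensity D k G t s τ) * sinRatio k L x s) := by
  rw [deriv_gammaPlus hD, gammaPlus_eq hD, rightIntegrand, omega_sub, Delta_sub hD,
    shift_sub hD, sinRatio, ← exp_mul_timeTransform k ht hG, Complex.exp_neg (k * L : ℂ)]
  simp only [div_eq_mul_inv, mul_inv, inv_inv, Complex.inv_I, inv_neg]
  ring

/-! ### The integral over the real line -/

/-- On the real line `λ` is not shifted, so the drift remains as the translation by `2Dkt = K₀t`. -/
theorem lineIntegrand_eq (hL : 0 ≤ L) (hρ : ∀ y ∈ Ioo 0 L, ρ y = Real.exp (-(k * y)) * θ₀ y)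
    (l : ℝ) : lineIntegrand D (2 * D * k) L θ₀ x t l
      = ∫ y in 0..L, gaussExp (D * t) (x - 2 * D * k * t - y) l
        * ((Real.exp (k * y) * ρ y : ℝ) : ℂ) := by
  rw [lineIntegrand, fourierHat, ← intervalIntegral.integral_const_mul]
  refine intervalIntegral_congr_Ioo hL fun y hy => ?_
  rw [hρ y hy, ← mul_assoc (Real.exp _), ← Real.exp_add, add_neg_cancel, Real.exp_zero, one_mul,
    ← mul_assoc, ← Complex.exp_add, gaussExp, omega]
  congr 2
  push_cast
  ring

theorem integrable_gaussExp_prod {a : ℝ} (ha : 0 < a) (z : ℝ) {h : ℝ → ℝ} {C : ℝ}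
    (hm : Measurable h) (hb : ∀ y ∈ Ioc 0 L, |h y| ≤ C) :
    Integrable (fun p : ℝ × ℝ => gaussExp a (z - p.2) p.1 * (h p.2 : ℂ))
      (volume.prod (volume.restrict (Ioc 0 L))) := by
  have h1 : Integrable (fun y => (h y : ℂ)) (volume.restrict (Ioc 0 L)) :=
    Integrable.of_bound (by fun_prop) C ((ae_restrict_mem measurableSet_Ioc).mono fun y hy => by
      rw [Complex.norm_real]; exact hb y hy)
  have h2 := (integrable_gaussExp_line ha 0).mul_prod h1
  refine h2.mono (AEStronglyMeasurable.mul ?_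
    (Complex.measurable_ofReal.comp (hm.comp measurable_snd)).aestronglyMeasurable) (.of_forall fun p => ?_)
  · unfold gaussExp
    exact Continuous.aestronglyMeasurable (by fun_prop)
  -- At a real argument the norm of `gaussExp` does not depend on the displacement, so the case of
  -- displacement `0` dominates.
  · rw [norm_mul, norm_mul]
    refine le_of_eq ?_
    congr 1
    rw [gaussExp, gaussExp, Complex.norm_exp, Complex.norm_exp]
    congr 1
    simp [pow_two]

theorem line_data (hm : Measurable ρ) {C : ℝ} (hb : ∀ y, |ρ y| ≤ C) (k L : ℝ) :
    Measurable (fun y => Real.exp (k * y) * ρ y) ∧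
      ∀ y ∈ Ioc 0 L, |Real.exp (k * y) * ρ y| ≤ Real.exp (|k| * L) * C := by
  refine ⟨by fun_prop, fun y hy => ?_⟩
  have h1 : k * y ≤ |k| * L := by
    nlinarith [le_abs_self k, hy.1, mul_le_mul_of_nonneg_left hy.2 (abs_nonneg k)]
  have h2 := hb y
  rw [abs_mul, Real.abs_exp]
  gcongr

theorem integrable_lineIntegrand (hD : 0 < D) (hL : 0 ≤ L) (ht : 0 < t) (hm : Measurable ρ)
    {C : ℝ} (hb : ∀ y, |ρ y| ≤ C) (hρ : ∀ y ∈ Ioo 0 L, ρ y = Real.exp (-(k * y)) * θ₀ y) :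
    Integrable fun l : ℝ => lineIntegrand D (2 * D * k) L θ₀ x t l := by
  obtain ⟨h1, h2⟩ := line_data hm hb k L
  have h := (integrable_gaussExp_prod (mul_pos hD ht) (x - 2 * D * k * t) h1 h2).integral_prod_left
  refine h.congr (.of_forall fun l => ?_)
  beta_reduce
  rw [lineIntegrand_eq hL hρ, intervalIntegral.integral_of_le hL]

theorem integral_lineIntegrand (hD : 0 < D) (hL : 0 ≤ L) (ht : 0 < t) (hm : Measurable ρ)
    {C : ℝ} (hb : ∀ y, |ρ y| ≤ C) (hρ : ∀ y ∈ Ioo 0 L, ρ y = Real.exp (-(k * y)) * θ₀ y) :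
    1 / (2 * Real.pi) * ∫ l : ℝ, lineIntegrand D (2 * D * k) L θ₀ x t l
      = Complex.exp (k * x) * Complex.exp (-(D * t * k ^ 2))
        * ((∫ y in 0..L, ρ y * heatKernel (D * t) (x - y) : ℝ) : ℂ) := by
  have ha := mul_pos hD ht
  obtain ⟨h1, h2⟩ := line_data hm hb k L
  simp_rw [lineIntegrand_eq hL hρ, intervalIntegral.integral_of_le hL]
  rw [integral_integral_swap (integrable_gaussExp_prod ha _ h1 h2)]
  have e : Complex.exp (k * x) * Complex.exp (-(D * t * k ^ 2))
      = ((Real.exp (k * x - D * t * k ^ 2) : ℝ) : ℂ) := by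
    rw [← Complex.exp_add]; push_cast; congr 1
  rw [e, ← integral_complex_ofReal, ← integral_const_mul, ← integral_const_mul]
  refine integral_congr_ae (.of_forall fun y => ?_)
  beta_reduce
  rw [integral_mul_const, integral_gaussExp_line ha, heatKernel]
  -- Completing the square: the drifting Gaussian, weighted by `e^{ky}`, is a centred one times a
  -- factor independent of `y`.
  have e2 : Real.exp (-(x - 2 * D * k * t - y) ^ 2 / (4 * (D * t))) * Real.exp (k * y)
      = Real.exp (k * x - D * t * k ^ 2) * Real.exp (-(x - y) ^ 2 / (4 * (D * t))) := by
    rw [← Real.exp_add, ← Real.exp_add]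
    congr 1
    field_simp
    ring
  have e3 : (2 * Real.pi)⁻¹ * (√(Real.pi / (D * t)) *
      Real.exp (-(x - 2 * D * k * t - y) ^ 2 / (4 * (D * t))) * (Real.exp (k * y) * ρ y))
      = Real.exp (k * x - D * t * k ^ 2) * (ρ y * (√(Real.pi / (D * t))
        * Real.exp (-(x - y) ^ 2 / (4 * (D * t))) / (2 * Real.pi))) := by
    linear_combination ((2 * Real.pi)⁻¹ * √(Real.pi / (D * t)) * ρ y) * e2
  rw [← Complex.ofReal_mul, ← Complex.ofReal_mul, ← e3]
  push_cast
  rw [one_div]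

end

end AdvectionDiffusion

namespace AdvectionDiffusion

noncomputable section

/-! ### The reflection `l ↦ ν(l)` -/

theorem nu_nu (D₀ K₀ : ℝ) (l : ℂ) : nu D₀ K₀ (nu D₀ K₀ l) = l := by
  unfold nu; ring

theorem Delta_nu (D₀ K₀ L : ℝ) (l : ℂ) : Delta D₀ K₀ L (nu D₀ K₀ l) = -Delta D₀ K₀ L l := by
  rw [Delta, nu_nu, Delta, neg_sub]

theorem shift_nu (D₀ K₀ : ℝ) (l : ℂ) : shift D₀ K₀ (nu D₀ K₀ l) = -shift D₀ K₀ l := by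
  unfold shift nu
  rw [show (K₀ : ℂ) / (2 * D₀) = K₀ / D₀ / 2 by rw [div_div, mul_comm]]
  ring

/-- The map `ν` reverses the direction of travel; this is the sign that enters when the contours are
exchanged. -/
theorem deriv_gammaMinus (D₀ K₀ s : ℝ) :
    deriv (gammaMinus D₀ K₀) s = -deriv (gammaPlus D₀ K₀) s := by
  rw [show gammaMinus D₀ K₀ = fun s => -gammaPlus D₀ K₀ s - Complex.I * (K₀ / D₀) from
    funext fun s => (nu_gammaPlus D₀ K₀ s).symm, deriv_sub_const, deriv.fun_neg]

variable {D₀ : ℝ}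

/-- Two factors, `1/Δ` and the sine, change sign, so the product does not; the sign of the
derivative then remains and flips the sign of the term. -/
theorem swappedIntegrand₁_nu (hD : 0 < D₀) (K₀ L : ℝ) (θ₀ : ℝ → ℝ) (x t : ℝ) (l : ℂ) :
    swappedIntegrand₁ D₀ K₀ L θ₀ x t (nu D₀ K₀ l) = initialIntegrand₁ D₀ K₀ L θ₀ x t l := by
  rw [swappedIntegrand₁, nu_nu, omega_nu hD, Delta_nu, shift_nu, mul_neg, Complex.sin_neg, div_neg,
    neg_mul_neg, initialIntegrand₁]

theorem swappedIntegrand₂_nu (hD : 0 < D₀) (K₀ L : ℝ) (θ₀ : ℝ → ℝ) (x t : ℝ) (l : ℂ) :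
    swappedIntegrand₂ D₀ K₀ L θ₀ x t (nu D₀ K₀ l) = initialIntegrand₂ D₀ K₀ L θ₀ x t l := by
  rw [swappedIntegrand₂, omega_nu hD, Delta_nu, shift_nu, mul_neg, Complex.sin_neg, div_neg,
    neg_mul_neg, initialIntegrand₂]

/-- The extra factor `μ` makes three sign changes. The total sign cancels against that of the
derivative, and the boundary terms keep their form. -/
theorem leftIntegrand_nu (hD : 0 < D₀) (K₀ L : ℝ) (f : ℝ → ℝ) (x t : ℝ) (l : ℂ) :
    leftIntegrand D₀ K₀ L f x t (nu D₀ K₀ l) = -leftIntegrand D₀ K₀ L f x t l := by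
  simp only [leftIntegrand, omega_nu hD, Delta_nu, shift_nu, mul_neg, Complex.sin_neg, div_neg,
    neg_mul, neg_neg]

theorem rightIntegrand_nu (hD : 0 < D₀) (K₀ L : ℝ) (g : ℝ → ℝ) (x t : ℝ) (l : ℂ) :
    rightIntegrand D₀ K₀ L g x t (nu D₀ K₀ l) = -rightIntegrand D₀ K₀ L g x t l := by
  simp only [rightIntegrand, omega_nu hD, Delta_nu, shift_nu, mul_neg, Complex.sin_neg, div_neg,
    neg_mul, neg_neg]

/-- An integrand that is carried by `ν` to its negative has the same integrand along both
parametrized contours. -/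
theorem integrand_gammaMinus_of_nu_neg {K₀ : ℝ} {H : ℂ → ℂ} (h : ∀ l, H (nu D₀ K₀ l) = -H l) :
    (fun s => H (gammaMinus D₀ K₀ s) * deriv (gammaMinus D₀ K₀) s)
      = fun s => H (gammaPlus D₀ K₀ s) * deriv (gammaPlus D₀ K₀) s := by
  ext s
  rw [← nu_gammaPlus, h, deriv_gammaMinus, neg_mul_neg]

theorem integrand_gammaMinus_of_nu {K₀ : ℝ} {H H' : ℂ → ℂ} (h : ∀ l, H (nu D₀ K₀ l) = H' l) :
    (fun s => H (gammaMinus D₀ K₀ s) * deriv (gammaMinus D₀ K₀) s)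
      = fun s => -(H' (gammaPlus D₀ K₀ s) * deriv (gammaPlus D₀ K₀) s) := by
  ext s
  rw [← nu_gammaPlus, h, deriv_gammaMinus, mul_neg]

theorem swappedRepresentation_gammaMinus (hD : 0 < D₀) (K₀ L : ℝ) (θ₀ f g : ℝ → ℝ) (x t : ℝ) :
    swappedRepresentation D₀ K₀ L θ₀ f g (gammaMinus D₀ K₀) x t
      = representation D₀ K₀ L θ₀ f g (gammaPlus D₀ K₀) x t := by
  unfold swappedRepresentation representation contourIntegral
  rw [integrand_gammaMinus_of_nu (swappedIntegrand₁_nu hD K₀ L θ₀ x t),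
    integrand_gammaMinus_of_nu (swappedIntegrand₂_nu hD K₀ L θ₀ x t),
    integrand_gammaMinus_of_nu_neg (leftIntegrand_nu hD K₀ L f x t),
    integrand_gammaMinus_of_nu_neg (rightIntegrand_nu hD K₀ L g x t), integral_neg, integral_neg]
  ring

theorem representation_gammaMinus_of_initial_eq_zero (hD : 0 < D₀) (K₀ : ℝ) {L : ℝ} (hL : 0 ≤ L)
    {θ₀ : ℝ → ℝ} (hθ₀ : ∀ ξ ∈ Ioo 0 L, θ₀ ξ = 0) (f g : ℝ → ℝ) (x t : ℝ) :
    representation D₀ K₀ L θ₀ f g (gammaMinus D₀ K₀) x t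
      = representation D₀ K₀ L θ₀ f g (gammaPlus D₀ K₀) x t := by
  have h (l : ℂ) : fourierHat L θ₀ l = 0 := by
    rw [fourierHat, intervalIntegral_congr_Ioo (h₂ := fun _ => 0) hL fun y hy => by
      rw [hθ₀ y hy, Complex.ofReal_zero, mul_zero], intervalIntegral.integral_zero]
  unfold representation contourIntegral
  rw [integrand_gammaMinus_of_nu_neg (leftIntegrand_nu hD K₀ L f x t),
    integrand_gammaMinus_of_nu_neg (rightIntegrand_nu hD K₀ L g x t)]
  simp only [initialIntegrand₁, initialIntegrand₂, h, mul_zero, zero_mul, integral_zero]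

/-! ### The representation -/

theorem representation_gammaPlus (hD : 0 < D₀) (k : ℝ) {L : ℝ} (hL : 0 < L)
    {θ₀ f g ρ F G : ℝ → ℝ} {C x t : ℝ} (ht : 0 < t) (hρm : Measurable ρ) (hρb : ∀ y, |ρ y| ≤ C)
    (hρ : ∀ y ∈ Ioo 0 L, ρ y = Real.exp (-(k * y)) * θ₀ y) (hF : ∀ τ ∈ Ioc 0 t, F τ = f τ)
    (hG : ∀ τ ∈ Ioc 0 t, G τ = g τ) :
    representation D₀ (2 * D₀ * k) L θ₀ f g (gammaPlus D₀ (2 * D₀ * k)) x t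
      = Real.exp (k * x) * reducedRepresentation D₀ k L ρ F G t x := by
  unfold representation contourIntegral
  simp_rw [initialIntegrand₁_gammaPlus hD hL.le hρ, initialIntegrand₂_gammaPlus hD hL.le hρ,
    leftIntegrand_gammaPlus hD ht.le hF, rightIntegrand_gammaPlus hD ht.le hG,
    integral_const_mul]
  rw [integral_lineIntegrand hD hL.le ht hρm hρb hρ, half_advection hD]
  unfold reducedRepresentation ratioIntegral
  rw [show -k * (2 * L - x) = k * x + (-(k * L) + -(k * L)) by ring,
    show -k * (L - x) = k * x + -(k * L) by ring, Real.exp_add, Real.exp_add, Real.exp_add,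
    show (2 * k * L : ℂ) = k * L + k * L by ring, Complex.exp_add]
  push_cast
  have hE : Complex.exp (k * L) * Complex.exp (-(k * L)) = 1 := by
    rw [← Complex.exp_add, add_neg_cancel, Complex.exp_zero]
  -- With the exponentials and the four contour integrals abstracted, only `E E' = 1` and `i² = -1`
  -- are needed.
  generalize Complex.exp (k * L) = E at hE ⊢
  generalize Complex.exp (-(k * L)) = E' at hE ⊢
  generalize (∫ s, (∫ y in 0..L, initialDensity k (D₀ * t) (fun y => ρ (L - y)) s y)
    * sinRatio k L x s) = J₁
  generalize (∫ s, (∫ y in 0..L, initialDensity k (D₀ * t) ρ s y) * sinRatio k L (L - x) s) = J₂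
  generalize (∫ s, (∫ τ in 0..t, boundaryDensity D₀ k F t s τ) * sinRatio k L (L - x) s) = J₃
  generalize (∫ s, (∫ τ in 0..t, boundaryDensity D₀ k G t s τ) * sinRatio k L x s) = J₄
  generalize Complex.exp (-(D₀ * t * k ^ 2)) = e
  generalize Complex.exp (k * x) = X
  linear_combination (X * e * J₁ / (2 * Real.pi) * Complex.I ^ 2 * (E * E' + 1)
      + X * e * J₂ / (2 * Real.pi) * Complex.I ^ 2
      - D₀ * Complex.I / Real.pi * X * J₃ - D₀ * Complex.I / Real.pi * X * E' * J₄) * hE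
    + (X * e * J₁ / (2 * Real.pi) + X * e * J₂ / (2 * Real.pi)) * Complex.I_sq

end

end AdvectionDiffusion

/-! ### Assembly: absolute convergence and the three formulas -/

theorem mainTheorem1 (D₀ K₀ L : ℝ) (hD : 0 < D₀) (hL : 0 < L)
    (θ₀ f g : ℝ → ℝ) (θ : ℝ → ℝ → ℝ) (hθ : IsSolution D₀ K₀ L θ₀ f g θ)
    (x : ℝ) (hx : x ∈ Ioo 0 L) (t : ℝ) (ht : 0 < t) :
    -- all integrals converge absolutely
    (Integrable (fun l : ℝ => lineIntegrand D₀ K₀ L θ₀ x t l) ∧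
      ContourIntegrable (gammaPlus D₀ K₀) (initialIntegrand₁ D₀ K₀ L θ₀ x t) ∧
      ContourIntegrable (gammaPlus D₀ K₀) (initialIntegrand₂ D₀ K₀ L θ₀ x t) ∧
      ContourIntegrable (gammaPlus D₀ K₀) (leftIntegrand D₀ K₀ L f x t) ∧
      ContourIntegrable (gammaPlus D₀ K₀) (rightIntegrand D₀ K₀ L g x t)) ∧
    -- the representation over `∂D₊`
    (θ x t : ℂ) = representation D₀ K₀ L θ₀ f g (gammaPlus D₀ K₀) x t ∧
    -- the representation over `∂D₋`
    (ContourIntegrable (gammaMinus D₀ K₀) (swappedIntegrand₁ D₀ K₀ L θ₀ x t) ∧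
      ContourIntegrable (gammaMinus D₀ K₀) (swappedIntegrand₂ D₀ K₀ L θ₀ x t) ∧
      ContourIntegrable (gammaMinus D₀ K₀) (leftIntegrand D₀ K₀ L f x t) ∧
      ContourIntegrable (gammaMinus D₀ K₀) (rightIntegrand D₀ K₀ L g x t)) ∧
    (θ x t : ℂ) = swappedRepresentation D₀ K₀ L θ₀ f g (gammaMinus D₀ K₀) x t ∧
    -- for a vanishing initial datum the two contours are interchangeable in the same formula
    ((∀ ξ ∈ Ioo 0 L, θ₀ ξ = 0) →
      (θ x t : ℂ) = representation D₀ K₀ L θ₀ f g (gammaMinus D₀ K₀) x t) := by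
  obtain ⟨k, rfl⟩ : ∃ k, K₀ = 2 * D₀ * k := ⟨K₀ / (2 * D₀), by field_simp⟩
  obtain ⟨C, ρ, F, G, ⟨hρm, hρb⟩, ⟨hFm, hFb⟩, ⟨hGm, hGb⟩, hρ, hF, hG⟩ :=
    hθ.exists_measurable_data hL k ht
  have hx0 : 0 ≤ L - x := by linarith [hx.2]
  have hx1 : L - x < L := by linarith [hx.1]
  have i₁ : ContourIntegrable (gammaPlus D₀ (2 * D₀ * k))
      (initialIntegrand₁ D₀ (2 * D₀ * k) L θ₀ x t) := by
    unfold ContourIntegrable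
    simp_rw [initialIntegrand₁_gammaPlus hD hL.le hρ]
    exact (integrable_mul_sinRatio (linearGrowth_initial k (D₀ * t)
      (hρm.comp (measurable_const.sub measurable_id)) (fun y => hρb _) hL.le) hL hx.1.le
      hx.2).const_mul _
  have i₂ : ContourIntegrable (gammaPlus D₀ (2 * D₀ * k))
      (initialIntegrand₂ D₀ (2 * D₀ * k) L θ₀ x t) := by
    unfold ContourIntegrable
    simp_rw [initialIntegrand₂_gammaPlus hD hL.le hρ]
    exact (integrable_mul_sinRatio (linearGrowth_initial k (D₀ * t) hρm hρb hL.le) hL hx0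
      hx1).const_mul _
  have i₃ : ContourIntegrable (gammaPlus D₀ (2 * D₀ * k))
      (leftIntegrand D₀ (2 * D₀ * k) L f x t) := by
    unfold ContourIntegrable
    simp_rw [leftIntegrand_gammaPlus hD ht.le hF]
    exact (integrable_mul_sinRatio (linearGrowth_boundary D₀ k hFm hFb ht.le) hL hx0
      hx1).const_mul _
  have i₄ : ContourIntegrable (gammaPlus D₀ (2 * D₀ * k))
      (rightIntegrand D₀ (2 * D₀ * k) L g x t) := by
    unfold ContourIntegrable
    simp_rw [rightIntegrand_gammaPlus hD ht.le hG]
    exact (integrable_mul_sinRatio (linearGrowth_boundary D₀ k hGm hGb ht.le) hL hx.1.le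
      hx.2).const_mul _
  have hrep : (θ x t : ℂ)
      = representation D₀ (2 * D₀ * k) L θ₀ f g (gammaPlus D₀ (2 * D₀ * k)) x t := by
    rw [representation_gammaPlus hD k hL ht hρm hρb hρ hF hG,
      hθ.reducedRepresentation_eq hD hL (half_advection hD k).symm hρm hρb hFm hFb hGm hGb ht
        hρ hF hG hx, ← Complex.ofReal_mul, ← mul_assoc, ← Real.exp_add, add_neg_cancel,
      Real.exp_zero, one_mul]
  refine ⟨⟨integrable_lineIntegrand hD hL.le ht hρm hρb hρ, i₁, i₂, i₃, i₄⟩, hrep,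
    ⟨?_, ?_, ?_, ?_⟩, ?_, fun h0 => ?_⟩
  · unfold ContourIntegrable
    rw [integrand_gammaMinus_of_nu (swappedIntegrand₁_nu hD _ L θ₀ x t)]
    exact i₁.neg
  · unfold ContourIntegrable
    rw [integrand_gammaMinus_of_nu (swappedIntegrand₂_nu hD _ L θ₀ x t)]
    exact i₂.neg
  · unfold ContourIntegrable
    rw [integrand_gammaMinus_of_nu_neg (leftIntegrand_nu hD _ L f x t)]
    exact i₃
  · unfold ContourIntegrable
    rw [integrand_gammaMinus_of_nu_neg (rightIntegrand_nu hD _ L g x t)]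
    exact i₄
  · rw [swappedRepresentation_gammaMinus hD]
    exact hrep
  · rw [representation_gammaMinus_of_initial_eq_zero hD _ hL.le h0]
    exact hrep
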